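/- **Setting.** Let $m,n,N\ge 1$ and let $\mathcal X\subseteq[0,1]^m$ be a set of $N=|\mathcal X|$ points. A dataset is $X=(x_1,\dots,x_n)\in\mathcal X^n$, with mean $\bar X=\frac1n\sum_i x_i$. In a *non-interactive protocol* $\Pi$, party $i$ (for $i=1,\dots,n$) knows only $x_i$ and public information, uses its own independent random coins, and sends one message $Z_i$ (a finite sequence of real numbers, padded by zeros) to a server, which outputs a random point $\Pi(X)\in\mathbb R^m$ computed from $Z_1,\dots,Z_n$, the public information and its own independent coins. The public information is $m,n,N,\alpha,\varepsilon$ and a list of the points of $\mathcal X$. The protocol is *$\varepsilon$-LDP* if for every $i$, all $x,x'\in\mathcal X$ and every measurable set $S$ of messages, $\Pr[Z_i\in S\mid x_i=x]\le e^{\varepsilon}\Pr[Z_i\in S\mid x_i=x']$. Its average error is $\mathrm{err}^2(\mathcal X,\Pi,n)=\max_{X\in\mathcal X^n}\left(\mathbb E\,\frac1m\|\Pi(X)-\bar X\|_2^2\right)^{1/2}$. For $t>0$ let $P(\mathcal X,t)$ be the largest size of a set $T\subseteq\mathcal X$ with $\|x-y\|_2>t\sqrt m$ for all distinct $x,y\in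 T$. Parties and server are run by fixed programs (one for all parties, one for the server, both independent of all parameters) for a real-number random access machine: unit-cost operations are $+$, truncated $-$ and comparison on integers; $+,-,\times,/,\sqrt{\ }$ and comparison on reals, with rational constants and $\pi$; indirect addressing by integers; and drawing an independent standard Gaussian or an independent uniform number in $[0,1]$. Control flow consists of branching and of loops whose number of rounds is computed on entry, each round being charged. The running time is the total number of steps of all parties and the server. **Theorem.** There are absolute constants $C,K>0$, a polynomial $p$, and two non-interactive protocols $\Pi_{CPM}$ and $\Pi_{CM}$ (local versions of the coarse projection mechanism and of the chaining mechanism) such that for all $m,n\ge1$, all finite $\mathcal X\subseteq[0,1]^m$, all $\alpha>0$ and all $0<\varepsilon\le 3/2$: both protocols are $\varepsilon$-LDP; both run in time at most $p(|\mathcal X|+n+m)$ on every dataset and for every outcome of the coins; and 1. $\mathrm{err}^2(\mathcal X,\Pi_{CPM},n)\le\alpha$ whenever $$n\ \ge\ K\,\frac{\log(1/\alpha)^2}{\alpha^4\varepsilon^2}\cdot\sup\{t^2\log P(\mathcal X,t)\;:\;t\ge\alpha/C\};$$ 2. $\mathrm{err}^2(\mathcal X,\Pi_{CM},n)\le\alpha$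 whenever $$n\ \ge\ K\,\frac{\log(1/\alpha)^6}{\alpha^4\varepsilon^2}\cdot\sup\{t^4\log P(\mathcal X,t)\;:\;t\ge\alpha/C\}.$$ -/

import Mathlib

open MeasureTheory ProbabilityTheory

noncomputable section

namespace LocalModel

/-! ## Packing numbers

The separation number of `S` in `ℝ^m` at scale `t`: the largest number of points of `S` whose
pairwise Euclidean distances are all greater than `t * √m`. -/

/-- `sepNumber S t` is the separation number `P(S, t)`, with values in `ℕ∞`
(it is finite when `S` is finite). -/
def sepNumber {m : ℕ} (S : Set (EuclideanSpace ℝ (Fin m))) (t : ℝ) : ℕ∞ :=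
  Metric.packingNumber (Real.toNNReal (t * √(m : ℝ))) S

/-- The quantity `sup { t ^ r * log P(S, t) : t ≥ s }`. -/
def packingSup {m : ℕ} (S : Set (EuclideanSpace ℝ (Fin m))) (r : ℕ) (s : ℝ) : ℝ :=
  sSup ((fun t : ℝ => t ^ r * Real.log ((sepNumber S t).toNat : ℝ)) '' Set.Ici s)

/-! ## Differential privacy -/

/-- A randomized algorithm, given by its output law on each input, is `ε`-differentially private
with respect to its (single element) input. -/
def DifferentiallyPrivate {D Y : Type*} [MeasurableSpace Y] (ε : ℝ) (M : D → Measure Y) : Prop :=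
  ∀ x x' : D, ∀ S : Set Y, MeasurableSet S → M x S ≤ ENNReal.ofReal (Real.exp ε) * M x' S

/-! ## Randomized real-number programs with a step count

A random access machine with two memories: an index memory, holding natural numbers and
supporting addition and truncated subtraction, and a real memory, holding real numbers and
supporting the field operations, square roots, comparisons, and the constants `π` and `q ∈ ℚ`.
Cells are grouped in arrays: a program names finitely many arrays and addresses their cells by
computed indices. There is no rounding from reals to indices. The random sources are
independent standard Gaussian variables and independent uniform variables on `[0,1]`. -/

/-- A random tape. Cell `k` holds the `k`-th Gaussian and the `k`-th uniform sample. -/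
abbrev Tape : Type := ℕ → ℝ × unitInterval

/-- The law of the random tape: all samples are independent, standard Gaussian in the first
component and uniform on `[0,1]` in the second one. -/
def tapeLaw : Measure Tape :=
  Measure.infinitePi fun _ : ℕ => (gaussianReal 0 1).prod (volume : Measure unitInterval)

instance : IsProbabilityMeasure tapeLaw := by unfold tapeLaw; infer_instance

/-- The state of the machine. -/
structure State where
  /-- index memory: array, cell -/
  idx : ℕ → ℕ → ℕ
  /-- real memory: array, row, column -/
  mem : ℕ → ℕ → ℕ → ℝ
  /-- number of cells of the random tape read so far -/
  pos : ℕ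
  /-- number of steps made so far -/
  time : ℕ

namespace State

/-- Charge `k` steps. -/
def tick (s : State) (k : ℕ) : State := { s with time := s.time + k }

/-- Write `v` into cell `i` of the index array `a`. -/
def writeIdx (s : State) (a i v : ℕ) : State :=
  { s with idx := fun a' i' => if a' = a ∧ i' = i then v else s.idx a' i' }

/-- Write `v` into cell `(i, j)` of the real array `a`. -/
def writeReal (s : State) (a i j : ℕ) (v : ℝ) : State :=
  { s with mem := fun a' i' j' => if a' = a ∧ i' = i ∧ j' = j then v else s.mem a' i' j' }

/-- Move on to the next cell of the random tape. -/
def advance (s : State) : State := { s with pos := s.pos + 1 }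

end State

/-- Index expressions. -/
inductive IExp where
  | lit (k : ℕ)
  | read (a : ℕ) (i : IExp)
  | add (x y : IExp)
  | sub (x y : IExp)

namespace IExp

def eval (s : State) : IExp → ℕ
  | lit k => k
  | read a i => s.idx a (i.eval s)
  | add x y => x.eval s + y.eval s
  | sub x y => x.eval s - y.eval s

/-- The number of operations in an expression, which is the cost of evaluating it. -/
def size : IExp → ℕ
  | lit _ => 1
  | read _ i => i.size + 1
  | add x y => x.size + y.size + 1
  | sub x y => x.size + y.size + 1

end IExp

/-- Real expressions. -/
inductive RExp where
  | lit (q : ℚ)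
  | pi
  | ofIdx (i : IExp)
  | read (a : ℕ) (i j : IExp)
  | add (x y : RExp)
  | sub (x y : RExp)
  | mul (x y : RExp)
  | div (x y : RExp)
  | sqrt (x : RExp)

namespace RExp

def eval (s : State) : RExp → ℝ
  | lit q => (q : ℝ)
  | pi => Real.pi
  | ofIdx i => (i.eval s : ℝ)
  | read a i j => s.mem a (i.eval s) (j.eval s)
  | add x y => x.eval s + y.eval s
  | sub x y => x.eval s - y.eval s
  | mul x y => x.eval s * y.eval s
  | div x y => x.eval s / y.eval s
  | sqrt x => √(x.eval s)

def size : RExp → ℕ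
  | lit _ => 1
  | pi => 1
  | ofIdx i => i.size + 1
  | read _ i j => i.size + j.size + 1
  | add x y => x.size + y.size + 1
  | sub x y => x.size + y.size + 1
  | mul x y => x.size + y.size + 1
  | div x y => x.size + y.size + 1
  | sqrt x => x.size + 1

end RExp

/-- Tests. -/
inductive BExp where
  | ile (x y : IExp)
  | rle (x y : RExp)
  | not (b : BExp)
  | and (b c : BExp)

namespace BExp

def eval (s : State) : BExp → Prop
  | ile x y => x.eval s ≤ y.eval s
  | rle x y => x.eval s ≤ y.eval s
  | not b => ¬ b.eval s
  | and b c => b.eval s ∧ c.eval s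

def size : BExp → ℕ
  | ile x y => x.size + y.size + 1
  | rle x y => x.size + y.size + 1
  | not b => b.size + 1
  | and b c => b.size + c.size + 1

end BExp

/-- Programs. In `loop a e c` the body `c` is executed `k` times, where `k` is the value of `e`
on entering the loop; cell `0` of the index array `a` is set to `0, 1, …, k - 1` in turn at the
start of the rounds. -/
inductive Cmd where
  | skip
  | setIdx (a : ℕ) (i e : IExp)
  | setReal (a : ℕ) (i j : IExp) (e : RExp)
  | gauss (a : ℕ) (i j : IExp)
  | unif (a : ℕ) (i j : IExp)
  | seq (c d : Cmd)
  | ite (b : BExp) (c d : Cmd)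
  | loop (a : ℕ) (e : IExp) (c : Cmd)

open Classical in
/-- Run a program on the random tape `ω`. Every instruction, every evaluated operation and every
round of a loop is charged. -/
def Cmd.exec (ω : Tape) : Cmd → State → State
  | .skip, s => s.tick 1
  | .setIdx a i e, s => (s.writeIdx a (i.eval s) (e.eval s)).tick (i.size + e.size + 1)
  | .setReal a i j e, s =>
      (s.writeReal a (i.eval s) (j.eval s) (e.eval s)).tick (i.size + j.size + e.size + 1)
  | .gauss a i j, s =>
      ((s.writeReal a (i.eval s) (j.eval s) (ω s.pos).1).advance).tick (i.size + j.size + 1)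
  | .unif a i j, s =>
      ((s.writeReal a (i.eval s) (j.eval s) ((ω s.pos).2 : ℝ)).advance).tick
        (i.size + j.size + 1)
  | .seq c d, s => d.exec ω (c.exec ω s)
  | .ite b c d, s =>
      if b.eval s then c.exec ω (s.tick (b.size + 1)) else d.exec ω (s.tick (b.size + 1))
  | .loop a e c, s =>
      (List.range (e.eval s)).foldl (fun s' v => c.exec ω ((s'.writeIdx a 0 v).tick 1))
        (s.tick (e.size + 1))

/-! ## Non-interactive protocols for the mean point problem

The universe is a finite set of points of `ℝ^m`, listed without repetition as `u : Fin N → ℝ^m`.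
Both the parties and the server are given `m`, `N`, `n`, `α`, `ε` and the list `u`. Party `i` is
also given its number `i` and its own point, and sends one message, a sequence of reals, to the
server; the server is also given the `n` messages. -/

/-- The state in which a program is started: index array `0` holds `m, N, n` and the number of
the party, real array `0` holds `α` and `ε`, real array `1` holds the universe, real array `2`
holds the input `priv`, and all other cells are zero. -/
def initState {m N : ℕ} (u : Fin N → EuclideanSpace ℝ (Fin m)) (n : ℕ) (α ε : ℝ)
    (party : ℕ) (priv : ℕ → ℕ → ℝ) : State where
  idx := fun a i =>
    match a, i with
    | 0, 0 => m
    | 0, 1 => N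
    | 0, 2 => n
    | 0, 3 => party
    | _, _ => 0
  mem := fun a i j =>
    match a, i, j with
    | 0, 0, 0 => α
    | 0, 0, 1 => ε
    | 1, i, j => if h : i < N ∧ j < m then u ⟨i, h.1⟩ ⟨j, h.2⟩ else 0
    | 2, i, j => priv i j
    | _, _, _ => 0
  pos := 0
  time := 0

/-- The starting state of party `i`, whose point is `x`. -/
def partyState {m N : ℕ} (u : Fin N → EuclideanSpace ℝ (Fin m)) (n : ℕ) (α ε : ℝ)
    (i : Fin n) (x : EuclideanSpace ℝ (Fin m)) : State :=
  initState u n α ε i fun r j => if h : r = 0 ∧ j < m then x ⟨j, h.2⟩ else 0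

/-- The starting state of the server, which has received the messages `z`. -/
def serverState {m N : ℕ} (u : Fin N → EuclideanSpace ℝ (Fin m)) (n : ℕ) (α ε : ℝ)
    (z : Fin n → ℕ → ℝ) : State :=
  initState u n α ε n fun r j => if h : r < n then z ⟨r, h⟩ j else 0

/-- A non-interactive protocol: the program run by the parties and the program run by the
server. The output of a program is row `0` of the real array `3`. -/
structure Protocol where
  client : Cmd
  server : Cmd

namespace Protocol

variable {m N : ℕ} (Q : Protocol) (u : Fin N → EuclideanSpace ℝ (Fin m)) (n : ℕ) (α ε : ℝ)

/-- The final state of party `i` with point `x`, when its random tape is `ω`. -/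
def partyRun (i : Fin n) (x : EuclideanSpace ℝ (Fin m)) (ω : Tape) : State :=
  Q.client.exec ω (partyState u n α ε i x)

/-- The message sent by party `i`. -/
def message (i : Fin n) (x : EuclideanSpace ℝ (Fin m)) (ω : Tape) : ℕ → ℝ :=
  (Q.partyRun u n α ε i x ω).mem 3 0

/-- The law of the message sent by party `i` holding the point `x`. -/
def messageLaw (i : Fin n) (x : EuclideanSpace ℝ (Fin m)) : Measure (ℕ → ℝ) :=
  tapeLaw.map (Q.message u n α ε i x)

/-- Every party has its own random tape, and so has the server; all are independent. -/
def coinLaw (n : ℕ) : Measure ((Fin n → Tape) × Tape) :=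
  (Measure.pi fun _ : Fin n => tapeLaw).prod tapeLaw

/-- The final state of the server, on the dataset whose `i`-th element is `X i`. -/
def serverRun (X : Fin n → EuclideanSpace ℝ (Fin m)) (ω : (Fin n → Tape) × Tape) : State :=
  Q.server.exec ω.2 (serverState u n α ε fun i => Q.message u n α ε i (X i) (ω.1 i))

/-- The point of `ℝ^m` output by the server. -/
def output (X : Fin n → EuclideanSpace ℝ (Fin m)) (ω : (Fin n → Tape) × Tape) :
    EuclideanSpace ℝ (Fin m) :=
  WithLp.toLp 2 fun j => (Q.serverRun u n α ε X ω).mem 3 0 j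

/-- The law of the output. -/
def outputLaw (X : Fin n → EuclideanSpace ℝ (Fin m)) : Measure (EuclideanSpace ℝ (Fin m)) :=
  (coinLaw n).map (Q.output u n α ε X)

/-- The running time: the total number of steps of all the parties and the server. -/
def totalTime (X : Fin n → EuclideanSpace ℝ (Fin m)) (ω : (Fin n → Tape) × Tape) : ℕ :=
  (∑ i : Fin n, (Q.partyRun u n α ε i (X i) (ω.1 i)).time) + (Q.serverRun u n α ε X ω).time

/-- `ε`-local differential privacy on the universe listed by `u`, where `ε` is the parameter
given to the protocol. -/
def IsLDP : Prop :=
  ∀ i : Fin n, DifferentiallyPrivate ε fun k : Fin N => Q.messageLaw u n α ε i (u k)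

/-- The average error on the dataset `X`: the square root of the expected value of
`‖output - mean of X‖₂² / m`. -/
def errAt (X : Fin n → EuclideanSpace ℝ (Fin m)) : ENNReal :=
  (∫⁻ z, ENNReal.ofReal (‖z - (n : ℝ)⁻¹ • ∑ i, X i‖ ^ 2 / m) ∂(Q.outputLaw u n α ε X)) ^
    (1 / 2 : ℝ)

/-- The average error on the universe listed by `u`: the maximum of the errors on all datasets
of `n` elements of the universe, repetitions allowed. -/
def err : ENNReal :=
  ⨆ a : Fin n → Fin N, Q.errAt u n α ε fun i => u (a i)

end Protocol

/-! ## Measurability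

The message and the output of a program are random variables, so that the laws above are
probability measures. -/

namespace State

def toProd (s : State) : (ℕ → ℕ → ℕ) × (ℕ → ℕ → ℕ → ℝ) × ℕ × ℕ := (s.idx, s.mem, s.pos, s.time)

instance : MeasurableSpace State := MeasurableSpace.comap toProd inferInstance

end State

section Measurability

variable {Ω : Type*} [MeasurableSpace Ω]

theorem measurable_apply {β : Type*} [MeasurableSpace β] {f : Ω → ℕ → β} {g : Ω → ℕ}
    (hf : Measurable f) (hg : Measurable g) : Measurable fun w => f w (g w) := by
  have h : Measurable fun p : (ℕ → β) × ℕ => p.1 p.2 :=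
    measurable_from_prod_countable_left fun k => measurable_pi_apply k
  exact h.comp (hf.prodMk hg)

namespace State

theorem measurable_toProd : Measurable toProd := comap_measurable _

theorem measurable_idx : Measurable State.idx := measurable_fst.comp measurable_toProd

theorem measurable_mem : Measurable State.mem :=
  (measurable_fst.comp measurable_snd).comp measurable_toProd

theorem measurable_pos : Measurable State.pos :=
  (measurable_fst.comp (measurable_snd.comp measurable_snd)).comp measurable_toProd

theorem measurable_time : Measurable State.time :=
  (measurable_snd.comp (measurable_snd.comp measurable_snd)).comp measurable_toProd

theorem measurable_mk {f : Ω → ℕ → ℕ → ℕ} {g : Ω → ℕ → ℕ → ℕ → ℝ} {p t : Ω → ℕ}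
    (hf : Measurable f) (hg : Measurable g) (hp : Measurable p) (ht : Measurable t) :
    Measurable fun w => State.mk (f w) (g w) (p w) (t w) :=
  measurable_comap_iff.2 (hf.prodMk (hg.prodMk (hp.prodMk ht)))

variable {σ : Ω → State}

theorem measurable_tick (hσ : Measurable σ) (k : ℕ) : Measurable fun w => (σ w).tick k :=
  measurable_mk (measurable_idx.comp hσ) (measurable_mem.comp hσ) (measurable_pos.comp hσ)
    ((measurable_time.comp hσ).add_const k)

theorem measurable_advance (hσ : Measurable σ) : Measurable fun w => (σ w).advance :=
  measurable_mk (measurable_idx.comp hσ) (measurable_mem.comp hσ)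
    ((measurable_pos.comp hσ).add_const 1) (measurable_time.comp hσ)

theorem measurable_writeIdx (hσ : Measurable σ) (a : ℕ) {i v : Ω → ℕ} (hi : Measurable i)
    (hv : Measurable v) : Measurable fun w => (σ w).writeIdx a (i w) (v w) := by
  refine measurable_mk ?_ (measurable_mem.comp hσ) (measurable_pos.comp hσ)
    (measurable_time.comp hσ)
  refine measurable_pi_lambda _ fun a' => measurable_pi_lambda _ fun i' => ?_
  refine Measurable.ite ?_ hv
    ((measurable_pi_apply i').comp ((measurable_pi_apply a').comp (measurable_idx.comp hσ)))
  exact (MeasurableSet.const _).inter (measurableSet_eq_fun measurable_const hi)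

theorem measurable_writeReal (hσ : Measurable σ) (a : ℕ) {i j : Ω → ℕ} {v : Ω → ℝ}
    (hi : Measurable i) (hj : Measurable j) (hv : Measurable v) :
    Measurable fun w => (σ w).writeReal a (i w) (j w) (v w) := by
  refine measurable_mk (measurable_idx.comp hσ) ?_ (measurable_pos.comp hσ)
    (measurable_time.comp hσ)
  refine measurable_pi_lambda _ fun a' => measurable_pi_lambda _ fun i' =>
    measurable_pi_lambda _ fun j' => ?_
  refine Measurable.ite ?_ hv ((measurable_pi_apply j').comp ((measurable_pi_apply i').comp
    ((measurable_pi_apply a').comp (measurable_mem.comp hσ))))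
  exact (MeasurableSet.const _).inter
    ((measurableSet_eq_fun measurable_const hi).inter (measurableSet_eq_fun measurable_const hj))

end State

variable {σ : Ω → State}

theorem IExp.measurable_eval (hσ : Measurable σ) (e : IExp) :
    Measurable fun w => e.eval (σ w) := by
  induction e with
  | lit k => exact measurable_const
  | read a i ih =>
      exact measurable_apply ((measurable_pi_apply a).comp (State.measurable_idx.comp hσ)) ih
  | add x y hx hy => exact hx.add hy
  | sub x y hx hy => exact hx.sub hy

theorem RExp.measurable_eval (hσ : Measurable σ) (e : RExp) :
    Measurable fun w => e.eval (σ w) := by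
  induction e with
  | lit q => exact measurable_const
  | pi => exact measurable_const
  | ofIdx i => exact (measurable_from_top (f := fun k : ℕ => (k : ℝ))).comp (i.measurable_eval hσ)
  | read a i j =>
      exact measurable_apply (measurable_apply
        ((measurable_pi_apply a).comp (State.measurable_mem.comp hσ)) (i.measurable_eval hσ))
        (j.measurable_eval hσ)
  | add x y hx hy => exact hx.add hy
  | sub x y hx hy => exact hx.sub hy
  | mul x y hx hy => exact hx.mul hy
  | div x y hx hy => exact hx.div hy
  | sqrt x hx => exact hx.sqrt

theorem BExp.measurableSet_eval (hσ : Measurable σ) (b : BExp) :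
    MeasurableSet {w | b.eval (σ w)} := by
  induction b with
  | ile x y => exact measurableSet_le (x.measurable_eval hσ) (y.measurable_eval hσ)
  | rle x y => exact measurableSet_le (x.measurable_eval hσ) (y.measurable_eval hσ)
  | not b hb => exact hb.compl
  | and b c hb hc => exact hb.inter hc

/-- The final state of a program is a measurable function of the random tape and the starting
state. -/
theorem Cmd.measurable_exec {τ : Ω → Tape} (hτ : Measurable τ) (c : Cmd) {σ : Ω → State}
    (hσ : Measurable σ) : Measurable fun w => c.exec (τ w) (σ w) := by
  have hcell : ∀ {σ : Ω → State}, Measurable σ → Measurable fun w => τ w (σ w).pos :=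
    fun hσ => measurable_apply hτ (State.measurable_pos.comp hσ)
  induction c generalizing σ with
  | skip => exact State.measurable_tick hσ 1
  | setIdx a i e =>
      exact State.measurable_tick
        (State.measurable_writeIdx hσ a (i.measurable_eval hσ) (e.measurable_eval hσ)) _
  | setReal a i j e =>
      exact State.measurable_tick (State.measurable_writeReal hσ a (i.measurable_eval hσ)
        (j.measurable_eval hσ) (e.measurable_eval hσ)) _
  | gauss a i j =>
      exact State.measurable_tick (State.measurable_advance (State.measurable_writeReal hσ a
        (i.measurable_eval hσ) (j.measurable_eval hσ) (measurable_fst.comp (hcell hσ)))) _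
  | unif a i j =>
      exact State.measurable_tick (State.measurable_advance (State.measurable_writeReal hσ a
        (i.measurable_eval hσ) (j.measurable_eval hσ)
        (measurable_subtype_coe.comp (measurable_snd.comp (hcell hσ))))) _
  | seq c d hc hd => exact hd (hc hσ)
  | ite b c d hc hd =>
      exact Measurable.ite (b.measurableSet_eval hσ) (hc (State.measurable_tick hσ _))
        (hd (State.measurable_tick hσ _))
  | loop a e c hc =>
      have h : ∀ k : ℕ, Measurable fun w => (List.range k).foldl
          (fun s' v => c.exec (τ w) ((s'.writeIdx a 0 v).tick 1)) ((σ w).tick (e.size + 1)) := by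
        intro k
        induction k with
        | zero => exact State.measurable_tick hσ _
        | succ k ih =>
            simp only [List.range_succ, List.foldl_append, List.foldl_cons, List.foldl_nil]
            exact hc (State.measurable_tick
              (State.measurable_writeIdx ih a measurable_const measurable_const) 1)
      exact measurable_apply (measurable_pi_lambda _ h : Measurable fun w (k : ℕ) => _)
        (e.measurable_eval hσ)

end Measurability

namespace Protocol

variable {m N : ℕ} (Q : Protocol) (u : Fin N → EuclideanSpace ℝ (Fin m)) (n : ℕ) (α ε : ℝ)

theorem measurable_message (i : Fin n) (x : EuclideanSpace ℝ (Fin m)) :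
    Measurable (Q.message u n α ε i x) :=
  (measurable_pi_apply 0).comp ((measurable_pi_apply 3).comp (State.measurable_mem.comp
    (Q.client.measurable_exec measurable_id measurable_const)))

theorem measurable_output (X : Fin n → EuclideanSpace ℝ (Fin m)) :
    Measurable (Q.output u n α ε X) := by
  refine (WithLp.measurable_toLp 2 (Fin m → ℝ)).comp (measurable_pi_lambda _ fun j => ?_)
  refine (measurable_pi_apply (j : ℕ)).comp ((measurable_pi_apply 0).comp
    ((measurable_pi_apply 3).comp (State.measurable_mem.comp
      (Q.server.measurable_exec measurable_snd ?_))))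
  refine State.measurable_mk measurable_const ?_ measurable_const measurable_const
  refine measurable_pi_lambda _ fun a => measurable_pi_lambda _ fun r =>
    measurable_pi_lambda _ fun c => ?_
  by_cases ha : a = 2
  · subst ha
    by_cases hr : r < n
    · simp only [hr, dite_true]
      exact (measurable_pi_apply c).comp
        ((Q.measurable_message u n α ε ⟨r, hr⟩ (X ⟨r, hr⟩)).comp
          ((measurable_pi_apply (⟨r, hr⟩ : Fin n)).comp measurable_fst))
    · simp [hr]
  · split <;> first | exact measurable_const | exact absurd rfl ha

instance (i : Fin n) (x : EuclideanSpace ℝ (Fin m)) :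
    IsProbabilityMeasure (Q.messageLaw u n α ε i x) :=
  Measure.isProbabilityMeasure_map (Q.measurable_message u n α ε i x).aemeasurable

instance : IsProbabilityMeasure (coinLaw n) := by unfold coinLaw; infer_instance

instance (X : Fin n → EuclideanSpace ℝ (Fin m)) :
    IsProbabilityMeasure (Q.outputLaw u n α ε X) :=
  Measure.isProbabilityMeasure_map (Q.measurable_output u n α ε X).aemeasurable

end Protocol

end LocalModel

end

/-! A single protocol, `chainingProtocol`, serves as both mechanisms. Its error is bounded for
arbitrary weights on the levels of a chain of nets, and the two sample complexities come from two
choices of the weights.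

Chain. Take greedy nets of the universe at the scales r = 2^(-v), down to about α/2, with L levels.
At scale 1 every point is sent to the first listed point, so up to distance α√m/2 each point is that
first point plus L increments. The increment at scale r has norm at most (3/2) r √m and takes at
most P(r/2)^2 values. It therefore suffices to estimate the mean increment of every level.

Messages. A party divides its increments by their scales, stacks them, and adds one coordinate that
makes the norm of the resulting vector T exactly (3/2)√(Lm). It draws a Gaussian vector g
independent of its point and sends g, without the last coordinate, times a bit that equals the sign
of ⟨T, g⟩ with probability 1/2 + ε/8. The point influences only this bit, whence privacy
(`measure_randomizedSign_le`). Reflection symmetry makes the mean of bit times g a multiple of T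
(`integral_sgn_mul_inner`), and the multiple is public because the norm of T is. So rescaled sums of
messages are unbiased, and along each fixed direction their noise is sub-Gaussian with parameter of
order L m r^2/(ε^2 n) (`integral_exp_response_sub_le`, `mul_serverScale_sq`).

Projection. In full norm this noise is too large, so the server approximately projects each estimate
to the convex hull of the increments of its level, by n Frank-Wolfe steps. With μ the true mean, the
squared error is at most twice the maximum of the noise against the vectors d_i - μ, plus O(r^2 m/n)
(`FrankWolfe.norm_sub_sq_le`). There are at most P(r/2)^2 such vectors, of norm at most 3r√m, so the
expected squared error is of order m W_v √L/(ε√n) with W_v = r^2 √(log P(r/2))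
(`exists_max_inner_le`, `exists_level_error_le`).

Summation. Weighted Cauchy-Schwarz over the levels asks that (∑ q_v)(∑ W_v/q_v)√L be at most a
constant times α^2 ε √n (`chainingProtocol_errAt_le`). If S_k is the supremum of t^k log P(t), then
W_v ≤ 2r√S_2 decays geometrically, and q_v = (3/4)^v leaves √(L S_2). Also W_v ≤ 4√S_4, and q_v = 1
leaves L^(5/2) √S_4. Since L = O(log(1/α)), both bounds follow for α < 1/2. For larger α the centre
of the cube is output.

The programs are verified by loop invariants, with frame conditions read off from their syntax. The
running time is polynomial because every loop is bounded by m, N or n (`Cmd.exec_time_le`). -/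

noncomputable section

namespace LocalModel

/-! ## Reasoning about programs -/

namespace State

variable (s : State) (k a i j v : ℕ) (x : ℝ)

@[simp] theorem tick_idx : (s.tick k).idx = s.idx := rfl
@[simp] theorem tick_mem : (s.tick k).mem = s.mem := rfl
@[simp] theorem tick_pos : (s.tick k).pos = s.pos := rfl
@[simp] theorem writeIdx_mem : (s.writeIdx a i v).mem = s.mem := rfl
@[simp] theorem writeReal_idx : (s.writeReal a i j x).idx = s.idx := rfl
@[simp] theorem writeReal_pos : (s.writeReal a i j x).pos = s.pos := rfl
@[simp] theorem advance_idx : s.advance.idx = s.idx := rfl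
@[simp] theorem advance_mem : s.advance.mem = s.mem := rfl
@[simp] theorem advance_pos : s.advance.pos = s.pos + 1 := rfl

@[simp] theorem writeIdx_idx (a' i' : ℕ) :
    (s.writeIdx a i v).idx a' i' = if a' = a ∧ i' = i then v else s.idx a' i' := rfl

@[simp] theorem writeReal_mem (a' i' j' : ℕ) :
    (s.writeReal a i j x).mem a' i' j' = if a' = a ∧ i' = i ∧ j' = j then x else s.mem a' i' j' :=
  rfl

theorem tick_tick (l : ℕ) : (s.tick k).tick l = s.tick (k + l) := by
  simp [tick, add_assoc]

theorem writeIdx_idx_of_ne {b : ℕ} (h : b ≠ a) : (s.writeIdx a i v).idx b = s.idx b := by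
  funext c; simp [h]

theorem writeReal_mem_of_ne {b : ℕ} (h : b ≠ a) : (s.writeReal a i j x).mem b = s.mem b := by
  funext c d; simp [h]

end State

/-- Two states agree on all index arrays outside `A` and all real arrays outside `B`. -/
structure Frame (A B : List ℕ) (s t : State) : Prop where
  idx : ∀ a, a ∉ A → t.idx a = s.idx a
  mem : ∀ b, b ∉ B → t.mem b = s.mem b

namespace Frame

variable {A B A' B' : List ℕ} {s t w : State}

theorem trans (h : Frame A B s t) (h' : Frame A B t w) : Frame A B s w :=
  ⟨fun a ha => (h'.idx a ha).trans (h.idx a ha), fun b hb => (h'.mem b hb).trans (h.mem b hb)⟩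

theorem mono (h : Frame A B s t) (hA : ∀ a ∈ A, a ∈ A') (hB : ∀ b ∈ B, b ∈ B') :
    Frame A' B' s t :=
  ⟨fun a ha => h.idx a fun h' => ha (hA a h'), fun b hb => h.mem b fun h' => hb (hB b h')⟩

end Frame

theorem foldl_range_induction {σ : Type*} (f : σ → ℕ → σ) (I : ℕ → σ → Prop) (s : σ) (k : ℕ)
    (h0 : I 0 s) (hs : ∀ v < k, ∀ t, I v t → I (v + 1) (f t v)) :
    I k ((List.range k).foldl f s) := by
  induction k with
  | zero => exact h0
  | succ k ih =>
      rw [List.range_succ, List.foldl_append]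
      exact hs k k.lt_succ_self _ (ih fun v hv => hs v (hv.trans k.lt_succ_self))

/-! ### Footprints of programs, and rules for loops. -/

namespace Cmd

/-- The index arrays to which a program may write. -/
def idxOut : Cmd → List ℕ
  | skip => []
  | setIdx a _ _ => [a]
  | setReal _ _ _ _ => []
  | gauss _ _ _ => []
  | unif _ _ _ => []
  | seq c d => c.idxOut ++ d.idxOut
  | ite _ c d => c.idxOut ++ d.idxOut
  | loop a _ c => a :: c.idxOut

/-- The real arrays to which a program may write. -/
def realOut : Cmd → List ℕ
  | skip => []
  | setIdx _ _ _ => []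
  | setReal a _ _ _ => [a]
  | gauss a _ _ => [a]
  | unif a _ _ => [a]
  | seq c d => c.realOut ++ d.realOut
  | ite _ c d => c.realOut ++ d.realOut
  | loop _ _ c => c.realOut

/-- The program has no instruction that draws a random number. -/
def CoinFree : Cmd → Prop
  | skip => True
  | setIdx _ _ _ => True
  | setReal _ _ _ _ => True
  | gauss _ _ _ => False
  | unif _ _ _ => False
  | seq c d => c.CoinFree ∧ d.CoinFree
  | ite _ c d => c.CoinFree ∧ d.CoinFree
  | loop _ _ c => c.CoinFree

/-- The footprint is syntactic, so for concrete programs the preservation of an array becomes a list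
membership that `simp` decides. All later verification rests on this. -/
theorem exec_frame (ω : Tape) (c : Cmd) (s : State) :
    Frame c.idxOut c.realOut s (c.exec ω s) := by
  induction c generalizing s with
  | skip => exact ⟨fun _ _ => rfl, fun _ _ => rfl⟩
  | setIdx a i e =>
      exact ⟨fun b hb => State.writeIdx_idx_of_ne _ _ _ _ (by simpa [idxOut] using hb),
        fun _ _ => rfl⟩
  | setReal a i j e =>
      exact ⟨fun _ _ => rfl,
        fun b hb => State.writeReal_mem_of_ne _ _ _ _ _ (by simpa [realOut] using hb)⟩
  | gauss a i j =>
      exact ⟨fun _ _ => rfl,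
        fun b hb => State.writeReal_mem_of_ne _ _ _ _ _ (by simpa [realOut] using hb)⟩
  | unif a i j =>
      exact ⟨fun _ _ => rfl,
        fun b hb => State.writeReal_mem_of_ne _ _ _ _ _ (by simpa [realOut] using hb)⟩
  | seq c d hc hd =>
      exact ((hc s).mono (by simp +contextual [idxOut]) (by simp +contextual [realOut])).trans
        ((hd _).mono (by simp +contextual [idxOut]) (by simp +contextual [realOut]))
  | ite b c d hc hd =>
      have ht : Frame (ite b c d).idxOut (ite b c d).realOut s (s.tick (b.size + 1)) :=
        ⟨fun _ _ => rfl, fun _ _ => rfl⟩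
      refine ht.trans ?_
      unfold exec
      split
      · refine Frame.mono (s := s.tick (b.size + 1)) (hc _) ?_ ?_ <;> simp +contextual [idxOut, realOut]
      · refine Frame.mono (s := s.tick (b.size + 1)) (hd _) ?_ ?_ <;> simp +contextual [idxOut, realOut]
  | loop a e c hc =>
      refine foldl_range_induction _ (fun _ t => Frame (a :: c.idxOut) c.realOut s t) _ _
        ⟨fun _ _ => rfl, fun _ _ => rfl⟩ fun v _ t ht => ht.trans ?_
      have h1 : Frame (a :: c.idxOut) c.realOut t ((t.writeIdx a 0 v).tick 1) :=
        ⟨fun b hb => State.writeIdx_idx_of_ne _ _ _ _ (fun h => hb (by simp [h])), fun _ _ => rfl⟩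
      exact h1.trans ((hc _).mono (by simp +contextual) (by simp +contextual))

/-- Needed to know that the preparatory part of a party's program leaves the tape untouched, so that
its Gaussians are the cells 0, 1, 2, … of the tape. -/
theorem exec_pos (ω : Tape) (c : Cmd) (hc : c.CoinFree) (s : State) :
    (c.exec ω s).pos = s.pos := by
  induction c generalizing s with
  | skip => rfl
  | setIdx a i e => rfl
  | setReal a i j e => rfl
  | gauss a i j => exact hc.elim
  | unif a i j => exact hc.elim
  | seq c d ihc ihd => exact (ihd hc.2 _).trans (ihc hc.1 s)
  | ite b c d ihc ihd =>
      unfold exec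
      split
      · exact ihc hc.1 _
      · exact ihd hc.2 _
  | loop a e c ih =>
      exact foldl_range_induction _ (fun _ (t : State) => t.pos = s.pos) _ _ rfl
        fun v _ t ht => (ih hc _).trans ht

/-- The invariant rule for loops. -/
theorem exec_loop (ω : Tape) (a : ℕ) (e : IExp) (c : Cmd) (s : State) (I : ℕ → State → Prop)
    (hI : ∀ v t t', t'.mem = t.mem → t'.pos = t.pos → (∀ b, b ≠ a → t'.idx b = t.idx b) →
      I v t → I v t')
    (h0 : I 0 s)
    (hstep : ∀ v, v < e.eval s → ∀ t, Frame (a :: c.idxOut) c.realOut s t → t.idx a 0 = v →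
      I v t → I (v + 1) (c.exec ω t)) :
    I (e.eval s) ((loop a e c).exec ω s) := by
  -- The frame relative to the start of the loop is carried along with the invariant. Each round may
  -- then use that everything outside the footprint still has its initial value.
  refine (foldl_range_induction _
    (fun v t => Frame (a :: c.idxOut) c.realOut s t ∧ I v t) (s.tick (e.size + 1)) _
    ⟨⟨fun _ _ => rfl, fun _ _ => rfl⟩, hI _ s _ rfl rfl (fun _ _ => rfl) h0⟩ fun v hv t ht => ?_).2
  have h1 : Frame (a :: c.idxOut) c.realOut t ((t.writeIdx a 0 v).tick 1) :=
    ⟨fun b hb => State.writeIdx_idx_of_ne _ _ _ _ (fun h => hb (by simp [h])), fun _ _ => rfl⟩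
  exact ⟨(ht.1.trans h1).trans ((exec_frame ω c _).mono (by simp +contextual)
      (by simp +contextual)),
    hstep v hv _ (ht.1.trans h1) (by simp)
      (hI v t _ rfl rfl (fun b hb => State.writeIdx_idx_of_ne _ _ _ _ hb) ht.2)⟩

theorem exec_seq (ω : Tape) (c d : Cmd) (s : State) :
    (seq c d).exec ω s = d.exec ω (c.exec ω s) := rfl

theorem exec_skip (ω : Tape) (s : State) : skip.exec ω s = s.tick 1 := rfl

theorem exec_ite_pos (ω : Tape) {b : BExp} {s : State} (h : b.eval s) (c d : Cmd) :
    (ite b c d).exec ω s = c.exec ω (s.tick (b.size + 1)) := by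
  rw [exec, if_pos h]

theorem exec_ite_neg (ω : Tape) {b : BExp} {s : State} (h : ¬ b.eval s) (c d : Cmd) :
    (ite b c d).exec ω s = d.exec ω (s.tick (b.size + 1)) := by
  rw [exec, if_neg h]

/-- Store `∑ v < k, x` in cell `(i, j)` of the real array `a`. -/
def sumInto (lv : ℕ) (k : IExp) (a : ℕ) (i j : IExp) (x : RExp) : Cmd :=
  seq (setReal a i j (.lit 0)) (loop lv k (setReal a i j (.add (.read a i j) x)))

/-- The hypotheses express that the address and the bound do not react to the cells being written.
The bound is evaluated after the accumulator is cleared but before the counter moves, hence its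
smaller frame. -/
theorem exec_sumInto (ω : Tape) (lv : ℕ) (k : IExp) (a : ℕ) (i j : IExp) (x : RExp) (s : State)
    (f : ℕ → ℝ) (hi : ∀ t, Frame [lv] [a] s t → i.eval t = i.eval s)
    (hj : ∀ t, Frame [lv] [a] s t → j.eval t = j.eval s)
    (hk : ∀ t, Frame [] [a] s t → k.eval t = k.eval s)
    (hx : ∀ v, v < k.eval s → ∀ t, Frame [lv] [a] s t → t.idx lv 0 = v → x.eval t = f v) :
    ((sumInto lv k a i j x).exec ω s).mem a = fun p q =>
      if p = i.eval s ∧ q = j.eval s then ∑ v ∈ Finset.range (k.eval s), f v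
      else s.mem a p q := by
  set s1 := (setReal a i j (.lit 0)).exec ω s with hs1
  have hf : Frame [] [a] s s1 := exec_frame ω (setReal a i j (.lit 0)) s
  have hf' : Frame [lv] [a] s s1 := hf.mono (by simp) (by simp)
  have key := exec_loop ω lv k (setReal a i j (.add (.read a i j) x)) s1
    (fun v t => t.mem a = fun p q => if p = i.eval s ∧ q = j.eval s then
      ∑ v ∈ Finset.range v, f v else s.mem a p q)
    (fun v t t' hm _ _ h => by simpa [hm] using h)
    (by funext p q; simp [hs1, exec, RExp.eval])
    (fun v hv t hfr htv ht => by
      rw [hk s1 hf] at hv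
      have hfr' : Frame [lv] [a] s t := hf'.trans (hfr.mono (by simp [idxOut]) (by simp [realOut]))
      funext p q
      simp only [exec, State.tick_mem, State.writeReal_mem, true_and, RExp.eval, hi t hfr',
        hj t hfr', ht, hx v hv t hfr' htv, Finset.sum_range_succ]
      by_cases h : p = i.eval s ∧ q = j.eval s <;> simp [h])
  rw [hk s1 hf] at key
  exact key

/-- Store the values of `x` in cells `(i, j)` of the real array `a`, where `j` runs through
an interval of length `k`. -/
theorem exec_fill (ω : Tape) (lv : ℕ) (k : IExp) (a : ℕ) (i j : IExp) (x : RExp) (s : State)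
    (b : ℕ) (f : ℕ → ℝ) (hi : ∀ t, Frame [lv] [a] s t → i.eval t = i.eval s)
    (hj : ∀ v, v < k.eval s → ∀ t, Frame [lv] [a] s t → t.idx lv 0 = v → j.eval t = b + v)
    (hx : ∀ v, v < k.eval s → ∀ t, Frame [lv] [a] s t → t.idx lv 0 = v →
      t.mem a (i.eval s) (b + v) = s.mem a (i.eval s) (b + v) → x.eval t = f v) :
    ((loop lv k (setReal a i j x)).exec ω s).mem a = fun p q =>
      if p = i.eval s ∧ b ≤ q ∧ q < b + k.eval s then f (q - b) else s.mem a p q := by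
  refine exec_loop ω lv k _ s
    (fun v t => t.mem a = fun p q => if p = i.eval s ∧ b ≤ q ∧ q < b + v then f (q - b)
      else s.mem a p q)
    (fun v t t' hm _ _ h => by simpa [hm] using h) ?_ ?_
  · funext p q
    rw [if_neg (by omega)]
  · intro v hv t hfr htv ht
    have hfr' : Frame [lv] [a] s t := hfr.mono (by simp [idxOut]) (by simp [realOut])
    -- The cell about to be written has not been reached yet, so it still has its old value. This
    -- allows in-place updates, where `x` reads the cell that it replaces.
    have hxv := hx v hv t hfr' htv (by rw [ht]; simp)
    funext p q
    simp only [exec, State.tick_mem, State.writeReal_mem, true_and, hi t hfr', hj v hv t hfr' htv,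
      ht, hxv]
    by_cases h : p = i.eval s ∧ q = b + v
    · rw [if_pos h, if_pos ⟨h.1, by omega, by omega⟩, h.2, Nat.add_sub_cancel_left]
    · rw [if_neg h]
      by_cases h2 : p = i.eval s ∧ b ≤ q ∧ q < b + v
      · rw [if_pos h2, if_pos ⟨h2.1, h2.2.1, by omega⟩]
      · rw [if_neg h2, if_neg (by omega)]

/-! ### Running time -/

/-- All loops of the program run `m`, `N` or `n` times, and it does not change these numbers. -/
def Tame : Cmd → Prop
  | skip => True
  | setIdx a _ _ => a ≠ 0
  | setReal _ _ _ _ => True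
  | gauss _ _ _ => True
  | unif _ _ _ => True
  | seq c d => c.Tame ∧ d.Tame
  | ite _ c d => c.Tame ∧ d.Tame
  | loop a e c => a ≠ 0 ∧ (∃ k < 3, e = .read 0 (.lit k)) ∧ c.Tame

/-- A polynomial bound on the running time of a tame program. -/
def costPoly : Cmd → Polynomial ℕ
  | skip => 1
  | setIdx _ i e => ((i.size + e.size + 1 : ℕ) : Polynomial ℕ)
  | setReal _ i j e => ((i.size + j.size + e.size + 1 : ℕ) : Polynomial ℕ)
  | gauss _ i j => ((i.size + j.size + 1 : ℕ) : Polynomial ℕ)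
  | unif _ i j => ((i.size + j.size + 1 : ℕ) : Polynomial ℕ)
  | seq c d => c.costPoly + d.costPoly
  | ite b c d => ((b.size + 1 : ℕ) : Polynomial ℕ) + c.costPoly + d.costPoly
  | loop _ e c => ((e.size + 1 : ℕ) : Polynomial ℕ) + Polynomial.X * (1 + c.costPoly)

theorem Tame.idx_zero {c : Cmd} (hc : c.Tame) : 0 ∉ c.idxOut := by
  induction c with
  | skip => simp [idxOut]
  | setIdx a i e => simpa [idxOut] using Ne.symm hc
  | setReal a i j e => simp [idxOut]
  | gauss a i j => simp [idxOut]
  | unif a i j => simp [idxOut]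
  | seq c d ihc ihd => simpa [idxOut] using ⟨ihc hc.1, ihd hc.2⟩
  | ite b c d ihc ihd => simpa [idxOut] using ⟨ihc hc.1, ihd hc.2⟩
  | loop a e c ih => simpa [idxOut] using ⟨Ne.symm hc.1, ih hc.2.2⟩

/-- Loop bounds are read from index array `0`, which a tame program never writes, so each nesting of
loops costs one factor `M` on every tape. Both branches of a test are charged in the polynomial. -/
theorem exec_time_le (ω : Tape) (c : Cmd) (hc : c.Tame) (M : ℕ) (s : State)
    (hM : ∀ k < 3, s.idx 0 k ≤ M) : (c.exec ω s).time ≤ s.time + c.costPoly.eval M := by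
  induction c generalizing s with
  | skip => simp [exec, costPoly, State.tick]
  | setIdx a i e => simp [exec, costPoly, State.tick, State.writeIdx]
  | setReal a i j e => simp [exec, costPoly, State.tick, State.writeReal]
  | gauss a i j => simp [exec, costPoly, State.tick, State.writeReal, State.advance]
  | unif a i j => simp [exec, costPoly, State.tick, State.writeReal, State.advance]
  | seq c d ihc ihd =>
      have h1 := ihc hc.1 s hM
      have h2 := ihd hc.2 (c.exec ω s) (by
        rw [(exec_frame ω c s).idx 0 hc.1.idx_zero]; exact hM)
      simp only [exec, costPoly, Polynomial.eval_add]
      omega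
  | ite b c d ihc ihd =>
      have h1 := ihc hc.1 (s.tick (b.size + 1)) hM
      have h2 := ihd hc.2 (s.tick (b.size + 1)) hM
      simp only [State.tick] at h1 h2
      simp only [exec, costPoly, Polynomial.eval_add, Polynomial.eval_natCast, State.tick,
        Nat.cast_id]
      split <;> omega
  | loop a e c ih =>
      obtain ⟨ha, ⟨k, hk, rfl⟩, hc⟩ := hc
      have key := foldl_range_induction
        (fun s' v => c.exec ω ((s'.writeIdx a 0 v).tick 1))
        (fun v t => t.idx 0 = s.idx 0 ∧
          t.time ≤ s.time + ((IExp.read 0 (.lit k)).size + 1) + v * (1 + c.costPoly.eval M))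
        (s.tick ((IExp.read 0 (.lit k)).size + 1)) (s.idx 0 k)
        ⟨rfl, by simp [State.tick]⟩ (fun v _ t ht => by
          have h0 : ((t.writeIdx a 0 v).tick 1).idx 0 = s.idx 0 :=
            (State.writeIdx_idx_of_ne _ _ _ _ (Ne.symm ha)).trans ht.1
          refine ⟨((exec_frame ω c _).idx 0 hc.idx_zero).trans h0, ?_⟩
          refine (ih hc _ (by rw [h0]; exact hM)).trans ?_
          have := ht.2
          simp only [State.tick, State.writeIdx, add_mul, one_mul] at this ⊢
          omega)
      have h2 := Nat.mul_le_mul_right (1 + c.costPoly.eval M) (hM k hk)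
      refine key.2.trans ?_
      simp only [costPoly, Polynomial.eval_add, Polynomial.eval_mul, Polynomial.eval_X,
        Polynomial.eval_one, Polynomial.eval_natCast, Nat.cast_id]
      omega

end Cmd

/-! ## Subroutines -/

/-- The index cell `(a, 0)`. -/
abbrev icell (a : ℕ) : IExp := .read a (.lit 0)

/-- The real cell `(a, 0, 0)`. -/
abbrev rcell (a : ℕ) : RExp := .read a (.lit 0) (.lit 0)

/-- The square of an expression. -/
abbrev RExp.sq (x : RExp) : RExp := .mul x x

/-- The number of coordinates. -/
abbrev dimCell : IExp := .read 0 (.lit 0)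

/-- The size of the universe. -/
abbrev univCell : IExp := .read 0 (.lit 1)

/-- The number of parties. -/
abbrev partiesCell : IExp := .read 0 (.lit 2)

namespace Cmd

/-- Store the squared distances of the points of the universe in the real array `4`. -/
def distances : Cmd :=
  loop 1 univCell (loop 2 univCell (sumInto 3 dimCell 4 (icell 1) (icell 2)
    (.sq (.sub (.read 1 (icell 1) (icell 3)) (.read 1 (icell 2) (icell 3))))))

theorem exec_distances (ω : Tape) (s : State) (i j : ℕ) (hi : i < s.idx 0 1)
    (hj : j < s.idx 0 1) :
    (distances.exec ω s).mem 4 i j =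
      ∑ l ∈ Finset.range (s.idx 0 0), (s.mem 1 i l - s.mem 1 j l) ^ 2 := by
  refine exec_loop ω 1 univCell _ s
    (fun v t => ∀ i j, i < v → j < s.idx 0 1 → t.mem 4 i j =
      ∑ l ∈ Finset.range (s.idx 0 0), (s.mem 1 i l - s.mem 1 j l) ^ 2)
    (fun v t t' hm _ _ h => by simpa [hm] using h) (by simp) ?_ i j hi hj
  intro v _ t hf hv ih
  have key := exec_loop ω 2 univCell (sumInto 3 dimCell 4 (icell 1) (icell 2)
    (.sq (.sub (.read 1 (icell 1) (icell 3)) (.read 1 (icell 2) (icell 3))))) t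
    (fun w t' => (∀ i j, i < v → j < s.idx 0 1 → t'.mem 4 i j =
      ∑ l ∈ Finset.range (s.idx 0 0), (s.mem 1 i l - s.mem 1 j l) ^ 2) ∧
      ∀ j, j < w → t'.mem 4 v j =
      ∑ l ∈ Finset.range (s.idx 0 0), (s.mem 1 v l - s.mem 1 j l) ^ 2)
    (fun v t t' hm _ _ h => by simpa [hm] using h) ⟨ih, by simp⟩ ?_
  · intro i j hi hj
    rcases Nat.lt_succ_iff_lt_or_eq.1 hi with h | rfl
    · exact key.1 i j h hj
    · refine key.2 j ?_
      have h0 : t.idx 0 = s.idx 0 := hf.idx 0 (by simp [sumInto, idxOut])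
      simpa only [IExp.eval, h0] using hj
  · intro w hw t' hf' hw' ih'
    have hf1 : Frame [1, 2, 3] [4] s t := hf.mono (by simp [sumInto, idxOut])
      (by simp [sumInto, realOut])
    have hf2 : Frame [1, 2, 3] [4] s t' := hf1.trans
      (hf'.mono (by simp [sumInto, idxOut]) (by simp [sumInto, realOut]))
    have h1 : t'.idx 1 0 = v := by
      rw [hf'.idx 1 (by simp [sumInto, idxOut]), hv]
    rw [exec_sumInto ω 3 dimCell 4 (icell 1) (icell 2) _ t'
      (fun l => (s.mem 1 v l - s.mem 1 w l) ^ 2)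
      (fun t hf => by simp [IExp.eval, hf.idx]) (fun t hf => by simp [IExp.eval, hf.idx])
      (fun t hf => by simp [IExp.eval, hf.idx])
      (fun l _ t'' hf'' hl => by
        simp [RExp.eval, IExp.eval, hf''.idx, hf''.mem, hl, h1, hw', hf2.mem, sq])]
    simp only [IExp.eval, h1, hw', hf2.idx 0 (by simp)]
    refine ⟨fun i j hi hj => ?_, fun j hj => ?_⟩
    · rw [if_neg (by omega)]
      exact ih'.1 i j hi hj
    · by_cases h : j = w
      · simp [h]
      · rw [if_neg (by simp [h])]
        exact ih'.2 j (by omega)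

/-- The number of halvings, at most `k`, after which `1` is at most `x`. -/
def _root_.LocalModel.numHalvings (x : ℝ) : ℕ → ℕ
  | 0 => 0
  | k + 1 => if x < (1 / 2) ^ numHalvings x k then numHalvings x k + 1 else numHalvings x k

/-- Count the levels in the index cell `(10, 0)`, and set the scale in the real cell `(5, 0, 0)`
to `1`. -/
def countLevels : Cmd :=
  seq (seq (setReal 5 (.lit 0) (.lit 0) (.lit 1))
    (loop 1 partiesCell (ite (.not (.rle (rcell 5) (.div (rcell 0) (.lit 2))))
      (seq (setReal 5 (.lit 0) (.lit 0) (.div (rcell 5) (.lit 2)))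
        (setIdx 10 (.lit 0) (.add (icell 10) (.lit 1)))) skip)))
    (setReal 5 (.lit 0) (.lit 0) (.lit 1))

/-- Reals cannot be rounded to indices, so the number of levels is found by counting halvings. The
only loop bounds available are `m`, `N` and `n`, which is why the count is capped at `n`. -/
theorem exec_countLevels (ω : Tape) (s : State) (hs : s.idx 10 0 = 0) :
    (countLevels.exec ω s).idx 10 0 = numHalvings (s.mem 0 0 0 / 2) (s.idx 0 2) ∧
      (countLevels.exec ω s).mem 5 0 0 = 1 := by
  refine ⟨?_, by simp [countLevels, exec, RExp.eval, IExp.eval]⟩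
  set s1 := (setReal 5 (.lit 0) (.lit 0) (.lit 1)).exec ω s with hs1
  have hf : Frame [] [5] s s1 := exec_frame ω (setReal 5 (.lit 0) (.lit 0) (.lit 1)) s
  have key := exec_loop ω 1 partiesCell (ite (.not (.rle (rcell 5) (.div (rcell 0) (.lit 2))))
      (seq (setReal 5 (.lit 0) (.lit 0) (.div (rcell 5) (.lit 2)))
        (setIdx 10 (.lit 0) (.add (icell 10) (.lit 1)))) skip) s1
    (fun v t => t.idx 10 0 = numHalvings (s.mem 0 0 0 / 2) v ∧
      t.mem 5 0 0 = (1 / 2) ^ numHalvings (s.mem 0 0 0 / 2) v)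
    (fun v t t' hm _ hi h => by simpa [hm, hi] using h)
    (by simp [hs1, exec, RExp.eval, IExp.eval, numHalvings, hs]) (by
      intro v _ t hft _ ⟨h1, h2⟩
      have h3 : t.mem 0 0 0 = s.mem 0 0 0 := by
        rw [hft.mem 0 (by simp [realOut]), hf.mem 0 (by simp)]
      by_cases h : s.mem 0 0 0 / 2 < (1 / 2) ^ numHalvings (s.mem 0 0 0 / 2) v
      · simp only [exec, BExp.eval, RExp.eval, IExp.eval, h3, h2, not_le]
        rw [if_pos (by simpa using h)]
        have h' : s.mem 0 0 0 / 2 < (2 ^ numHalvings (s.mem 0 0 0 / 2) v)⁻¹ := by simpa using h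
        simp [numHalvings, h1, h2, pow_succ, if_pos h']
        ring
      · simp only [exec, BExp.eval, RExp.eval, IExp.eval, h3, h2, not_le]
        rw [if_neg (by simpa using h)]
        have h' : ¬ s.mem 0 0 0 / 2 < (2 ^ numHalvings (s.mem 0 0 0 / 2) v)⁻¹ := by
          simpa using h
        simp [numHalvings, h1, h2, if_neg h'])
  have h2 : partiesCell.eval s1 = s.idx 0 2 := rfl
  rw [h2] at key
  exact key.1

/-- `p` assigns to every `i < N` the last earlier point of the greedy net that is close to `i`,
and `i` itself, which is then a point of the net, if there is none. The points of the net are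
those `j` with `j ≤ p j`. -/
def _root_.LocalModel.IsNet (N : ℕ) (Q : ℕ → ℕ → Prop) (p : ℕ → ℕ) : Prop :=
  ∀ i < N, (p i = i ∧ ∀ j < i, j ≤ p j → ¬ Q i j) ∨
    (p i < i ∧ p i ≤ p (p i) ∧ Q i (p i) ∧ ∀ j, p i < j → j < i → j ≤ p j → ¬ Q i j)

/-- Compute in the index array `P` the greedy net at scale `x`. -/
def netInto (P : ℕ) (x : RExp) : Cmd :=
  loop 1 univCell (seq (setIdx P (icell 1) (icell 1))
    (loop 2 univCell (ite (.and (.ile (.add (icell 2) (.lit 1)) (icell 1))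
      (.and (.ile (icell 2) (.read P (icell 2)))
        (.rle (.read 4 (icell 1) (icell 2)) (.mul (.sq x) (.ofIdx dimCell)))))
      (setIdx P (icell 1) (icell 2)) skip)))

theorem exec_netInto (ω : Tape) (P : ℕ) (x : RExp) (s : State) (r : ℝ) (hP0 : P ≠ 0) (hP1 : P ≠ 1)
    (hP2 : P ≠ 2) (hx : ∀ t, Frame [1, P, 2] [] s t → x.eval t = r) :
    IsNet (s.idx 0 1) (fun i j => s.mem 4 i j ≤ r ^ 2 * (s.idx 0 0 : ℝ))
      ((netInto P x).exec ω s |>.idx P) := by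
  set Q : ℕ → ℕ → Prop := fun i j => s.mem 4 i j ≤ r ^ 2 * (s.idx 0 0 : ℝ) with hQ
  refine exec_loop ω 1 univCell _ s (fun v t => IsNet v Q (t.idx P))
    (fun v t t' _ _ hi h => by simpa [hi P hP1] using h) (by simp [IsNet]) ?_
  intro v hv t hf hv1 ih
  rw [exec_seq]
  set t1 := (setIdx P (icell 1) (icell 1)).exec ω t with ht1
  have hf1 : Frame [P] [] t t1 := exec_frame ω (setIdx P (icell 1) (icell 1)) t
  have ht1P : ∀ i, t1.idx P i = if i = v then v else t.idx P i := fun i => by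
    simp [ht1, exec, IExp.eval, hv1]
  have hfs1 : Frame [1, P, 2] [] s t1 := Frame.trans (hf.mono (by simp [idxOut])
    (by simp [realOut])) (hf1.mono (by simp) (by simp))
  -- Before round `w`, the entry of `v` is the last net point below `min v w` that is close to `v`,
  -- or `v` itself by default. Entries other than that of `v` do not change, so tests on earlier
  -- points see their final values.
  have key := exec_loop ω 2 univCell (ite (.and (.ile (.add (icell 2) (.lit 1)) (icell 1))
      (.and (.ile (icell 2) (.read P (icell 2)))
        (.rle (.read 4 (icell 1) (icell 2)) (.mul (.sq x) (.ofIdx dimCell)))))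
      (setIdx P (icell 1) (icell 2)) skip) t1
    (fun w t' => (∀ i, i ≠ v → t'.idx P i = t.idx P i) ∧
      ((t'.idx P v = v ∧ ∀ j < v, j < w → j ≤ t.idx P j → ¬ Q v j) ∨
        (t'.idx P v < v ∧ t'.idx P v ≤ t.idx P (t'.idx P v) ∧ Q v (t'.idx P v) ∧
          ∀ j, t'.idx P v < j → j < w → j < v → j ≤ t.idx P j → ¬ Q v j)))
    (fun w t t' _ _ hi h => by simpa [hi P hP2] using h)
    ⟨fun i hi => by simp [ht1P, hi], Or.inl ⟨by simp [ht1P], by simp⟩⟩ (by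
      intro w hw t' hf' hw2 ⟨h1, h2⟩
      have hfs : Frame [1, P, 2] [] s t' := hfs1.trans (hf'.mono (by simp [idxOut])
        (by simp [realOut]))
      have hv1' : t'.idx 1 0 = v := by
        rw [hf'.idx 1 (by simp [idxOut, hP1.symm]), hf1.idx 1 (by simp [hP1.symm]), hv1]
      have h0 : t'.idx 0 = s.idx 0 := hfs.idx 0 (by simp [hP0.symm])
      have h4 : t'.mem 4 = s.mem 4 := hfs.mem 4 (by simp)
      simp only [exec, BExp.eval, RExp.eval, IExp.eval, hv1', hw2, h0, h4, hx t' hfs, ← sq]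
      by_cases hc : w + 1 ≤ v ∧ w ≤ t'.idx P w ∧ s.mem 4 v w ≤ r ^ 2 * (s.idx 0 0 : ℝ)
      · rw [if_pos hc]
        have hwv : w ≠ v := by omega
        simp only [State.tick_idx, State.writeIdx_idx, hv1', hw2, true_and]
        refine ⟨fun i hi => by simp [hi, h1 i hi], Or.inr ?_⟩
        simp only [if_true]
        exact ⟨by omega, by rw [← h1 w hwv]; exact hc.2.1, hc.2.2, fun j _ _ => by omega⟩
      · rw [if_neg hc]
        simp only [State.tick_idx]
        have hnew : w < v → w ≤ t.idx P w → ¬ Q v w := fun hwv hw3 hq =>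
          hc ⟨hwv, by rw [h1 w hwv.ne]; exact hw3, hq⟩
        refine ⟨h1, h2.imp (fun h => ⟨h.1, fun j hj hjw => ?_⟩)
          (fun h => ⟨h.1, h.2.1, h.2.2.1, fun j hj hjw hjv => ?_⟩)⟩
        · rcases Nat.lt_succ_iff_lt_or_eq.1 hjw with h' | rfl
          · exact h.2 j hj h'
          · exact hnew hj
        · rcases Nat.lt_succ_iff_lt_or_eq.1 hjw with h' | rfl
          · exact h.2.2.2 j hj h' hjv
          · exact hnew hjv)
  have hN : univCell.eval t1 = s.idx 0 1 := by
    simp only [IExp.eval, hfs1.idx 0 (by simp [hP0.symm])]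
  rw [hN] at key
  have hvN : v < s.idx 0 1 := hv
  obtain ⟨k1, k2⟩ := key
  intro i hi
  rcases Nat.lt_succ_iff_lt_or_eq.1 hi with h | rfl
  · rw [k1 i h.ne]
    rcases ih i h with ⟨ha, hb⟩ | ⟨ha, hb, hc, hd⟩
    · exact Or.inl ⟨ha, fun j hj hj' => hb j hj (by rwa [k1 j (by omega)] at hj')⟩
    · exact Or.inr ⟨ha, hb.trans_eq (k1 _ (by omega)).symm, hc,
        fun j hj hji hj' => hd j hj hji (by rwa [k1 j (by omega)] at hj')⟩
  · rcases k2 with ⟨ha, hb⟩ | ⟨ha, hb, hc, hd⟩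
    · exact Or.inl ⟨ha, fun j hj hj' => hb j hj (by omega) (by rwa [k1 j (by omega)] at hj')⟩
    · exact Or.inr ⟨ha, hb.trans_eq (k1 _ (by omega)).symm, hc,
        fun j hj hji hj' => hd j hj (by omega) hji (by rwa [k1 j (by omega)] at hj')⟩

end Cmd

/-! ## Greedy nets -/

theorem IsNet.congr {N : ℕ} {Q Q' : ℕ → ℕ → Prop} {p : ℕ → ℕ} (h : IsNet N Q p)
    (hQ : ∀ i < N, ∀ j < N, (Q i j ↔ Q' i j)) : IsNet N Q' p := by
  intro i hi
  rcases h i hi with ⟨h1, h2⟩ | ⟨h1, h2, h3, h4⟩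
  · exact Or.inl ⟨h1, fun j hj hj' => by rw [← hQ i hi j (hj.trans hi)]; exact h2 j hj hj'⟩
  · exact Or.inr ⟨h1, h2, (hQ i hi _ (h1.trans hi)).1 h3, fun j hj hji hj' => by
      rw [← hQ i hi j (hji.trans hi)]; exact h4 j hj hji hj'⟩

/-- The value at an index is forced by the values at smaller indices. Hence the nets computed by all
parties and by the server coincide with the chosen `netMap`. -/
theorem IsNet.unique {N : ℕ} {Q : ℕ → ℕ → Prop} {p q : ℕ → ℕ} (hp : IsNet N Q p)
    (hq : IsNet N Q q) : ∀ i < N, p i = q i := by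
  intro i
  induction i using Nat.strong_induction_on with
  | _ i ih =>
    intro hi
    have ih' : ∀ j < i, p j = q j := fun j hj => ih j hj (hj.trans hi)
    rcases hp i hi with ⟨h1, h2⟩ | ⟨h1, h2, h3, h4⟩ <;>
      rcases hq i hi with ⟨k1, k2⟩ | ⟨k1, k2, k3, k4⟩
    · rw [h1, k1]
    · exact absurd k3 (h2 _ k1 (by rw [ih' _ k1]; exact k2))
    · exact absurd h3 (k2 _ h1 (by rw [← ih' _ h1]; exact h2))
    · rcases lt_trichotomy (p i) (q i) with h | h | h
      · exact absurd k3 (h4 _ h k1 (by rw [ih' _ k1]; exact k2))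
      · exact h
      · exact absurd h3 (k4 _ h h1 (by rw [← ih' _ h1]; exact h2))

theorem IsNet.exists (N : ℕ) (Q : ℕ → ℕ → Prop) : ∃ p, IsNet N Q p := by
  classical
  induction N with
  | zero => exact ⟨id, fun i hi => absurd hi (Nat.not_lt_zero i)⟩
  | succ N ih =>
    obtain ⟨p, hp⟩ := ih
    have hext : ∀ k, ∀ i, i < N → Function.update p N k i = p i := fun k i hi =>
      Function.update_of_ne hi.ne _ _
    have hold : ∀ k, IsNet N Q (Function.update p N k) := by
      intro k i hi
      rw [hext k i hi]
      rcases hp i hi with ⟨h1, h2⟩ | ⟨h1, h2, h3, h4⟩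
      · exact Or.inl ⟨h1, fun j hj hj' => h2 j hj (by rwa [hext k j (hj.trans hi)] at hj')⟩
      · exact Or.inr ⟨h1, by rw [hext k _ (h1.trans hi)]; exact h2, h3,
          fun j hj hji hj' => h4 j hj hji (by rwa [hext k j (hji.trans hi)] at hj')⟩
    by_cases hne : ∃ j < N, j ≤ p j ∧ Q N j
    -- The greatest candidate is taken because the program overwrites earlier hits, so that the last
    -- one survives.
    · set k := Nat.findGreatest (fun j => j < N ∧ j ≤ p j ∧ Q N j) N with hk
      obtain ⟨j, hj⟩ := hne
      have hspec : k < N ∧ k ≤ p k ∧ Q N k :=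
        Nat.findGreatest_spec (P := fun j => j < N ∧ j ≤ p j ∧ Q N j) hj.1.le hj
      refine ⟨Function.update p N k, fun i hi => ?_⟩
      rcases Nat.lt_succ_iff_lt_or_eq.1 hi with h | rfl
      · exact hold k i h
      · refine Or.inr ?_
        rw [Function.update_self, hext k k hspec.1]
        refine ⟨hspec.1, hspec.2.1, hspec.2.2, fun j hj hji hj' hq => ?_⟩
        rw [hext k j hji] at hj'
        exact Nat.findGreatest_is_greatest hj hji.le ⟨hji, hj', hq⟩
    · refine ⟨Function.update p N N, fun i hi => ?_⟩
      rcases Nat.lt_succ_iff_lt_or_eq.1 hi with h | rfl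
      · exact hold N i h
      · refine Or.inl ⟨Function.update_self _ _ _, fun j hj hj' hq => hne ⟨j, hj, ?_, hq⟩⟩
        rwa [hext _ j hj] at hj'

/-- The squared distance of two points of a list of points. -/
def sqDist (m : ℕ) (U : ℕ → ℕ → ℝ) (i j : ℕ) : ℝ :=
  ∑ l ∈ Finset.range m, (U i l - U j l) ^ 2

/-- The greedy net at scale `r`: every index is sent to that of a nearby point of the net. -/
def netMap (m N : ℕ) (U : ℕ → ℕ → ℝ) (r : ℝ) : ℕ → ℕ :=
  (IsNet.exists N fun i j => sqDist m U i j ≤ r ^ 2 * m).choose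

theorem isNet_netMap (m N : ℕ) (U : ℕ → ℕ → ℝ) (r : ℝ) :
    IsNet N (fun i j => sqDist m U i j ≤ r ^ 2 * m) (netMap m N U r) :=
  (IsNet.exists N fun i j => sqDist m U i j ≤ r ^ 2 * m).choose_spec

/-- The difference of the approximations of the point `i` at the scales `r / 2` and `r`. -/
def increment (m N : ℕ) (U : ℕ → ℕ → ℝ) (r : ℝ) (i l : ℕ) : ℝ :=
  U (netMap m N U (r / 2) i) l - U (netMap m N U r i) l

/-- `c` is a possible result of `t` steps of the Frank-Wolfe algorithm for the projection of `y`
to the convex hull of the first `N` rows of `d`, started at `0`. -/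
inductive FrankWolfe (m N : ℕ) (d : ℕ → ℕ → ℝ) (y : ℕ → ℝ) : ℕ → (ℕ → ℝ) → Prop
  | zero (c : ℕ → ℝ) (hc : ∀ j < m, c j = 0) : FrankWolfe m N d y 0 c
  | succ (t i : ℕ) (c c' : ℕ → ℝ) (h : FrankWolfe m N d y t c) (hi : i < N)
      (hmin : ∀ i' < N, ∑ j ∈ Finset.range m, (c j - y j) * d i j ≤
        ∑ j ∈ Finset.range m, (c j - y j) * d i' j)
      (hc' : ∀ j < m, c' j = c j + 2 / ((t : ℝ) + 2) * (d i j - c j)) :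
      FrankWolfe m N d y (t + 1) c'

/-- Memory outside the `N` by `m` block may contain anything. This lemma passes from arrays of the
machine to the mathematical increments, which agree with them only inside the block. -/
theorem FrankWolfe.congr {m N : ℕ} {d d' : ℕ → ℕ → ℝ} {y y' : ℕ → ℝ} {t : ℕ} {c : ℕ → ℝ}
    (h : FrankWolfe m N d y t c) (hd : ∀ i < N, ∀ j < m, d i j = d' i j)
    (hy : ∀ j < m, y j = y' j) : FrankWolfe m N d' y' t c := by
  induction h with
  | zero c hc => exact .zero c hc
  | succ t i c c' _ hi hmin hc' ih =>
    have hs : ∀ i < N, ∑ j ∈ Finset.range m, (c j - y' j) * d' i j =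
        ∑ j ∈ Finset.range m, (c j - y j) * d i j := fun i hi =>
      Finset.sum_congr rfl fun j hj => by
        rw [hd i hi j (Finset.mem_range.1 hj), hy j (Finset.mem_range.1 hj)]
    refine .succ t i c c' ih hi (fun i' hi' => ?_) fun j hj => ?_
    · rw [hs i hi, hs i' hi']
      exact hmin i' hi'
    · rw [hc' j hj, hd i hi j hj]

/-! ### Programs for nets, increments, averages and the projection to a convex hull. -/

namespace Cmd

/-- Compute the nets at the scale in the real cell `(5, 0, 0)` and at half this scale. -/
def levelNets : Cmd :=
  seq (netInto 6 (rcell 5)) (netInto 7 (.div (rcell 5) (.lit 2)))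

theorem exec_levelNets (ω : Tape) (s : State)
    (hs : ∀ i < s.idx 0 1, ∀ j < s.idx 0 1, s.mem 4 i j = sqDist (s.idx 0 0) (s.mem 1) i j)
    (i : ℕ) (hi : i < s.idx 0 1) :
    (levelNets.exec ω s).idx 6 i =
        netMap (s.idx 0 0) (s.idx 0 1) (s.mem 1) (s.mem 5 0 0) i ∧
      (levelNets.exec ω s).idx 7 i =
        netMap (s.idx 0 0) (s.idx 0 1) (s.mem 1) (s.mem 5 0 0 / 2) i := by
  have h6 := exec_netInto ω 6 (rcell 5) s (s.mem 5 0 0) (by simp) (by simp) (by simp)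
    (fun t hf => by simp [RExp.eval, IExp.eval, hf.mem])
  have hf : Frame [1, 6, 2] [] s ((netInto 6 (rcell 5)).exec ω s) :=
    (exec_frame ω (netInto 6 (rcell 5)) s).mono (by simp [netInto, idxOut])
      (by simp [netInto, realOut])
  have h7 := exec_netInto ω 7 (.div (rcell 5) (.lit 2)) ((netInto 6 (rcell 5)).exec ω s)
    (s.mem 5 0 0 / 2) (by simp) (by simp) (by simp)
    (fun t hf' => by simp [RExp.eval, IExp.eval, hf'.mem, hf.mem])
  have hf' := exec_frame ω (netInto 7 (.div (rcell 5) (.lit 2)))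
    ((netInto 6 (rcell 5)).exec ω s)
  rw [hf.idx 0 (by simp), hf.mem 4 (by simp)] at h7
  have hQ : ∀ r : ℝ, ∀ i < s.idx 0 1, ∀ j < s.idx 0 1,
      (s.mem 4 i j ≤ r ^ 2 * (s.idx 0 0 : ℝ) ↔
        sqDist (s.idx 0 0) (s.mem 1) i j ≤ r ^ 2 * (s.idx 0 0 : ℝ)) :=
    fun r i hi j hj => by rw [hs i hi j hj]
  -- The two nets are kept in different index arrays, so computing the second preserves the first.
  -- Uniqueness identifies each with `netMap`.
  refine ⟨?_, (h7.congr (hQ _)).unique (isNet_netMap _ _ _ _) i hi⟩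
  rw [levelNets, exec_seq, hf'.idx 6 (by simp [netInto, idxOut])]
  exact (h6.congr (hQ _)).unique (isNet_netMap _ _ _ _) i hi

/-- Store the increments of the approximations in the real array `6`. -/
def increments : Cmd :=
  loop 1 univCell (loop 2 dimCell (setReal 6 (icell 1) (icell 2)
    (.sub (.read 1 (.read 7 (icell 1)) (icell 2)) (.read 1 (.read 6 (icell 1)) (icell 2)))))

theorem exec_increments (ω : Tape) (s : State) (i j : ℕ) (hi : i < s.idx 0 1)
    (hj : j < s.idx 0 0) :
    (increments.exec ω s).mem 6 i j = s.mem 1 (s.idx 7 i) j - s.mem 1 (s.idx 6 i) j := by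
  refine exec_loop ω 1 univCell _ s
    (fun v t => ∀ i j, i < v → j < s.idx 0 0 → t.mem 6 i j =
      s.mem 1 (s.idx 7 i) j - s.mem 1 (s.idx 6 i) j)
    (fun v t t' hm _ _ h => by simpa [hm] using h) (by simp) ?_ i j hi hj
  intro v _ t hf hv ih
  have hfs : Frame [1, 2] [6] s t := hf
  rw [exec_fill ω 2 dimCell 6 (icell 1) (icell 2) _ t 0
    (fun j => s.mem 1 (s.idx 7 v) j - s.mem 1 (s.idx 6 v) j)
    (fun t hf => by simp [IExp.eval, hf.idx])
    (fun w _ t hf hw => by simp [IExp.eval, hw])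
    (fun w _ t hf hw _ => by
      simp [RExp.eval, IExp.eval, hw, hf.idx, hf.mem, hv, hfs.idx, hfs.mem])]
  intro i j hi hj
  simp only [IExp.eval, hv, hfs.idx 0 (by simp), Nat.zero_le, true_and, zero_add, Nat.sub_zero]
  by_cases h : i = v
  · rw [if_pos ⟨h, hj⟩, h]
  · rw [if_neg (by simp [h])]
    exact ih i j (by omega) hj

/-- Store in row `0` of the real array `7` the sums of the entries of the messages that belong to
the current level, multiplied by `x`. -/
def average (x : RExp) : Cmd :=
  loop 2 dimCell (seq (sumInto 1 partiesCell 8 (.lit 0) (.lit 0)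
    (.read 2 (icell 1) (.add (icell 9) (icell 2)))) (setReal 7 (.lit 0) (icell 2)
      (.mul x (rcell 8))))

theorem exec_average (ω : Tape) (x : RExp) (s : State) (r : ℝ)
    (hx : ∀ t, Frame [1, 2] [7, 8] s t → x.eval t = r) (j : ℕ) (hj : j < s.idx 0 0) :
    ((average x).exec ω s).mem 7 0 j =
      r * ∑ i ∈ Finset.range (s.idx 0 2), s.mem 2 i (s.idx 9 0 + j) := by
  refine exec_loop ω 2 dimCell _ s
    (fun v t => ∀ j, j < v → t.mem 7 0 j =
      r * ∑ i ∈ Finset.range (s.idx 0 2), s.mem 2 i (s.idx 9 0 + j))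
    (fun v t t' hm _ _ h => by simpa [hm] using h) (by simp) ?_ j hj
  intro v _ t hf hv ih
  have hfs : Frame [1, 2] [7, 8] s t := hf.mono (by simp [sumInto, idxOut])
    (by simp [sumInto, realOut])
  rw [exec_seq]
  have hsum := exec_sumInto ω 1 partiesCell 8 (.lit 0) (.lit 0)
    (.read 2 (icell 1) (.add (icell 9) (icell 2))) t
    (fun i => s.mem 2 i (s.idx 9 0 + v))
    (fun t hf => by simp [IExp.eval]) (fun t hf => by simp [IExp.eval])
    (fun t hf => by simp [IExp.eval, hf.idx])
    (fun i _ t' hf' hi => by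
      simp [RExp.eval, IExp.eval, hi, hf'.idx, hf'.mem, hv, hfs.mem, hfs.idx])
  set t1 := (sumInto 1 partiesCell 8 (.lit 0) (.lit 0)
    (.read 2 (icell 1) (.add (icell 9) (icell 2)))).exec ω t with ht1
  have hf1 : Frame [1] [8] t t1 := (exec_frame ω _ t).mono (by simp [sumInto, idxOut])
    (by simp [sumInto, realOut])
  have hfs1 : Frame [1, 2] [7, 8] s t1 := hfs.trans (hf1.mono (by simp) (by simp))
  intro j hj
  simp only [exec, State.tick_mem, State.writeReal_mem, IExp.eval, RExp.eval, true_and,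
    hf1.idx 2 (by simp), hv, hf1.mem 7 (by simp), hx t1 hfs1, hsum, and_self, if_true,
    hfs.idx 0 (by simp)]
  by_cases h : j = v
  · simp [h]
  · rw [if_neg h]
    exact ih j (by omega)

/-- One step of the Frank-Wolfe algorithm. -/
def frankWolfeStep : Cmd :=
  seq (loop 1 univCell (sumInto 2 dimCell 10 (.lit 0) (icell 1)
      (.mul (.sub (.read 9 (.lit 0) (icell 2)) (.read 7 (.lit 0) (icell 2)))
        (.read 6 (icell 1) (icell 2)))))
    (seq (setIdx 8 (.lit 0) (.lit 0))
      (seq (loop 1 univCell (ite (.rle (.read 10 (.lit 0) (icell 1)) (.read 10 (.lit 0) (icell 8)))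
          (setIdx 8 (.lit 0) (icell 1)) skip))
        (loop 2 dimCell (setReal 9 (.lit 0) (icell 2) (.add (.read 9 (.lit 0) (icell 2))
          (.mul (.div (.lit 2) (.add (.ofIdx (icell 5)) (.lit 2)))
            (.sub (.read 6 (icell 8) (icell 2)) (.read 9 (.lit 0) (icell 2)))))))))

/-- The minimizing index is only asserted to exist, since the analysis is indifferent to ties. This
is also why `FrankWolfe` is a relation and not a function. -/
theorem exec_frankWolfeStep (ω : Tape) (s : State) (hN : 0 < s.idx 0 1) :
    ∃ i < s.idx 0 1, (∀ i' < s.idx 0 1,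
      ∑ j ∈ Finset.range (s.idx 0 0), (s.mem 9 0 j - s.mem 7 0 j) * s.mem 6 i j ≤
        ∑ j ∈ Finset.range (s.idx 0 0), (s.mem 9 0 j - s.mem 7 0 j) * s.mem 6 i' j) ∧
      ∀ j < s.idx 0 0, (frankWolfeStep.exec ω s).mem 9 0 j =
        s.mem 9 0 j + 2 / ((s.idx 5 0 : ℝ) + 2) * (s.mem 6 i j - s.mem 9 0 j) := by
  set f : ℕ → ℝ := fun i =>
    ∑ j ∈ Finset.range (s.idx 0 0), (s.mem 9 0 j - s.mem 7 0 j) * s.mem 6 i j with hfdef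
  set c1 : Cmd := loop 1 univCell (sumInto 2 dimCell 10 (.lit 0) (icell 1)
      (.mul (.sub (.read 9 (.lit 0) (icell 2)) (.read 7 (.lit 0) (icell 2)))
        (.read 6 (icell 1) (icell 2)))) with hc1
  set s1 := c1.exec ω s with hs1
  have hf1 : Frame [1, 2] [10] s s1 := (exec_frame ω c1 s).mono
    (by simp [hc1, sumInto, idxOut]) (by simp [hc1, sumInto, realOut])
  have h1 : ∀ i < s.idx 0 1, s1.mem 10 0 i = f i := by
    refine exec_loop ω 1 univCell _ s (fun v t => ∀ i < v, t.mem 10 0 i = f i)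
      (fun v t t' hm _ _ h => by simpa [hm] using h) (by simp) ?_
    intro v _ t hf hv ih i hi
    have hfs : Frame [1, 2] [10] s t := hf.mono (by simp [sumInto, idxOut])
      (by simp [sumInto, realOut])
    rw [exec_sumInto ω 2 dimCell 10 (.lit 0) (icell 1) _ t
      (fun j => (s.mem 9 0 j - s.mem 7 0 j) * s.mem 6 v j)
      (fun t hf => by simp [IExp.eval]) (fun t hf => by simp [IExp.eval, hf.idx])
      (fun t hf => by simp [IExp.eval, hf.idx])
      (fun j _ t' hf' hj => by
        simp [RExp.eval, IExp.eval, hj, hf'.idx, hf'.mem, hv, hfs.mem])]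
    simp only [IExp.eval, hv, true_and, hfs.idx 0 (by simp)]
    by_cases h : i = v
    · simp [h, hfdef]
    · rw [if_neg h]
      exact ih i (by omega)
  set s2 := (setIdx 8 (.lit 0) (.lit 0)).exec ω s1 with hs2
  have hf2 : Frame [8] [] s1 s2 := exec_frame ω (setIdx 8 (.lit 0) (.lit 0)) s1
  set c3 : Cmd := loop 1 univCell (ite (.rle (.read 10 (.lit 0) (icell 1))
      (.read 10 (.lit 0) (icell 8))) (setIdx 8 (.lit 0) (icell 1)) skip) with hc3
  set s3 := c3.exec ω s2 with hs3
  have hf3 : Frame [1, 8] [] s2 s3 := exec_frame ω c3 s2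
  have hf02 : Frame [1, 2, 8] [10] s s2 := (hf1.mono (by simp) (by simp)).trans
    (hf2.mono (by simp) (by simp))
  have h3 := exec_loop ω 1 univCell (ite (.rle (.read 10 (.lit 0) (icell 1))
      (.read 10 (.lit 0) (icell 8))) (setIdx 8 (.lit 0) (icell 1)) skip) s2
      (fun v t => t.idx 8 0 < s.idx 0 1 ∧ ∀ i < v, f (t.idx 8 0) ≤ f i)
      (fun v t t' _ _ hi h => by simpa [hi] using h)
      -- The search starts from candidate `0`, which is a valid index only for a nonempty universe.
      ⟨by simpa [hs2, exec, IExp.eval] using hN, by simp⟩ (by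
    intro v hv t hf hv1 ⟨ih1, ih2⟩
    have hvN : v < s.idx 0 1 := by
      simpa only [IExp.eval, hf02.idx 0 (by simp)] using hv
    have hm : ∀ i < s.idx 0 1, t.mem 10 0 i = f i := fun i hi => by
      rw [hf.mem 10 (by simp [realOut]), hf2.mem 10 (by simp), h1 i hi]
    simp only [exec, BExp.eval, RExp.eval, IExp.eval, hv1, hm v hvN, hm _ ih1]
    split_ifs with hle
    · refine ⟨by simpa [hv1] using hvN, fun i hi => ?_⟩
      simp only [State.tick_idx, State.writeIdx_idx, and_self, if_true, hv1]
      rcases Nat.lt_succ_iff_lt_or_eq.1 hi with h | rfl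
      · exact hle.trans (ih2 i h)
      · exact le_rfl
    · refine ⟨ih1, fun i hi => ?_⟩
      rcases Nat.lt_succ_iff_lt_or_eq.1 hi with h | rfl
      · exact ih2 i h
      · exact (not_le.1 hle).le)
  have hN2 : univCell.eval s2 = s.idx 0 1 := by
    simp only [IExp.eval, hf02.idx 0 (by simp)]
  rw [hN2] at h3
  refine ⟨s3.idx 8 0, h3.1, h3.2, fun j hj => ?_⟩
  have hf03 : Frame [1, 2, 8] [10] s s3 := hf02.trans (hf3.mono (by simp) (by simp))
  rw [frankWolfeStep, exec_seq, exec_seq, exec_seq]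
  change ((loop 2 dimCell _).exec ω s3).mem 9 0 j = _
  rw [exec_fill ω 2 dimCell 9 (.lit 0) (icell 2) _ s3 0
    (fun j => s.mem 9 0 j + 2 / ((s.idx 5 0 : ℝ) + 2) * (s.mem 6 (s3.idx 8 0) j - s.mem 9 0 j))
    (fun t hf => by simp [IExp.eval])
    (fun w _ t hf hw => by simp [IExp.eval, hw])
    (fun w _ t hf hw h => by
      simp only [IExp.eval, zero_add] at h
      simp [RExp.eval, IExp.eval, hw, hf.idx, hf.mem, hf03.idx, hf03.mem, h])]
  simp only [IExp.eval, hf03.idx 0 (by simp), zero_add]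
  rw [if_pos ⟨trivial, Nat.zero_le _, hj⟩, Nat.sub_zero]

/-- The Frank-Wolfe algorithm, started at `0`. -/
def frankWolfe : Cmd :=
  seq (loop 2 dimCell (setReal 9 (.lit 0) (icell 2) (.lit 0)))
    (loop 5 partiesCell frankWolfeStep)

theorem exec_frankWolfe (ω : Tape) (s : State) (hN : 0 < s.idx 0 1) :
    FrankWolfe (s.idx 0 0) (s.idx 0 1) (s.mem 6) (s.mem 7 0) (s.idx 0 2)
      ((frankWolfe.exec ω s).mem 9 0) := by
  rw [frankWolfe, exec_seq]
  set s1 := (loop 2 dimCell (setReal 9 (.lit 0) (icell 2) (.lit 0))).exec ω s with hs1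
  have hf1 : Frame [2] [9] s s1 :=
    exec_frame ω (loop 2 dimCell (setReal 9 (.lit 0) (icell 2) (.lit 0))) s
  have h2 : partiesCell.eval s1 = s.idx 0 2 := by simp only [IExp.eval, hf1.idx 0 (by simp)]
  rw [← h2]
  refine exec_loop ω 5 partiesCell frankWolfeStep s1
    (fun v t => FrankWolfe (s.idx 0 0) (s.idx 0 1) (s.mem 6) (s.mem 7 0) v (t.mem 9 0))
    (fun v t t' hm _ _ h => by simpa [hm] using h) ?_ ?_
  · refine .zero _ fun j hj => ?_
    rw [hs1, exec_fill ω 2 dimCell 9 (.lit 0) (icell 2) _ s 0 (fun _ => 0)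
      (fun t hf => by simp [IExp.eval])
      (fun w _ t hf hw => by simp [IExp.eval, hw])
      (fun w _ t hf hw h => by simp [RExp.eval])]
    simp [IExp.eval, hj]
  · intro v _ t hf hv ih
    have hfs : Frame [1, 2, 5, 8] [9, 10] s t := (hf1.mono (by simp) (by simp)).trans
      (hf.mono (by simp [frankWolfeStep, sumInto, idxOut])
        (by simp [frankWolfeStep, sumInto, realOut]))
    obtain ⟨i, hi, hmin, hc⟩ := exec_frankWolfeStep ω t (by rwa [hfs.idx 0 (by simp)])
    rw [hfs.idx 0 (by simp), hfs.mem 6 (by simp), hfs.mem 7 (by simp)] at hmin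
    rw [hfs.idx 0 (by simp), hfs.mem 6 (by simp), hv] at hc
    rw [hfs.idx 0 (by simp)] at hi
    exact .succ v i _ _ ih hi hmin hc

end Cmd

theorem numHalvings_le (x : ℝ) (k : ℕ) : numHalvings x k ≤ k := by
  induction k with
  | zero => exact le_rfl
  | succ k ih => unfold numHalvings; split_ifs <;> omega

/-! ## The server -/

/-- The factor by which the server multiplies the sums of messages. -/
def serverScale (m n L : ℕ) (ε r : ℝ) : ℝ :=
  4 / ε * √(Real.pi / 2) * (3 / 2 * √((L : ℝ) * m)) * r / n

namespace Cmd

/-- Pass to the next level: halve the scale in the real cell `(5, 0, 0)` and increase by `m` the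
offset in the index cell `(9, 0)`. -/
def nextLevel : Cmd :=
  seq (setReal 5 (.lit 0) (.lit 0) (.div (rcell 5) (.lit 2)))
    (setIdx 9 (.lit 0) (.add (icell 9) dimCell))

/-- The part of the server's program that estimates the mean of the increments of one level. -/
def serverLevel : Cmd :=
  seq levelNets (seq increments (seq (average
    (.div (.mul (.mul (.mul (.div (.lit 4) (.read 0 (.lit 0) (.lit 1))) (.sqrt (.div .pi (.lit 2))))
      (.mul (.lit (3 / 2)) (.sqrt (.mul (.ofIdx (icell 10)) (.ofIdx dimCell))))) (rcell 5))
      (.ofIdx partiesCell)))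
    (seq frankWolfe (loop 2 dimCell (setReal 3 (.lit 0) (icell 2)
      (.add (.read 3 (.lit 0) (icell 2)) (.read 9 (.lit 0) (icell 2))))))))

theorem exec_serverLevel (ω : Tape) (s : State) (hN : 0 < s.idx 0 1)
    (hs : ∀ i < s.idx 0 1, ∀ j < s.idx 0 1, s.mem 4 i j = sqDist (s.idx 0 0) (s.mem 1) i j) :
    ∃ c : ℕ → ℝ, FrankWolfe (s.idx 0 0) (s.idx 0 1)
      (increment (s.idx 0 0) (s.idx 0 1) (s.mem 1) (s.mem 5 0 0))
      (fun j => serverScale (s.idx 0 0) (s.idx 0 2) (s.idx 10 0) (s.mem 0 0 1) (s.mem 5 0 0) *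
        ∑ i ∈ Finset.range (s.idx 0 2), s.mem 2 i (s.idx 9 0 + j)) (s.idx 0 2) c ∧
      ∀ j < s.idx 0 0, (serverLevel.exec ω s).mem 3 0 j = s.mem 3 0 j + c j := by
  rw [serverLevel, exec_seq, exec_seq, exec_seq, exec_seq]
  set x : RExp := .div (.mul (.mul (.mul (.div (.lit 4) (.read 0 (.lit 0) (.lit 1)))
      (.sqrt (.div .pi (.lit 2)))) (.mul (.lit (3 / 2)) (.sqrt (.mul (.ofIdx (icell 10))
      (.ofIdx dimCell))))) (rcell 5)) (.ofIdx partiesCell) with hx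
  set s1 := levelNets.exec ω s with hs1
  have hf1 : Frame [1, 2, 6, 7] [] s s1 := (exec_frame ω levelNets s).mono
    (by simp [levelNets, netInto, idxOut]) (by simp [levelNets, netInto, realOut])
  have h1 := exec_levelNets ω s hs
  rw [← hs1] at h1
  set s2 := increments.exec ω s1 with hs2
  have hf2 : Frame [1, 2] [6] s1 s2 := exec_frame ω increments s1
  have hf02 : Frame [1, 2, 6, 7] [6] s s2 := (hf1.mono (by simp) (by simp)).trans
    (hf2.mono (by simp) (by simp))
  set s3 := (average x).exec ω s2 with hs3
  have hf3 : Frame [1, 2] [7, 8] s2 s3 := (exec_frame ω (average x) s2).mono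
    (by simp [average, sumInto, idxOut]) (by simp [average, sumInto, realOut])
  have hf03 : Frame [1, 2, 6, 7] [6, 7, 8] s s3 := (hf02.mono (by simp) (by simp)).trans
    (hf3.mono (by simp) (by simp))
  have hFW := exec_frankWolfe ω s3 (by rwa [hf03.idx 0 (by simp)])
  set s4 := frankWolfe.exec ω s3 with hs4
  have hf4 : Frame [1, 2, 5, 8] [9, 10] s3 s4 := (exec_frame ω frankWolfe s3).mono
    (by simp [frankWolfe, frankWolfeStep, sumInto, idxOut])
    (by simp [frankWolfe, frankWolfeStep, sumInto, realOut])
  have hf04 : Frame [1, 2, 5, 6, 7, 8] [6, 7, 8, 9, 10] s s4 :=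
    (hf03.mono (by simp) (by simp)).trans (hf4.mono (by simp) (by simp))
  rw [hf03.idx 0 (by simp), hf3.mem 6 (by simp)] at hFW
  refine ⟨s4.mem 9 0, hFW.congr (fun i hi j hj => ?_) (fun j hj => ?_), fun j hj => ?_⟩
  · have h := exec_increments ω s1 i j (by rwa [hf1.idx 0 (by simp)])
      (by rwa [hf1.idx 0 (by simp)])
    rw [← hs2, hf1.mem 1 (by simp), (h1 i hi).1, (h1 i hi).2] at h
    exact h
  · have h := exec_average ω x s2
      (serverScale (s.idx 0 0) (s.idx 0 2) (s.idx 10 0) (s.mem 0 0 1) (s.mem 5 0 0))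
      (fun t hf => by
        simp [hx, RExp.eval, IExp.eval, hf.idx, hf.mem, hf02.idx, hf02.mem, serverScale]) j
      (by rwa [hf02.idx 0 (by simp)])
    rw [← hs3, hf02.idx 0 (by simp), hf02.idx 9 (by simp), hf02.mem 2 (by simp)] at h
    exact h
  · rw [exec_fill ω 2 dimCell 3 (.lit 0) (icell 2) _ s4 0
      (fun j => s.mem 3 0 j + s4.mem 9 0 j)
      (fun t hf => by simp [IExp.eval])
      (fun w _ t hf hw => by simp [IExp.eval, hw])
      (fun w _ t hf hw h => by
        simp only [IExp.eval, zero_add] at h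
        simp [RExp.eval, IExp.eval, hw, hf.mem, h, hf04.mem])]
    simp [IExp.eval, hf04.idx, hj]

theorem exec_nextLevel (ω : Tape) (s : State) :
    (nextLevel.exec ω s).mem 5 0 0 = s.mem 5 0 0 / 2 ∧
      (nextLevel.exec ω s).idx 9 0 = s.idx 9 0 + s.idx 0 0 ∧
      Frame [9] [5] s (nextLevel.exec ω s) :=
  ⟨by simp [nextLevel, exec, RExp.eval, IExp.eval], by simp [nextLevel, exec, IExp.eval],
    exec_frame ω nextLevel s⟩

/-- One round of the main loop of the server. -/
def serverRound : Cmd :=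
  seq (ite (.ile (.add (icell 4) (.lit 1)) (icell 10)) serverLevel skip) nextLevel

theorem frame_serverLevel (ω : Tape) (s : State) :
    Frame [1, 2, 5, 6, 7, 8] [3, 6, 7, 8, 9, 10] s (serverLevel.exec ω s) :=
  (exec_frame ω serverLevel s).mono
    (by simp [serverLevel, levelNets, netInto, increments, average, frankWolfe,
      frankWolfeStep, sumInto, idxOut])
    (by simp [serverLevel, levelNets, netInto, increments, average, frankWolfe,
      frankWolfeStep, sumInto, realOut])

theorem serverRound_idxOut : ∀ a ∈ serverRound.idxOut, a ∈ [1, 2, 5, 6, 7, 8, 9] := by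
  simp [serverRound, serverLevel, nextLevel, levelNets, netInto, increments, average, frankWolfe,
    frankWolfeStep, sumInto, idxOut]

theorem serverRound_realOut : ∀ a ∈ serverRound.realOut, a ∈ [3, 5, 6, 7, 8, 9, 10] := by
  simp [serverRound, serverLevel, nextLevel, levelNets, netInto, increments, average, frankWolfe,
    frankWolfeStep, sumInto, realOut]

theorem exec_serverRound (ω : Tape) (s : State) (hN : 0 < s.idx 0 1)
    (hs : ∀ i < s.idx 0 1, ∀ j < s.idx 0 1, s.mem 4 i j = sqDist (s.idx 0 0) (s.mem 1) i j) :
    (serverRound.exec ω s).mem 5 0 0 = s.mem 5 0 0 / 2 ∧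
    (serverRound.exec ω s).idx 9 0 = s.idx 9 0 + s.idx 0 0 ∧
    (¬ s.idx 4 0 < s.idx 10 0 → (serverRound.exec ω s).mem 3 = s.mem 3) ∧
    (s.idx 4 0 < s.idx 10 0 → ∃ c : ℕ → ℝ, FrankWolfe (s.idx 0 0) (s.idx 0 1)
      (increment (s.idx 0 0) (s.idx 0 1) (s.mem 1) (s.mem 5 0 0))
      (fun j => serverScale (s.idx 0 0) (s.idx 0 2) (s.idx 10 0) (s.mem 0 0 1) (s.mem 5 0 0) *
        ∑ i ∈ Finset.range (s.idx 0 2), s.mem 2 i (s.idx 9 0 + j)) (s.idx 0 2) c ∧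
      ∀ j < s.idx 0 0, (serverRound.exec ω s).mem 3 0 j = s.mem 3 0 j + c j) := by
  by_cases h : s.idx 4 0 < s.idx 10 0
  · obtain ⟨k, ht⟩ : ∃ k, serverRound.exec ω s =
        nextLevel.exec ω (serverLevel.exec ω (s.tick k)) := by
      rw [serverRound, exec_seq, exec_ite_pos ω (by exact Nat.succ_le_of_lt h)]
      exact ⟨_, rfl⟩
    obtain ⟨c, hc, hout⟩ := exec_serverLevel ω (s.tick k) hN hs
    have hf := frame_serverLevel ω (s.tick k)
    obtain ⟨n1, n2, n3⟩ := exec_nextLevel ω (serverLevel.exec ω (s.tick k))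
    rw [ht]
    refine ⟨?_, ?_, fun h' => absurd h h', fun _ => ⟨c, hc, fun j hj => ?_⟩⟩
    · rw [n1, hf.mem 5 (by simp)]; rfl
    · rw [n2, hf.idx 9 (by simp), hf.idx 0 (by simp)]; rfl
    · rw [n3.mem 3 (by simp)]
      exact hout j hj
  · obtain ⟨k, ht⟩ : ∃ k : ℕ, serverRound.exec ω s = nextLevel.exec ω (s.tick k) := by
      rw [serverRound, exec_seq, exec_ite_neg ω (by exact fun h' => h (Nat.lt_of_succ_le h')),
        exec_skip, State.tick_tick]
      exact ⟨_, rfl⟩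
    obtain ⟨n1, n2, n3⟩ := exec_nextLevel ω (s.tick k)
    rw [ht]
    exact ⟨n1, n2, fun _ => n3.mem 3 (by simp), fun h' => absurd h' h⟩

/-- The main loop of the server. -/
def serverLoop : Cmd := loop 4 partiesCell serverRound

theorem frame_serverLoop (ω : Tape) (s : State) :
    Frame [1, 2, 4, 5, 6, 7, 8, 9] [3, 5, 6, 7, 8, 9, 10] s (serverLoop.exec ω s) := by
  refine (exec_frame ω serverLoop s).mono ?_ fun b hb => serverRound_realOut b hb
  intro a ha
  rcases List.mem_cons.1 ha with rfl | ha
  · simp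
  · have := serverRound_idxOut a ha
    simp only [List.mem_cons, List.not_mem_nil, or_false] at this ⊢
    tauto

theorem exec_serverLoop (ω : Tape) (s : State) (hN : 0 < s.idx 0 1)
    (hs : ∀ i < s.idx 0 1, ∀ j < s.idx 0 1, s.mem 4 i j = sqDist (s.idx 0 0) (s.mem 1) i j)
    (h5 : s.mem 5 0 0 = 1) (h9 : s.idx 9 0 = 0) (hL : s.idx 10 0 ≤ s.idx 0 2) :
    ∃ c : ℕ → ℕ → ℝ, (∀ v < s.idx 10 0, FrankWolfe (s.idx 0 0) (s.idx 0 1)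
      (increment (s.idx 0 0) (s.idx 0 1) (s.mem 1) ((1 / 2) ^ v))
      (fun j => serverScale (s.idx 0 0) (s.idx 0 2) (s.idx 10 0) (s.mem 0 0 1) ((1 / 2) ^ v) *
        ∑ i ∈ Finset.range (s.idx 0 2), s.mem 2 i (v * s.idx 0 0 + j)) (s.idx 0 2) (c v)) ∧
      ∀ j < s.idx 0 0, (serverLoop.exec ω s).mem 3 0 j = s.mem 3 0 j +
        ∑ v ∈ Finset.range (s.idx 10 0), c v j := by
  -- All `n` rounds are run, but only those below the number of levels act. Hence the minimum in the
  -- invariant, while the scale and the offset move on in every round.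
  have key := exec_loop ω 4 partiesCell serverRound s
    (fun v t => t.mem 5 0 0 = (1 / 2) ^ v ∧ t.idx 9 0 = v * s.idx 0 0 ∧
      ∃ c : ℕ → ℕ → ℝ, (∀ v' < min v (s.idx 10 0), FrankWolfe (s.idx 0 0) (s.idx 0 1)
        (increment (s.idx 0 0) (s.idx 0 1) (s.mem 1) ((1 / 2) ^ v'))
        (fun j => serverScale (s.idx 0 0) (s.idx 0 2) (s.idx 10 0) (s.mem 0 0 1) ((1 / 2) ^ v') *
          ∑ i ∈ Finset.range (s.idx 0 2), s.mem 2 i (v' * s.idx 0 0 + j)) (s.idx 0 2) (c v')) ∧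
        ∀ j < s.idx 0 0, t.mem 3 0 j = s.mem 3 0 j +
          ∑ v' ∈ Finset.range (min v (s.idx 10 0)), c v' j)
    (fun v t t' hm _ hi h => by rw [hm, hi 9 (by simp)]; exact h)
    ⟨by rw [h5, pow_zero], by rw [h9]; simp, 0, by simp, by simp⟩ (by
    rintro v hv t hf hv4 ⟨i1, i2, c, i3, i4⟩
    have hft : Frame [1, 2, 4, 5, 6, 7, 8, 9] [3, 5, 6, 7, 8, 9, 10] s t := by
      refine hf.mono (fun a ha => ?_) serverRound_realOut
      rcases List.mem_cons.1 ha with rfl | ha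
      · simp
      · have := serverRound_idxOut a ha
        simp only [List.mem_cons, List.not_mem_nil, or_false] at this ⊢
        tauto
    have e0 : t.idx 0 = s.idx 0 := hft.idx 0 (by simp)
    have e10 : t.idx 10 = s.idx 10 := hft.idx 10 (by simp)
    have m0 : t.mem 0 = s.mem 0 := hft.mem 0 (by simp)
    have m1 : t.mem 1 = s.mem 1 := hft.mem 1 (by simp)
    have m2 : t.mem 2 = s.mem 2 := hft.mem 2 (by simp)
    have m4 : t.mem 4 = s.mem 4 := hft.mem 4 (by simp)
    have hr := exec_serverRound ω t (by rwa [e0]) (by rw [e0, m1, m4]; exact hs)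
    rw [e0, e10, m0, m1, m2, hv4, i1, i2] at hr
    obtain ⟨r1, r2, r3, r4⟩ := hr
    refine ⟨by rw [r1, pow_succ]; ring, by rw [r2, add_mul, one_mul], ?_⟩
    by_cases hvL : v < s.idx 10 0
    · obtain ⟨c', hc', hout⟩ := r4 hvL
      refine ⟨Function.update c v c', fun v' hv' => ?_, fun j hj => ?_⟩
      · rw [Nat.min_eq_left hvL] at hv'
        rcases Nat.lt_succ_iff_lt_or_eq.1 hv' with h | rfl
        · rw [Function.update_of_ne h.ne]
          exact i3 v' (by omega)
        · rw [Function.update_self]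
          exact hc'
      · have hup : ∀ v' ∈ Finset.range v, Function.update c v c' v' j = c v' j :=
          fun v' h => by rw [Function.update_of_ne (Finset.mem_range.1 h).ne]
        have i4' := i4 j hj
        rw [Nat.min_eq_left hvL.le] at i4'
        rw [Nat.min_eq_left hvL, Finset.sum_range_succ, Function.update_self,
          Finset.sum_congr rfl hup, hout j hj, i4', add_assoc]
    · have hmin : min (v + 1) (s.idx 10 0) = min v (s.idx 10 0) := by omega
      rw [hmin, r3 hvL]
      exact ⟨c, i3, i4⟩)
  have hn : partiesCell.eval s = s.idx 0 2 := rfl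
  rw [hn, Nat.min_eq_right hL] at key
  exact key.2.2

/-- The program of the server. -/
def chainingServer : Cmd :=
  seq distances (seq countLevels
    (seq (loop 2 dimCell (setReal 3 (.lit 0) (icell 2) (.read 1 (.lit 0) (icell 2))))
      (seq serverLoop (ite (.rle (.lit (1 / 2)) (rcell 0))
          (loop 2 dimCell (setReal 3 (.lit 0) (icell 2) (.lit (1 / 2)))) skip))))

/-- The chain starts at row `0` of the universe, the only net point at scale 1 when the universe
lies in the unit cube. For large `α` the centre of the cube overwrites the estimate. -/
theorem exec_chainingServer (ω : Tape) (s : State) (hN : 0 < s.idx 0 1) (h10 : s.idx 10 0 = 0)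
    (h9 : s.idx 9 0 = 0) :
    ∃ c : ℕ → ℕ → ℝ, (∀ v < numHalvings (s.mem 0 0 0 / 2) (s.idx 0 2),
      FrankWolfe (s.idx 0 0) (s.idx 0 1)
      (increment (s.idx 0 0) (s.idx 0 1) (s.mem 1) ((1 / 2) ^ v))
      (fun j => serverScale (s.idx 0 0) (s.idx 0 2) (numHalvings (s.mem 0 0 0 / 2) (s.idx 0 2))
        (s.mem 0 0 1) ((1 / 2) ^ v) *
        ∑ i ∈ Finset.range (s.idx 0 2), s.mem 2 i (v * s.idx 0 0 + j)) (s.idx 0 2) (c v)) ∧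
      ∀ j < s.idx 0 0, (chainingServer.exec ω s).mem 3 0 j =
        if 1 / 2 ≤ s.mem 0 0 0 then 1 / 2 else s.mem 1 0 j +
          ∑ v ∈ Finset.range (numHalvings (s.mem 0 0 0 / 2) (s.idx 0 2)), c v j := by
  rw [chainingServer, exec_seq, exec_seq, exec_seq, exec_seq]
  set s1 := distances.exec ω s with hs1
  have hf1 : Frame [1, 2, 3] [4] s s1 := (exec_frame ω distances s).mono
    (by simp [distances, sumInto, idxOut]) (by simp [distances, sumInto, realOut])
  have hd := exec_distances ω s
  rw [← hs1] at hd
  have hcount := exec_countLevels ω s1 (by rw [hf1.idx 10 (by simp), h10])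
  set s2 := countLevels.exec ω s1 with hs2
  have hf2 : Frame [1, 10] [5] s1 s2 := (exec_frame ω countLevels s1).mono
    (by simp [countLevels, idxOut]) (by simp [countLevels, realOut])
  rw [hf1.mem 0 (by simp), hf1.idx 0 (by simp)] at hcount
  have hf02 : Frame [1, 2, 3, 10] [4, 5] s s2 := (hf1.mono (by simp) (by simp)).trans
    (hf2.mono (by simp) (by simp))
  set s3 := (loop 2 dimCell (setReal 3 (.lit 0) (icell 2) (.read 1 (.lit 0) (icell 2)))).exec ω s2
    with hs3
  have hf3 : Frame [2] [3] s2 s3 := exec_frame ω (loop 2 dimCell (setReal 3 (.lit 0) (icell 2)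
    (.read 1 (.lit 0) (icell 2)))) s2
  have h3 : ∀ j < s.idx 0 0, s3.mem 3 0 j = s.mem 1 0 j := by
    intro j hj
    rw [hs3, exec_fill ω 2 dimCell 3 (.lit 0) (icell 2) _ s2 0 (fun j => s.mem 1 0 j)
      (fun t hf => by simp [IExp.eval])
      (fun w _ t hf hw => by simp [IExp.eval, hw])
      (fun w _ t hf hw h => by simp [RExp.eval, IExp.eval, hw, hf.mem, hf02.mem])]
    simp [IExp.eval, hf02.idx, hj]
  have hf03 : Frame [1, 2, 3, 10] [3, 4, 5] s s3 := (hf02.mono (by simp) (by simp)).trans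
    (hf3.mono (by simp) (by simp))
  have e0 : s3.idx 0 = s.idx 0 := hf03.idx 0 (by simp)
  have e10 : s3.idx 10 0 = numHalvings (s.mem 0 0 0 / 2) (s.idx 0 2) := by
    rw [hf3.idx 10 (by simp), hcount.1]
  have m0 : s3.mem 0 = s.mem 0 := hf03.mem 0 (by simp)
  have m1 : s3.mem 1 = s.mem 1 := hf03.mem 1 (by simp)
  have m2 : s3.mem 2 = s.mem 2 := hf03.mem 2 (by simp)
  have key := exec_serverLoop ω s3 (by rwa [e0]) (by
      rw [e0, m1, hf3.mem 4 (by simp), hf2.mem 4 (by simp)]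
      exact fun i hi j hj => hd i j hi hj) (by rw [hf3.mem 5 (by simp), hcount.2])
    (by rw [hf03.idx 9 (by simp), h9]) (by rw [e10, e0]; exact numHalvings_le _ _)
  have hf4 := frame_serverLoop ω s3
  set s4 := serverLoop.exec ω s3 with hs4
  rw [e0, e10, m0, m1, m2] at key
  obtain ⟨c, k1, k2⟩ := key
  have a4 : s4.mem 0 = s.mem 0 := by rw [hf4.mem 0 (by simp), m0]
  have e4 : s4.idx 0 = s.idx 0 := by rw [hf4.idx 0 (by simp), e0]
  refine ⟨c, k1, fun j hj => ?_⟩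
  rw [exec]
  simp only [BExp.eval, RExp.eval, IExp.eval, a4]
  by_cases ha : 1 / 2 ≤ s.mem 0 0 0
  · rw [if_pos (by simpa using ha), if_pos ha]
    rw [exec_fill ω 2 dimCell 3 (.lit 0) (icell 2) _ _ 0 (fun j => 1 / 2)
      (fun t hf => by simp [IExp.eval])
      (fun w _ t hf hw => by simp [IExp.eval, hw])
      (fun w _ t hf hw h => by simp [RExp.eval])]
    simp [IExp.eval, e4, hj]
  · rw [if_neg (by simpa using ha), if_neg ha]
    simp only [exec, State.tick_mem]
    rw [k2 j hj, h3 j hj]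

end Cmd

/-! ## The parties -/

/-- The concatenation of the increments of the point `own` at all levels, each divided by its
scale. -/
def stacked (m N L : ℕ) (U : ℕ → ℕ → ℝ) (own c : ℕ) : ℝ :=
  if c < L * m then increment m N U ((1 / 2) ^ (c / m)) own (c % m) / (1 / 2) ^ (c / m) else 0

/-- The probability with which the bit `1` is sent. -/
def bitProb (ε S : ℝ) : ℝ := if 0 ≤ S then 1 / 2 + ε / 8 else 1 / 2 - ε / 8

/-- The bit that is sent: a randomized version of the sign of `S`. -/
def randomizedSign (ε S u : ℝ) : ℝ := if u ≤ bitProb ε S then 1 else -1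

/-- The Gaussian projection of the stacked increments, which are completed by one more coordinate
to a vector of norm `3 / 2 * √(L * m)`. -/
def projection (m N n L : ℕ) (U : ℕ → ℕ → ℝ) (own : ℕ) (ω : Tape) : ℝ :=
  ∑ c ∈ Finset.range (n * m), (ω c).1 * stacked m N L U own c +
    (ω (n * m)).1 * √(9 / 4 * ((L : ℝ) * m) -
      ∑ c ∈ Finset.range (n * m), stacked m N L U own c ^ 2)

namespace Cmd

/-- Find in the universe the point of the party, and store its index in the index cell `(8, 0)`. -/
def findOwn : Cmd :=
  loop 1 univCell (seq (sumInto 3 dimCell 14 (.lit 0) (.lit 0)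
    (.sq (.sub (.read 1 (icell 1) (icell 3)) (.read 2 (.lit 0) (icell 3)))))
    (ite (.rle (rcell 14) (.lit 0)) (setIdx 8 (.lit 0) (icell 1)) skip))

theorem exec_findOwn (ω : Tape) (s : State)
    (hs : ∃ k < s.idx 0 1, ∀ l < s.idx 0 0, s.mem 1 k l = s.mem 2 0 l) :
    (findOwn.exec ω s).idx 8 0 < s.idx 0 1 ∧
      ∀ l < s.idx 0 0, s.mem 1 ((findOwn.exec ω s).idx 8 0) l = s.mem 2 0 l := by
  -- The claim is conditional on a match having been met: until then nothing is known about the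
  -- index cell `(8, 0)`.
  refine exec_loop ω 1 univCell _ s
    (fun v t => (∃ k < v, ∀ l < s.idx 0 0, s.mem 1 k l = s.mem 2 0 l) → t.idx 8 0 < s.idx 0 1 ∧
      ∀ l < s.idx 0 0, s.mem 1 (t.idx 8 0) l = s.mem 2 0 l)
    (fun v t t' _ _ hi h => by rw [hi 8 (by simp)]; exact h) (by simp) ?_ hs
  intro v hvN t hf hv ih
  have hfs : Frame [1, 3, 8] [14] s t := hf.mono (by simp [sumInto, idxOut])
    (by simp [sumInto, realOut])
  rw [exec_seq]
  have hsum := exec_sumInto ω 3 dimCell 14 (.lit 0) (.lit 0)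
    (.sq (.sub (.read 1 (icell 1) (icell 3)) (.read 2 (.lit 0) (icell 3)))) t
    (fun l => (s.mem 1 v l - s.mem 2 0 l) ^ 2)
    (fun t hf => by simp [IExp.eval]) (fun t hf => by simp [IExp.eval])
    (fun t hf => by simp [IExp.eval, hf.idx])
    (fun l _ t' hf' hl => by
      simp [RExp.eval, IExp.eval, hl, hf'.idx, hf'.mem, hv, hfs.mem, sq])
  set t1 := (sumInto 3 dimCell 14 (.lit 0) (.lit 0)
    (.sq (.sub (.read 1 (icell 1) (icell 3)) (.read 2 (.lit 0) (icell 3))))).exec ω t with ht1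
  have hf1 : Frame [3] [14] t t1 := (exec_frame ω _ t).mono (by simp [sumInto, idxOut])
    (by simp [sumInto, realOut])
  have hacc : t1.mem 14 0 0 = ∑ l ∈ Finset.range (s.idx 0 0), (s.mem 1 v l - s.mem 2 0 l) ^ 2 := by
    simp only [hsum, IExp.eval, and_self, if_true, hfs.idx 0 (by simp)]
  by_cases hc : ∀ l < s.idx 0 0, s.mem 1 v l = s.mem 2 0 l
  · rw [exec_ite_pos ω (by
      simp only [BExp.eval, RExp.eval, IExp.eval, hacc]
      rw [Finset.sum_eq_zero fun l hl => by rw [hc l (Finset.mem_range.1 hl)]; simp]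
      simp)]
    intro _
    simp only [exec, IExp.eval, State.tick_idx, State.writeIdx_idx, and_self, if_true,
      hf1.idx 1 (by simp), hv]
    exact ⟨hvN, hc⟩
  · rw [exec_ite_neg ω (by
      simp only [BExp.eval, RExp.eval, IExp.eval, hacc, Rat.cast_zero, not_le]
      push Not at hc
      obtain ⟨l, hl, hne⟩ := hc
      exact Finset.sum_pos' (fun _ _ => sq_nonneg _)
        ⟨l, Finset.mem_range.2 hl, by positivity [sub_ne_zero.2 hne]⟩), exec_skip]
    rintro ⟨k, hk, hk'⟩
    have hkv : k < v := by
      rcases Nat.lt_succ_iff_lt_or_eq.1 hk with h | rfl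
      · exact h
      · exact absurd hk' hc
    simp only [State.tick_idx, hf1.idx 8 (by simp)]
    exact ih ⟨k, hkv, hk'⟩

/-- The part of the parties' program that computes the increment of one level. -/
def clientLevel : Cmd :=
  seq levelNets (loop 2 dimCell (setReal 7 (.lit 0) (.add (icell 9) (icell 2))
    (.div (.sub (.read 1 (.read 7 (icell 8)) (icell 2)) (.read 1 (.read 6 (icell 8)) (icell 2)))
      (rcell 5))))

theorem exec_clientLevel (ω : Tape) (s : State) (h8 : s.idx 8 0 < s.idx 0 1)
    (hs : ∀ i < s.idx 0 1, ∀ j < s.idx 0 1, s.mem 4 i j = sqDist (s.idx 0 0) (s.mem 1) i j) :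
    (clientLevel.exec ω s).mem 7 0 = fun q =>
      if s.idx 9 0 ≤ q ∧ q < s.idx 9 0 + s.idx 0 0 then
        increment (s.idx 0 0) (s.idx 0 1) (s.mem 1) (s.mem 5 0 0) (s.idx 8 0) (q - s.idx 9 0) /
          s.mem 5 0 0 else s.mem 7 0 q := by
  rw [clientLevel, exec_seq]
  have h1 := exec_levelNets ω s hs (s.idx 8 0) h8
  set s1 := levelNets.exec ω s with hs1
  have hf1 : Frame [1, 2, 6, 7] [] s s1 := (exec_frame ω levelNets s).mono
    (by simp [levelNets, netInto, idxOut]) (by simp [levelNets, netInto, realOut])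
  rw [exec_fill ω 2 dimCell 7 (.lit 0) _ _ s1 (s.idx 9 0)
    (fun q => increment (s.idx 0 0) (s.idx 0 1) (s.mem 1) (s.mem 5 0 0) (s.idx 8 0) q /
          s.mem 5 0 0)
    (fun t hf => by simp [IExp.eval])
    (fun w _ t hf hw => by simp [IExp.eval, hw, hf.idx, hf1.idx])
    (fun w _ t hf hw _ => by
      simp [RExp.eval, IExp.eval, hw, hf.idx, hf.mem, hf1.idx, hf1.mem, increment, h1.1, h1.2])]
  funext q
  simp [IExp.eval, hf1.idx, hf1.mem]

/-- One round of the main loop of the parties. -/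
def clientRound : Cmd :=
  seq (ite (.ile (.add (icell 4) (.lit 1)) (icell 10)) clientLevel skip) nextLevel

/-- The main loop of the parties. -/
def clientLoop : Cmd := loop 4 partiesCell clientRound

theorem frame_clientLoop (ω : Tape) (s : State) :
    Frame [4, 1, 2, 6, 7, 9] [5, 7] s (clientLoop.exec ω s) :=
  (exec_frame ω clientLoop s).mono
    (by simp [clientLoop, clientRound, clientLevel, levelNets, netInto, nextLevel, idxOut])
    (by simp [clientLoop, clientRound, clientLevel, levelNets, netInto, nextLevel, realOut])

theorem exec_clientLoop (ω : Tape) (s : State) (h8 : s.idx 8 0 < s.idx 0 1)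
    (hs : ∀ i < s.idx 0 1, ∀ j < s.idx 0 1, s.mem 4 i j = sqDist (s.idx 0 0) (s.mem 1) i j)
    (h5 : s.mem 5 0 0 = 1) (h7 : ∀ q, s.mem 7 0 q = 0) (h9 : s.idx 9 0 = 0)
    (hL : s.idx 10 0 ≤ s.idx 0 2) :
    (clientLoop.exec ω s).mem 7 0 =
      stacked (s.idx 0 0) (s.idx 0 1) (s.idx 10 0) (s.mem 1) (s.idx 8 0) := by
  -- After `v` rounds the row is the stacked vector truncated to `min v L` levels, with `L` the
  -- level count. The cells after these blocks must be zero from the start, which is what `h7`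
  -- provides.
  have key := exec_loop ω 4 partiesCell clientRound s
    (fun v t => t.mem 5 0 0 = (1 / 2) ^ v ∧ t.idx 9 0 = v * s.idx 0 0 ∧
      t.mem 7 0 = stacked (s.idx 0 0) (s.idx 0 1) (min v (s.idx 10 0)) (s.mem 1) (s.idx 8 0))
    (fun v t t' hm _ hi h => by rw [hm, hi 9 (by simp)]; exact h)
    ⟨by rw [h5, pow_zero], by rw [h9]; simp, by funext q; simp [stacked, h7]⟩ (by
    rintro v hv t hf hv4 ⟨i1, i2, i3⟩
    have hft : Frame [4, 1, 2, 6, 7, 9] [5, 7] s t := hf.mono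
      (by simp [clientRound, clientLevel, levelNets, netInto, nextLevel, idxOut])
      (by simp [clientRound, clientLevel, levelNets, netInto, nextLevel, realOut])
    have e0 : t.idx 0 = s.idx 0 := hft.idx 0 (by simp)
    have e8 : t.idx 8 = s.idx 8 := hft.idx 8 (by simp)
    have e10 : t.idx 10 = s.idx 10 := hft.idx 10 (by simp)
    have m1 : t.mem 1 = s.mem 1 := hft.mem 1 (by simp)
    have m4 : t.mem 4 = s.mem 4 := hft.mem 4 (by simp)
    rw [clientRound, exec_seq]
    by_cases hvL : v < s.idx 10 0
    · rw [exec_ite_pos ω (by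
        simp only [BExp.eval, IExp.eval, hv4, e10]
        exact Nat.succ_le_of_lt hvL)]
      obtain ⟨k, hk⟩ : ∃ k, k = (BExp.ile (.add (icell 4) (.lit 1)) (icell 10)).size + 1 :=
        ⟨_, rfl⟩
      rw [← hk]
      have hlev := exec_clientLevel ω (t.tick k) (by rwa [State.tick_idx, e0, e8])
        (by rw [State.tick_idx, State.tick_mem, e0, m1, m4]; exact hs)
      have hfl : Frame [1, 2, 6, 7] [7] (t.tick k) (clientLevel.exec ω (t.tick k)) :=
        (exec_frame ω clientLevel (t.tick k)).mono
          (by simp [clientLevel, levelNets, netInto, idxOut])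
          (by simp [clientLevel, levelNets, netInto, realOut])
      simp only [State.tick_idx, State.tick_mem, e0, e8, m1, i1, i2] at hlev
      obtain ⟨n1, n2, n3⟩ := exec_nextLevel ω (clientLevel.exec ω (t.tick k))
      refine ⟨?_, ?_, ?_⟩
      · rw [n1, hfl.mem 5 (by simp), State.tick_mem, i1, pow_succ]; ring
      · rw [n2, hfl.idx 9 (by simp), hfl.idx 0 (by simp), State.tick_idx, i2, e0, add_mul, one_mul]
      · rw [n3.mem 7 (by simp), hlev, i3, Nat.min_eq_left hvL.le, Nat.min_eq_left hvL]
        funext q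
        by_cases hq : v * s.idx 0 0 ≤ q ∧ q < v * s.idx 0 0 + s.idx 0 0
        · have hdiv : q / s.idx 0 0 = v := by
            rw [Nat.div_eq_iff (by omega)]
            have : s.idx 0 0 * v = v * s.idx 0 0 := mul_comm _ _
            constructor <;> omega
          have hmod : q % s.idx 0 0 = q - v * s.idx 0 0 := by
            have := Nat.div_add_mod q (s.idx 0 0)
            rw [hdiv, mul_comm] at this
            omega
          rw [if_pos hq, stacked, if_pos (by rw [Nat.succ_mul]; exact hq.2), hdiv, hmod]
        · rw [if_neg hq, stacked, stacked, Nat.succ_mul]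
          by_cases hq' : q < v * s.idx 0 0
          · rw [if_pos hq', if_pos (by omega)]
          · rw [if_neg hq', if_neg (by omega)]
    · rw [exec_ite_neg ω (by
        simp only [BExp.eval, IExp.eval, hv4, e10]
        exact fun h' => hvL (Nat.lt_of_succ_le h')), exec_skip, State.tick_tick]
      obtain ⟨k, hk⟩ : ∃ k, k = (BExp.ile (.add (icell 4) (.lit 1)) (icell 10)).size + 1 + 1 :=
        ⟨_, rfl⟩
      rw [← hk]
      obtain ⟨n1, n2, n3⟩ := exec_nextLevel ω (t.tick k)
      refine ⟨?_, ?_, ?_⟩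
      · rw [n1, State.tick_mem, i1, pow_succ]; ring
      · rw [n2, State.tick_idx, i2, e0, add_mul, one_mul]
      · rw [n3.mem 7 (by simp), State.tick_mem, i3,
          show min (v + 1) (s.idx 10 0) = min v (s.idx 10 0) by omega])
  have hn : partiesCell.eval s = s.idx 0 2 := rfl
  rw [hn, Nat.min_eq_right hL] at key
  exact key.2.2

/-- Execute `c` with the index cell `(9, 0)` running through the numbers below `n * m`. -/
def flatLoop (c : Cmd) : Cmd :=
  seq (setIdx 9 (.lit 0) (.lit 0)) (loop 1 partiesCell (loop 2 dimCell
    (seq c (setIdx 9 (.lit 0) (.add (icell 9) (.lit 1))))))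

/-- A product is not an admissible loop bound, so two nested loops maintain a running counter. This
rule hides the nesting. Invariants may depend on neither the two loop counters nor the running one.
-/
theorem exec_flatLoop (ω : Tape) (c : Cmd) (hc : c.idxOut = []) (s : State) (I : ℕ → State → Prop)
    (hI : ∀ q t t', t'.mem = t.mem → t'.pos = t.pos → (∀ b, b ∉ [1, 2, 9] → t'.idx b = t.idx b) →
      I q t → I q t')
    (h0 : I 0 s)
    (hstep : ∀ q, q < s.idx 0 2 * s.idx 0 0 → ∀ t, Frame [1, 2, 9] c.realOut s t → t.idx 9 0 = q →
      I q t → I (q + 1) (c.exec ω t)) :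
    I (s.idx 0 2 * s.idx 0 0) ((flatLoop c).exec ω s) := by
  rw [flatLoop, exec_seq]
  set s1 := (setIdx 9 (.lit 0) (.lit 0)).exec ω s with hs1
  have hf1 : Frame [9] [] s s1 := exec_frame ω (setIdx 9 (.lit 0) (.lit 0)) s
  set body : Cmd := seq c (setIdx 9 (.lit 0) (.add (icell 9) (.lit 1))) with hbody
  have key := exec_loop ω 1 partiesCell (loop 2 dimCell body) s1
    (fun v t => t.idx 9 0 = v * s.idx 0 0 ∧ I (v * s.idx 0 0) t)
    (fun v t t' hm hp hi h => ⟨by rw [hi 9 (by simp)]; exact h.1, hI _ t t' hm hp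
      (fun b hb => hi b (by rintro rfl; simp at hb)) h.2⟩)
    ⟨by simp [hs1, exec, IExp.eval], by
      rw [zero_mul]
      exact hI 0 s s1 rfl rfl (fun b hb => hf1.idx b (by simp at hb ⊢; tauto)) h0⟩ ?_
  · have hn : partiesCell.eval s1 = s.idx 0 2 := by simp only [IExp.eval, hf1.idx 0 (by simp)]
    rw [hn] at key
    exact key.2
  intro v hv t hf hv1 ⟨i1, i2⟩
  have hft : Frame [1, 2, 9] c.realOut s t := (hf1.mono (by simp) (by simp)).trans
    (hf.mono (by simp [hbody, idxOut, hc]) (by simp [hbody, realOut]))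
  have e0 : t.idx 0 = s.idx 0 := hft.idx 0 (by simp)
  have key2 := exec_loop ω 2 dimCell body t
    (fun w t => t.idx 9 0 = v * s.idx 0 0 + w ∧ I (v * s.idx 0 0 + w) t)
    (fun w t t' hm hp hi h => ⟨by rw [hi 9 (by simp)]; exact h.1, hI _ t t' hm hp
      (fun b hb => hi b (by rintro rfl; simp at hb)) h.2⟩)
    ⟨by simpa using i1, by simpa using i2⟩ (by
    intro w hw t' hf' hw2 ⟨j1, j2⟩
    have hft' : Frame [1, 2, 9] c.realOut s t' := hft.trans
      (hf'.mono (by simp [hbody, idxOut, hc]) (by simp [hbody, realOut]))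
    have hvn : v < s.idx 0 2 := by simpa only [IExp.eval, hf1.idx 0 (by simp)] using hv
    have hwm : w < s.idx 0 0 := by simpa only [IExp.eval, e0] using hw
    have hlt : v * s.idx 0 0 + w < s.idx 0 2 * s.idx 0 0 := by
      have := Nat.mul_le_mul_right (s.idx 0 0) (Nat.succ_le_of_lt hvn)
      rw [Nat.succ_mul] at this
      omega
    have hst := hstep _ hlt t' hft' j1 j2
    have hc9 : (c.exec ω t').idx 9 = t'.idx 9 := (exec_frame ω c t').idx 9 (by simp [hc])
    rw [hbody, exec_seq]
    refine ⟨by simp [exec, IExp.eval, hc9, j1]; ring,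
      hI (v * s.idx 0 0 + w + 1) (c.exec ω t') _ rfl rfl (fun b hb => ?_) hst⟩
    exact (exec_frame ω (setIdx 9 (.lit 0) (.add (icell 9) (.lit 1))) (c.exec ω t')).idx b
      (by simp [idxOut] at hb ⊢; tauto))
  have hn : dimCell.eval t = s.idx 0 0 := by simp only [IExp.eval, e0]
  rw [hn] at key2
  rw [add_mul, one_mul]
  exact key2

/-- Draw Gaussian variables and project the stacked increments. -/
def project : Cmd :=
  flatLoop (seq (gauss 8 (.lit 0) (icell 9))
    (seq (setReal 11 (.lit 0) (.lit 0) (.add (rcell 11)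
        (.mul (.read 8 (.lit 0) (icell 9)) (.read 7 (.lit 0) (icell 9)))))
      (setReal 12 (.lit 0) (.lit 0) (.add (rcell 12) (.sq (.read 7 (.lit 0) (icell 9)))))))

/-- One Gaussian is drawn per round, so the coordinate `c` uses the tape cell `c`. The draws are
stored because the message contains them again; the sum of squares is needed for the completing
coordinate. -/
theorem exec_project (ω : Tape) (s : State) (hp : s.pos = 0) (h11 : s.mem 11 0 0 = 0)
    (h12 : s.mem 12 0 0 = 0) :
    (project.exec ω s).pos = s.idx 0 2 * s.idx 0 0 ∧
      (project.exec ω s).mem 11 0 0 =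
        ∑ c ∈ Finset.range (s.idx 0 2 * s.idx 0 0), (ω c).1 * s.mem 7 0 c ∧
      (project.exec ω s).mem 12 0 0 =
        ∑ c ∈ Finset.range (s.idx 0 2 * s.idx 0 0), s.mem 7 0 c ^ 2 ∧
      ∀ c < s.idx 0 2 * s.idx 0 0, (project.exec ω s).mem 8 0 c = (ω c).1 := by
  refine exec_flatLoop ω _ rfl s (fun q t => t.pos = q ∧
    t.mem 11 0 0 = ∑ c ∈ Finset.range q, (ω c).1 * s.mem 7 0 c ∧
    t.mem 12 0 0 = ∑ c ∈ Finset.range q, s.mem 7 0 c ^ 2 ∧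
    ∀ c < q, t.mem 8 0 c = (ω c).1)
    (fun q t t' hm hp _ h => by rw [hm, hp]; exact h)
    ⟨hp, by simpa using h11, by simpa using h12, by simp⟩ ?_
  rintro q hq t hf h9 ⟨i1, i2, i3, i4⟩
  have m7 : t.mem 7 = s.mem 7 := hf.mem 7 (by simp [realOut])
  refine ⟨?_, ?_, ?_, ?_⟩
  · simp [exec, i1]
  · simp [exec, RExp.eval, IExp.eval, h9, m7, i2, i1, Finset.sum_range_succ]
  · simp [exec, RExp.eval, IExp.eval, h9, m7, i3, Finset.sum_range_succ, sq]
  · intro c hc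
    simp only [exec, RExp.eval, IExp.eval, State.tick_mem, State.writeReal_mem, State.tick_idx,
      State.writeReal_idx, State.advance_mem, h9, i1]
    by_cases h : c = q
    · simp [h]
    · simp [h, i4 c (by omega)]

/-- Draw the bit that is sent. -/
def drawBit : Cmd :=
  seq (gauss 13 (.lit 0) (.lit 0))
    (seq (setReal 11 (.lit 0) (.lit 0) (.add (rcell 11) (.mul (rcell 13)
        (.sqrt (.sub (.mul (.lit (9 / 4)) (.mul (.ofIdx (icell 10)) (.ofIdx dimCell)))
          (rcell 12))))))
      (seq (unif 13 (.lit 0) (.lit 1))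
        (seq (ite (.rle (.lit 0) (rcell 11))
            (setReal 13 (.lit 0) (.lit 2)
              (.add (.lit (1 / 2)) (.div (.read 0 (.lit 0) (.lit 1)) (.lit 8))))
            (setReal 13 (.lit 0) (.lit 2)
              (.sub (.lit (1 / 2)) (.div (.read 0 (.lit 0) (.lit 1)) (.lit 8)))))
          (ite (.rle (.read 13 (.lit 0) (.lit 1)) (.read 13 (.lit 0) (.lit 2)))
            (setReal 13 (.lit 0) (.lit 3) (.lit 1)) (setReal 13 (.lit 0) (.lit 3) (.lit (-1)))))))

/-- Either kind of draw consumes a whole tape cell. The completing Gaussian thus comes from the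
current cell and the uniform variable from the next one. -/
theorem exec_drawBit (ω : Tape) (s : State) :
    (drawBit.exec ω s).mem 13 0 3 = randomizedSign (s.mem 0 0 1)
      (s.mem 11 0 0 + (ω s.pos).1 * √(9 / 4 * ((s.idx 10 0 : ℝ) * s.idx 0 0) - s.mem 12 0 0))
      (ω (s.pos + 1)).2 := by
  set S := s.mem 11 0 0 +
    (ω s.pos).1 * √(9 / 4 * ((s.idx 10 0 : ℝ) * s.idx 0 0) - s.mem 12 0 0) with hS
  set c1 : Cmd := seq (gauss 13 (.lit 0) (.lit 0))
    (seq (setReal 11 (.lit 0) (.lit 0) (.add (rcell 11) (.mul (rcell 13)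
        (.sqrt (.sub (.mul (.lit (9 / 4)) (.mul (.ofIdx (icell 10)) (.ofIdx dimCell)))
          (rcell 12)))))) (unif 13 (.lit 0) (.lit 1))) with hc1
  set c2 : Cmd := ite (.rle (.lit 0) (rcell 11))
            (setReal 13 (.lit 0) (.lit 2)
              (.add (.lit (1 / 2)) (.div (.read 0 (.lit 0) (.lit 1)) (.lit 8))))
            (setReal 13 (.lit 0) (.lit 2)
              (.sub (.lit (1 / 2)) (.div (.read 0 (.lit 0) (.lit 1)) (.lit 8)))) with hc2
  set c3 : Cmd := ite (.rle (.read 13 (.lit 0) (.lit 1)) (.read 13 (.lit 0) (.lit 2)))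
            (setReal 13 (.lit 0) (.lit 3) (.lit 1)) (setReal 13 (.lit 0) (.lit 3) (.lit (-1)))
    with hc3
  have hex : drawBit.exec ω s = c3.exec ω (c2.exec ω (c1.exec ω s)) := rfl
  have hS1 : (c1.exec ω s).mem 11 0 0 = S := by
    simp [hc1, exec, RExp.eval, IExp.eval, hS]
  have hu1 : (c1.exec ω s).mem 13 0 1 = (ω (s.pos + 1)).2 := by
    simp [hc1, exec, RExp.eval, IExp.eval]
  have he1 : (c1.exec ω s).mem 0 = s.mem 0 := (exec_frame ω c1 s).mem 0 (by simp [hc1, realOut])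
  rw [hex]
  set s1 := c1.exec ω s with hs1
  have hp2 : (c2.exec ω s1).mem 13 0 2 = bitProb (s.mem 0 0 1) S := by
    by_cases h : 0 ≤ S
    · rw [hc2, exec_ite_pos ω (by simpa [BExp.eval, RExp.eval, IExp.eval, hS1] using h)]
      simp [exec, RExp.eval, IExp.eval, he1, bitProb, h]
    · rw [hc2, exec_ite_neg ω (by simpa [BExp.eval, RExp.eval, IExp.eval, hS1] using h)]
      simp [exec, RExp.eval, IExp.eval, he1, bitProb, h]
  have hu2 : (c2.exec ω s1).mem 13 0 1 = (ω (s.pos + 1)).2 := by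
    by_cases h : 0 ≤ S
    · rw [hc2, exec_ite_pos ω (by simpa [BExp.eval, RExp.eval, IExp.eval, hS1] using h)]
      simp [exec, RExp.eval, IExp.eval, hu1]
    · rw [hc2, exec_ite_neg ω (by simpa [BExp.eval, RExp.eval, IExp.eval, hS1] using h)]
      simp [exec, RExp.eval, IExp.eval, hu1]
  set s2 := c2.exec ω s1 with hs2
  by_cases h : ((ω (s.pos + 1)).2 : ℝ) ≤ bitProb (s.mem 0 0 1) S
  · rw [hc3, exec_ite_pos ω (by simpa [BExp.eval, RExp.eval, IExp.eval, hp2, hu2] using h)]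
    simp [exec, RExp.eval, IExp.eval, randomizedSign, h]
  · rw [hc3, exec_ite_neg ω (by simpa [BExp.eval, RExp.eval, IExp.eval, hp2, hu2] using h)]
    simp [exec, RExp.eval, IExp.eval, randomizedSign, h]

/-- Write the message. -/
def send : Cmd :=
  flatLoop (setReal 3 (.lit 0) (icell 9) (.mul (.read 13 (.lit 0) (.lit 3))
    (.read 8 (.lit 0) (icell 9))))

theorem exec_send (ω : Tape) (s : State) (h3 : ∀ c, s.mem 3 0 c = 0) :
    (send.exec ω s).mem 3 0 = fun c => if c < s.idx 0 2 * s.idx 0 0 then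
      s.mem 13 0 3 * s.mem 8 0 c else 0 := by
  refine exec_flatLoop ω _ rfl s (fun q t => t.mem 3 0 = fun c => if c < q then
      s.mem 13 0 3 * s.mem 8 0 c else 0)
    (fun q t t' hm _ _ h => by rw [hm]; exact h) (by funext c; simp [h3]) ?_
  intro q hq t hf h9 ih
  funext c
  simp only [exec, RExp.eval, IExp.eval, State.tick_mem, State.writeReal_mem, true_and, h9, ih,
    hf.mem 13 (by simp [realOut]), hf.mem 8 (by simp [realOut])]
  by_cases h : c = q
  · simp [h]
  · by_cases h' : c < q
    · rw [if_neg h, if_pos h', if_pos (by omega)]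
    · rw [if_neg h, if_neg h', if_neg (by omega)]

/-- The program of the parties. -/
def chainingClient : Cmd :=
  seq findOwn (seq distances (seq countLevels (seq clientLoop (seq project (seq drawBit send)))))

/-- The zero hypotheses concern counters and accumulators that the program uses without clearing
them, and the cells beyond the output that the message must leave at zero. -/
theorem exec_chainingClient (ω : Tape) (s : State) (own : ℕ) (hown : own < s.idx 0 1)
    (hx : ∀ l < s.idx 0 0, s.mem 1 own l = s.mem 2 0 l)
    (huniq : ∀ k < s.idx 0 1, (∀ l < s.idx 0 0, s.mem 1 k l = s.mem 2 0 l) → k = own)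
    (hp : s.pos = 0) (h3 : ∀ c, s.mem 3 0 c = 0)
    (h7 : ∀ c, s.mem 7 0 c = 0) (h9 : s.idx 9 0 = 0) (h10 : s.idx 10 0 = 0)
    (h11 : s.mem 11 0 0 = 0) (h12 : s.mem 12 0 0 = 0) :
    (chainingClient.exec ω s).mem 3 0 = fun c => if c < s.idx 0 2 * s.idx 0 0 then
      randomizedSign (s.mem 0 0 1) (projection (s.idx 0 0) (s.idx 0 1) (s.idx 0 2)
        (numHalvings (s.mem 0 0 0 / 2) (s.idx 0 2)) (s.mem 1) own ω)
        (ω (s.idx 0 2 * s.idx 0 0 + 1)).2 * (ω c).1 else 0 := by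
  rw [chainingClient, exec_seq, exec_seq, exec_seq, exec_seq, exec_seq, exec_seq]
  have k1 := exec_findOwn ω s ⟨own, hown, hx⟩
  have hf1 : Frame [1, 3, 8] [14] s (findOwn.exec ω s) := (exec_frame ω findOwn s).mono
    (by simp [findOwn, sumInto, idxOut]) (by simp [findOwn, sumInto, realOut])
  have p1 := exec_pos ω findOwn (by simp [findOwn, sumInto, CoinFree]) s
  set s1 := findOwn.exec ω s with hs1
  have own1 : s1.idx 8 0 = own := huniq _ k1.1 k1.2
  have k2 := exec_distances ω s1
  have hf2 : Frame [1, 2, 3] [4] s1 (distances.exec ω s1) := (exec_frame ω distances s1).mono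
    (by simp [distances, sumInto, idxOut]) (by simp [distances, sumInto, realOut])
  have p2 := exec_pos ω distances (by simp [distances, sumInto, CoinFree]) s1
  set s2 := distances.exec ω s1 with hs2
  have hf02 : Frame [1, 2, 3, 8] [4, 14] s s2 := (hf1.mono (by simp) (by simp)).trans
    (hf2.mono (by simp) (by simp))
  have k3 := exec_countLevels ω s2 (by rw [hf02.idx 10 (by simp), h10])
  have hf3 : Frame [1, 10] [5] s2 (countLevels.exec ω s2) := (exec_frame ω countLevels s2).mono
    (by simp [countLevels, idxOut]) (by simp [countLevels, realOut])
  have p3 := exec_pos ω countLevels (by simp [countLevels, CoinFree]) s2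
  set s3 := countLevels.exec ω s2 with hs3
  have hf03 : Frame [1, 2, 3, 8, 10] [4, 5, 14] s s3 := (hf02.mono (by simp) (by simp)).trans
    (hf3.mono (by simp) (by simp))
  rw [hf02.mem 0 (by simp), hf02.idx 0 (by simp)] at k3
  rw [hf1.idx 0 (by simp), hf1.mem 1 (by simp)] at k2
  have own3 : s3.idx 8 0 = own := by rw [hf3.idx 8 (by simp), hf2.idx 8 (by simp), own1]
  have e3 : s3.idx 0 = s.idx 0 := hf03.idx 0 (by simp)
  have m3 : s3.mem 1 = s.mem 1 := hf03.mem 1 (by simp)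
  have k4 := exec_clientLoop ω s3 (by rwa [own3, e3])
    (by rw [e3, m3, hf3.mem 4 (by simp)]; exact fun i hi j hj => k2 i j hi hj) k3.2
    (by rw [hf03.mem 7 (by simp)]; exact h7) (by rw [hf03.idx 9 (by simp), h9])
    (by rw [k3.1, e3]; exact numHalvings_le _ _)
  have hf4 := frame_clientLoop ω s3
  have p4 := exec_pos ω clientLoop (by
    simp [clientLoop, clientRound, clientLevel, levelNets, netInto, nextLevel, CoinFree]) s3
  set s4 := clientLoop.exec ω s3 with hs4
  have hf04 : Frame [1, 2, 3, 4, 6, 7, 8, 9, 10] [4, 5, 7, 14] s s4 :=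
    (hf03.mono (by simp) (by simp)).trans (hf4.mono (by simp) (by simp))
  rw [own3, m3, e3, k3.1] at k4
  have e4 : s4.idx 0 = s.idx 0 := hf04.idx 0 (by simp)
  have k5 := exec_project ω s4 (by rw [p4, p3, p2, p1, hp]) (by rw [hf04.mem 11 (by simp), h11])
    (by rw [hf04.mem 12 (by simp), h12])
  have hf5 : Frame [1, 2, 9] [8, 11, 12] s4 (project.exec ω s4) := (exec_frame ω project s4).mono
    (by simp [project, flatLoop, idxOut]) (by simp [project, flatLoop, realOut])
  set s5 := project.exec ω s4 with hs5
  have hf05 : Frame [1, 2, 3, 4, 6, 7, 8, 9, 10] [4, 5, 7, 8, 11, 12, 14] s s5 :=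
    (hf04.mono (by simp) (by simp)).trans (hf5.mono (by simp) (by simp))
  rw [e4, k4] at k5
  obtain ⟨q1, q2, q3, q4⟩ := k5
  have k6 := exec_drawBit ω s5
  have hf6 : Frame [] [11, 13] s5 (drawBit.exec ω s5) := (exec_frame ω drawBit s5).mono
    (by simp [drawBit, idxOut]) (by simp [drawBit, realOut])
  set s6 := drawBit.exec ω s5 with hs6
  have hf06 : Frame [1, 2, 3, 4, 6, 7, 8, 9, 10] [4, 5, 7, 8, 11, 12, 13, 14] s s6 :=
    (hf05.mono (by simp) (by simp)).trans (hf6.mono (by simp) (by simp))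
  rw [hf05.mem 0 (by simp), hf5.idx 10 (by simp), hf4.idx 10 (by simp), k3.1,
    hf05.idx 0 (by simp), q1, q2, q3] at k6
  rw [exec_send ω s6 (by rw [hf06.mem 3 (by simp)]; exact h3), k6, hf06.idx 0 (by simp),
    hf6.mem 8 (by simp)]
  funext c
  by_cases hc : c < s.idx 0 2 * s.idx 0 0
  · rw [if_pos hc, if_pos hc, q4 c hc]
    rfl
  · rw [if_neg hc, if_neg hc]

end Cmd

/-! ## The protocol -/

/-- The local chaining mechanism. Every party sends a single bit times a Gaussian vector, from
which the server recovers the mean of the increments of all levels of a chain of nets. -/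
def chainingProtocol : Protocol := ⟨Cmd.chainingClient, Cmd.chainingServer⟩

/-- The coordinates of the points of the universe. -/
def coords {m N : ℕ} (u : Fin N → EuclideanSpace ℝ (Fin m)) (i j : ℕ) : ℝ :=
  if h : i < N ∧ j < m then u ⟨i, h.1⟩ ⟨j, h.2⟩ else 0

theorem coords_fin {m N : ℕ} (u : Fin N → EuclideanSpace ℝ (Fin m)) (i : Fin N) (j : Fin m) :
    coords u i j = u i j := by
  simp [coords]

/-! ### The message, the output and the running time of the protocol. -/

section Chaining

variable {m N : ℕ} (u : Fin N → EuclideanSpace ℝ (Fin m)) (n : ℕ) (α ε : ℝ)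

theorem chainingProtocol_message (hu : Function.Injective u) (i : Fin n) (k : Fin N) (ω : Tape) :
    chainingProtocol.message u n α ε i (u k) ω = fun c => if c < n * m then
      randomizedSign ε (projection m N n (numHalvings (α / 2) n) (coords u) k ω)
        (ω (n * m + 1)).2 * (ω c).1 else 0 := by
  refine Cmd.exec_chainingClient ω (partyState u n α ε i (u k)) k k.2 ?_ ?_ rfl
    (fun _ => rfl) (fun _ => rfl) rfl rfl rfl rfl
  · intro l hl
    change l < m at hl
    change coords u k l = _
    simp [coords, hl, partyState, initState]
  · intro k' hk' h
    change k' < N at hk'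
    -- Since the list has no repetitions, a party recovers its index from its coordinates.
    have : (⟨k', hk'⟩ : Fin N) = k := by
      refine hu (PiLp.ext fun l => ?_)
      have hl := h l l.2
      change coords u k' l = _ at hl
      simpa [coords, hk', partyState, initState] using hl
    exact congrArg Fin.val this

theorem chainingProtocol_output (hN : 0 < N) (X : Fin n → EuclideanSpace ℝ (Fin m))
    (ω : (Fin n → Tape) × Tape) :
    ∃ c : ℕ → ℕ → ℝ, (∀ v < numHalvings (α / 2) n,
      FrankWolfe m N (increment m N (coords u) ((1 / 2) ^ v))
      (fun j => serverScale m n (numHalvings (α / 2) n) ε ((1 / 2) ^ v) *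
        ∑ i : Fin n, chainingProtocol.message u n α ε i (X i) (ω.1 i) (v * m + j)) n (c v)) ∧
      ∀ j : Fin m, chainingProtocol.output u n α ε X ω j =
        if 1 / 2 ≤ α then 1 / 2 else coords u 0 j +
          ∑ v ∈ Finset.range (numHalvings (α / 2) n), c v j := by
  obtain ⟨c, h1, h2⟩ := Cmd.exec_chainingServer ω.2 (serverState u n α ε fun i =>
    chainingProtocol.message u n α ε i (X i) (ω.1 i)) hN rfl rfl
  refine ⟨c, fun v hv => (h1 v hv).congr (fun i _ j _ => rfl) fun j _ => ?_, fun j => h2 j j.2⟩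
  congr 1
  rw [← Fin.sum_univ_eq_sum_range (fun i => (serverState u n α ε fun i =>
    chainingProtocol.message u n α ε i (X i) (ω.1 i)).mem 2 i _)]
  exact Finset.sum_congr rfl fun i _ => dif_pos (show (i : ℕ) < n from i.2)

/-- A polynomial bound for the running time of the protocol. -/
def chainingTime : Polynomial ℕ :=
  Polynomial.X * Cmd.chainingClient.costPoly + Cmd.chainingServer.costPoly

theorem chainingClient_tame : Cmd.chainingClient.Tame := by
  simp [Cmd.chainingClient, Cmd.findOwn, Cmd.distances, Cmd.countLevels, Cmd.clientLoop,
    Cmd.clientRound, Cmd.clientLevel, Cmd.levelNets, Cmd.netInto, Cmd.nextLevel, Cmd.project,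
    Cmd.flatLoop, Cmd.drawBit, Cmd.send, Cmd.sumInto, Cmd.Tame]

theorem chainingServer_tame : Cmd.chainingServer.Tame := by
  simp [Cmd.chainingServer, Cmd.distances, Cmd.countLevels, Cmd.serverLoop,
    Cmd.serverRound, Cmd.serverLevel, Cmd.levelNets, Cmd.netInto, Cmd.nextLevel, Cmd.increments,
    Cmd.average, Cmd.frankWolfe, Cmd.frankWolfeStep, Cmd.sumInto, Cmd.Tame]

theorem chainingProtocol_totalTime (X : Fin n → EuclideanSpace ℝ (Fin m))
    (ω : (Fin n → Tape) × Tape) :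
    chainingProtocol.totalTime u n α ε X ω ≤ chainingTime.eval (N + n + m) := by
  have hc : ∀ i, (chainingProtocol.partyRun u n α ε i (X i) (ω.1 i)).time ≤
      Cmd.chainingClient.costPoly.eval (N + n + m) := fun i =>
    (Cmd.exec_time_le (ω.1 i) _ chainingClient_tame (N + n + m) _ (by
      intro k hk
      interval_cases k <;> simp [partyState, initState] <;> omega)).trans
      (by simp [partyState, initState])
  have hs : (chainingProtocol.serverRun u n α ε X ω).time ≤
      Cmd.chainingServer.costPoly.eval (N + n + m) :=
    (Cmd.exec_time_le ω.2 _ chainingServer_tame (N + n + m) _ (by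
      intro k hk
      interval_cases k <;> simp [serverState, initState] <;> omega)).trans
      (by simp [serverState, initState])
  have hsum := Finset.sum_le_sum fun i (_ : i ∈ Finset.univ) => hc i
  rw [Finset.sum_const, Finset.card_univ, Fintype.card_fin, smul_eq_mul] at hsum
  simp only [chainingTime, Polynomial.eval_add, Polynomial.eval_mul, Polynomial.eval_X]
  refine add_le_add (hsum.trans (Nat.mul_le_mul_right _ (by omega))) hs

end Chaining

/-! ## The random bit -/

/-- The Gaussian variables in the first cells of the tape. -/
def gaussians (d : ℕ) (ω : Tape) : EuclideanSpace ℝ (Fin d) := WithLp.toLp 2 fun c => (ω c).1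

@[fun_prop]
theorem measurable_gaussians (d : ℕ) : Measurable (gaussians d) :=
  (WithLp.measurable_toLp 2 (Fin d → ℝ)).comp (measurable_pi_lambda _ fun c =>
    measurable_fst.comp (measurable_pi_apply (c : ℕ)))

/-- The first `d` Gaussian variables of the tape form a standard Gaussian vector, which is
independent of the next uniform variable. -/
theorem map_tapeLaw (d : ℕ) : tapeLaw.map (fun ω => (gaussians d ω, (ω d).2)) =
    (stdGaussian (EuclideanSpace ℝ (Fin d))).prod volume := by
  have hind : iIndepFun (fun (c : ℕ) (ω : Tape) => ω c) tapeLaw :=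
    iIndepFun_infinitePi (X := fun _ x => x) fun _ => measurable_id
  have hlaw : ∀ c : ℕ, tapeLaw.map (fun ω : Tape => ω c) =
      (gaussianReal 0 1).prod (volume : Measure unitInterval) := fun c =>
    Measure.infinitePi_map_eval _ c
  have hd := hind.indepFun_finset (Finset.range d) {d} (by simp) fun c => measurable_pi_apply c
  have hUm : Measurable fun ω : Tape => (ω d).2 := measurable_snd.comp (measurable_pi_apply d)
  have hI : IndepFun (gaussians d) (fun ω : Tape => (ω d).2) tapeLaw :=
    hd.comp (φ := fun x : Finset.range d → ℝ × unitInterval =>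
        (WithLp.toLp 2 fun c : Fin d => (x ⟨c, Finset.mem_range.2 c.2⟩).1 :
          EuclideanSpace ℝ (Fin d)))
      (ψ := fun x : ({d} : Finset ℕ) → ℝ × unitInterval => (x ⟨d, by simp⟩).2)
      ((WithLp.measurable_toLp 2 (Fin d → ℝ)).comp (measurable_pi_lambda _ fun c =>
        measurable_fst.comp (measurable_pi_apply _)))
      (measurable_snd.comp (measurable_pi_apply _))
  rw [(indepFun_iff_map_prod_eq_prod_map_map (measurable_gaussians d).aemeasurable
    hUm.aemeasurable).1 hI]
  congr 1
  · have hG : iIndepFun (fun (c : Fin d) (ω : Tape) => (ω c).1) tapeLaw :=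
      (hind.precomp Fin.val_injective).comp (fun _ => Prod.fst) fun _ => measurable_fst
    have hGm : ∀ c : Fin d, Measurable fun ω : Tape => (ω c).1 := fun c =>
      measurable_fst.comp (measurable_pi_apply (c : ℕ))
    have h := hG.map_fun_eq_pi_map fun c => (hGm c).aemeasurable
    have h1 : ∀ c : Fin d, tapeLaw.map (fun ω : Tape => (ω c).1) = gaussianReal 0 1 := fun c => by
      have := Measure.map_map (μ := tapeLaw) measurable_fst (measurable_pi_apply (c : ℕ))
      rw [hlaw, Measure.map_fst_prod, measure_univ, one_smul] at this
      exact this.symm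
    simp only [h1] at h
    rw [← map_pi_eq_stdGaussian, ← h, Measure.map_map (WithLp.measurable_toLp 2 (Fin d → ℝ))
      (measurable_pi_lambda _ hGm)]
    rfl
  · have := Measure.map_map (μ := tapeLaw) measurable_snd (measurable_pi_apply d)
    rw [hlaw, Measure.map_snd_prod, measure_univ, one_smul] at this
    exact this.symm

/-! ### Privacy of the randomized bit. -/

theorem bitProb_mem {ε : ℝ} (h0 : 0 < ε) (S : ℝ) :
    bitProb ε S ∈ Set.Icc (1 / 2 - ε / 8) (1 / 2 + ε / 8) := by
  unfold bitProb
  split_ifs <;> constructor <;> linarith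

/-- The worst ratio is that of 1/2 + ε/8 to 1/2 - ε/8. It is at most 1 + ε as long as ε ≤ 2, and 1 +
ε ≤ e^ε. -/
theorem bitProb_le_exp_mul {ε : ℝ} (h0 : 0 < ε) (h1 : ε ≤ 3 / 2) (S S' : ℝ) :
    bitProb ε S ≤ Real.exp ε * bitProb ε S' ∧
      1 - bitProb ε S ≤ Real.exp ε * (1 - bitProb ε S') := by
  have h := bitProb_mem h0 S
  have h' := bitProb_mem h0 S'
  have he := Real.add_one_le_exp ε
  constructor <;> nlinarith [h.1, h.2, h'.1, h'.2]

@[fun_prop]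
theorem measurable_bitProb (ε : ℝ) : Measurable (bitProb ε) :=
  Measurable.ite measurableSet_Ici measurable_const measurable_const

@[fun_prop]
theorem measurable_randomizedSign (ε : ℝ) :
    Measurable fun p : ℝ × unitInterval => randomizedSign ε p.1 p.2 :=
  Measurable.ite (measurableSet_le (measurable_subtype_coe.comp measurable_snd)
    ((measurable_bitProb ε).comp measurable_fst)) measurable_const measurable_const

theorem volume_le_bitProb {ε : ℝ} (h0 : 0 < ε) (h1 : ε ≤ 3 / 2) (S : ℝ) :
    (volume : Measure unitInterval) {u | (u : ℝ) ≤ bitProb ε S} = ENNReal.ofReal (bitProb ε S) := by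
  have h := bitProb_mem h0 S
  exact unitInterval.volume_Iic ⟨bitProb ε S, by linarith [h.1], by linarith [h.2]⟩

theorem volume_bitProb_lt {ε : ℝ} (h0 : 0 < ε) (h1 : ε ≤ 3 / 2) (S : ℝ) :
    (volume : Measure unitInterval) {u | ¬ (u : ℝ) ≤ bitProb ε S} =
      ENNReal.ofReal (1 - bitProb ε S) := by
  have h := bitProb_mem h0 S
  rw [← unitInterval.volume_Ioi ⟨bitProb ε S, by linarith [h.1], by linarith [h.2]⟩]
  congr 1
  ext u
  exact not_le

/-- A message that depends on the input only through the randomized sign is private. -/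
theorem measure_randomizedSign_le {E Y : Type*} [MeasurableSpace E] [MeasurableSpace Y]
    (γ : Measure E) [SFinite γ] {ε : ℝ} (h0 : 0 < ε) (h1 : ε ≤ 3 / 2) {f f' : E → ℝ}
    (hf : Measurable f) (hf' : Measurable f') {F : E × ℝ → Y} (hF : Measurable F) {S : Set Y}
    (hS : MeasurableSet S) :
    (γ.prod (volume : Measure unitInterval)) {p | F (p.1, randomizedSign ε (f p.1) p.2) ∈ S} ≤
      ENNReal.ofReal (Real.exp ε) *
        (γ.prod (volume : Measure unitInterval))
          {p | F (p.1, randomizedSign ε (f' p.1) p.2) ∈ S} := by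
  have hmeas : ∀ {f : E → ℝ}, Measurable f →
      MeasurableSet {p : E × unitInterval | F (p.1, randomizedSign ε (f p.1) p.2) ∈ S} :=
    fun hf => hS.preimage (hF.comp (measurable_fst.prodMk ((measurable_randomizedSign ε).comp
      ((hf.comp measurable_fst).prodMk measurable_snd))))
  rw [Measure.prod_apply (hmeas hf), Measure.prod_apply (hmeas hf'),
    ← lintegral_const_mul _ (measurable_measure_prodMk_left (hmeas hf'))]
  refine lintegral_mono fun x => ?_
  classical
  -- With the Gaussian part fixed there are only two possible messages. The probability of `S` is a
  -- sum of at most two bit probabilities, which are compared one by one.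
  have hset : ∀ s : ℝ, (volume : Measure unitInterval) {u | F (x, randomizedSign ε s u) ∈ S} =
      (if F (x, 1) ∈ S then ENNReal.ofReal (bitProb ε s) else 0) +
      (if F (x, -1) ∈ S then ENNReal.ofReal (1 - bitProb ε s) else 0) := by
    intro s
    have hp := bitProb_mem h0 s
    by_cases ha : F (x, 1) ∈ S <;> by_cases hb : F (x, -1) ∈ S
    · have : {u : unitInterval | F (x, randomizedSign ε s u) ∈ S} = Set.univ := by
        ext u
        simp only [randomizedSign, Set.mem_ofPred_eq, Set.mem_univ, iff_true]
        split_ifs <;> assumption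
      rw [this, measure_univ, if_pos ha, if_pos hb, ← ENNReal.ofReal_add (by linarith [hp.1])
        (by linarith [hp.2])]
      simp
    · rw [if_pos ha, if_neg hb, add_zero, ← volume_le_bitProb h0 h1]
      congr 1
      ext u
      simp only [randomizedSign, Set.mem_ofPred_eq]
      split_ifs with h <;> simp [ha, hb, h]
    · rw [if_neg ha, if_pos hb, zero_add, ← volume_bitProb_lt h0 h1]
      congr 1
      ext u
      simp only [randomizedSign, Set.mem_ofPred_eq]
      split_ifs with h <;> simp [ha, hb, h]
    · have : {u : unitInterval | F (x, randomizedSign ε s u) ∈ S} = ∅ := by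
        ext u
        simp only [randomizedSign, Set.mem_ofPred_eq, Set.mem_empty_iff_false, iff_false]
        split_ifs <;> assumption
      rw [this, measure_empty, if_neg ha, if_neg hb, add_zero]
  have key := bitProb_le_exp_mul h0 h1 (f x) (f' x)
  change (volume : Measure unitInterval) {u | F (x, randomizedSign ε (f x) u) ∈ S} ≤
    ENNReal.ofReal (Real.exp ε) *
      (volume : Measure unitInterval) {u | F (x, randomizedSign ε (f' x) u) ∈ S}
  rw [hset, hset, mul_add]
  refine add_le_add ?_ ?_
  · split_ifs
    · rw [← ENNReal.ofReal_mul (Real.exp_pos _).le]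
      exact ENNReal.ofReal_le_ofReal key.1
    · exact zero_le
  · split_ifs
    · rw [← ENNReal.ofReal_mul (Real.exp_pos _).le]
      exact ENNReal.ofReal_le_ofReal key.2
    · exact zero_le

/-- The vector of norm `3 / 2 * √(L * m)` onto which the Gaussian vector is projected. -/
def completed (m N n L : ℕ) (U : ℕ → ℕ → ℝ) (own : ℕ) : EuclideanSpace ℝ (Fin (n * m + 1)) :=
  WithLp.toLp 2 fun c => if (c : ℕ) < n * m then stacked m N L U own c else
    √(9 / 4 * ((L : ℝ) * m) - ∑ c ∈ Finset.range (n * m), stacked m N L U own c ^ 2)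

/-- Turns the computed sum into a linear functional of one Gaussian vector of dimension `n * m + 1`,
so that rotation invariance can be used. -/
theorem projection_eq_inner (m N n L : ℕ) (U : ℕ → ℕ → ℝ) (own : ℕ) (ω : Tape) :
    projection m N n L U own ω =
      inner ℝ (completed m N n L U own) (gaussians (n * m + 1) ω) := by
  rw [PiLp.inner_apply, Fin.sum_univ_castSucc, projection, Finset.sum_range]
  simp [completed, gaussians]

theorem chainingProtocol_isLDP {m N : ℕ} {u : Fin N → EuclideanSpace ℝ (Fin m)}
    (hu : Function.Injective u) (n : ℕ) (α : ℝ) {ε : ℝ} (h0 : 0 < ε) (h1 : ε ≤ 3 / 2) :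
    chainingProtocol.IsLDP u n α ε := by
  intro i k k' S hS
  set d := n * m + 1 with hd
  set T : ℕ → EuclideanSpace ℝ (Fin d) := fun k =>
    completed m N n (numHalvings (α / 2) n) (coords u) k with hT
  -- The message is a fixed function, the same for all points, of the Gaussian vector and the bit.
  -- The last Gaussian coordinate is not sent.
  set F : EuclideanSpace ℝ (Fin d) × ℝ → ℕ → ℝ := fun p c =>
    if h : c < n * m then p.2 * p.1 ⟨c, by omega⟩ else 0 with hF
  have hFm : Measurable F := by
    refine measurable_pi_lambda _ fun c => ?_
    by_cases h : c < n * m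
    · simp only [hF, h, dif_pos]
      fun_prop
    · simp only [hF, h, dif_neg, not_false_eq_true]
      fun_prop
  have hlaw : ∀ k : Fin N, chainingProtocol.messageLaw u n α ε i (u k) S =
      ((stdGaussian (EuclideanSpace ℝ (Fin d))).prod (volume : Measure unitInterval))
        {p | F (p.1, randomizedSign ε (inner ℝ (T k) p.1) p.2) ∈ S} := by
    intro k
    have hmeas : MeasurableSet {p : EuclideanSpace ℝ (Fin d) × unitInterval |
        F (p.1, randomizedSign ε (inner ℝ (T k) p.1) p.2) ∈ S} :=
      hS.preimage (hFm.comp (measurable_fst.prodMk ((measurable_randomizedSign ε).comp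
        ((by fun_prop : Measurable fun p : EuclideanSpace ℝ (Fin d) × unitInterval =>
          inner ℝ (T k) p.1).prodMk measurable_snd))))
    rw [Protocol.messageLaw, Measure.map_apply (chainingProtocol.measurable_message u n α ε i _) hS,
      ← map_tapeLaw, Measure.map_apply (f := fun ω : Tape => (gaussians d ω, (ω d).2))
        ((measurable_gaussians d).prodMk (measurable_snd.comp (measurable_pi_apply d))) hmeas]
    congr 1
    ext ω
    simp only [Set.mem_preimage, Set.mem_ofPred_eq]
    rw [chainingProtocol_message u n α ε hu, projection_eq_inner]
    have : (fun c => if c < n * m then randomizedSign ε (inner ℝ (completed m N n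
        (numHalvings (α / 2) n) (coords u) k) (gaussians (n * m + 1) ω)) (ω (n * m + 1)).2 *
        (ω c).1 else 0) = F (gaussians d ω, randomizedSign ε (inner ℝ (T k) (gaussians d ω))
          (ω d).2) := by
      funext c
      by_cases h : c < n * m
      · rw [if_pos h]
        simp only [hF]
        rw [dif_pos h]
        rfl
      · simp [hF, h]
    rw [this]
  simp only [hlaw]
  exact measure_randomizedSign_le _ h0 h1 (by fun_prop) (by fun_prop) hFm hS

/-! ## Mean and deviations of the randomized sign -/

theorem integral_abs_gaussianReal : ∫ x, |x| ∂(gaussianReal 0 1) = √(2 / Real.pi) := by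
  rw [integral_gaussianReal_eq_integral_smul one_ne_zero]
  have h1 : ∀ x : ℝ, gaussianPDFReal 0 1 x • |x| =
      (√(2 * Real.pi))⁻¹ * (fun y : ℝ => y ^ (1 : ℝ) * Real.exp (-(1 / 2) * y ^ (2 : ℝ))) |x| := by
    intro x
    simp only [gaussianPDFReal, NNReal.coe_one, mul_one, sub_zero, smul_eq_mul, Real.rpow_one,
      Real.rpow_two, sq_abs]
    ring_nf
  simp_rw [h1]
  rw [integral_const_mul, integral_comp_abs (f := fun y : ℝ => y ^ (1 : ℝ) *
    Real.exp (-(1 / 2) * y ^ (2 : ℝ))), integral_rpow_mul_exp_neg_mul_rpow (by norm_num)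
    (by norm_num) (by norm_num)]
  norm_num
  have h2 : √(2 : ℝ) ≠ 0 := by positivity
  have hpi : √Real.pi ≠ 0 := (Real.sqrt_pos.2 Real.pi_pos).ne'
  field_simp
  exact (Real.sq_sqrt (by norm_num)).symm

/-! ### Mean and exponential moments of a randomized sign times a Gaussian vector. -/

section Gaussian

variable {d : ℕ}

theorem map_inner_stdGaussian (w : EuclideanSpace ℝ (Fin d)) :
    (stdGaussian (EuclideanSpace ℝ (Fin d))).map (fun g => inner ℝ w g) =
      gaussianReal 0 (‖w‖₊ ^ 2) := by
  have h := IsGaussian.map_eq_gaussianReal (μ := stdGaussian (EuclideanSpace ℝ (Fin d)))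
    (innerSL ℝ w)
  rw [integral_strongDual_stdGaussian, variance_dual_stdGaussian, innerSL_apply_norm] at h
  convert h using 2
  · ext
    simp
  · exact NNReal.eq (by rw [Real.coe_toNNReal _ (sq_nonneg _)]; simp)

theorem integral_exp_inner_stdGaussian (w : EuclideanSpace ℝ (Fin d)) (t : ℝ) :
    Integrable (fun g => Real.exp (t * inner ℝ w g)) (stdGaussian (EuclideanSpace ℝ (Fin d))) ∧
    ∫ g, Real.exp (t * inner ℝ w g) ∂(stdGaussian (EuclideanSpace ℝ (Fin d))) =
      Real.exp (t ^ 2 * ‖w‖ ^ 2 / 2) := by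
  have hm := map_inner_stdGaussian w
  constructor
  · have h := integrable_exp_mul_gaussianReal (μ := 0) (v := ‖w‖₊ ^ 2) t
    rw [← hm] at h
    exact h.comp_aemeasurable (by fun_prop)
  · have h := mgf_gaussianReal hm t
    rw [mgf] at h
    rw [h]
    congr 1
    push_cast
    ring

theorem integral_abs_inner_stdGaussian (w : EuclideanSpace ℝ (Fin d)) :
    ∫ g, |inner ℝ w g| ∂(stdGaussian (EuclideanSpace ℝ (Fin d))) = ‖w‖ * √(2 / Real.pi) := by
  have h1 : ∫ x, |x| ∂(gaussianReal 0 (‖w‖₊ ^ 2)) = ‖w‖ * √(2 / Real.pi) := by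
    have h2 := gaussianReal_map_const_mul (μ := 0) (v := 1) ‖w‖
    rw [mul_zero, mul_one] at h2
    have h3 : NNReal.mk (‖w‖ ^ 2) (sq_nonneg _) = ‖w‖₊ ^ 2 := NNReal.eq (by rw [NNReal.coe_mk]; simp)
    rw [h3] at h2
    rw [← h2, integral_map (by fun_prop) (by fun_prop)]
    simp_rw [abs_mul, abs_norm]
    rw [integral_const_mul, integral_abs_gaussianReal]
  rw [← h1, ← map_inner_stdGaussian, integral_map (by fun_prop) (by fun_prop)]

theorem integrable_inner_stdGaussian (w : EuclideanSpace ℝ (Fin d)) :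
    Integrable (fun g => inner ℝ w g) (stdGaussian (EuclideanSpace ℝ (Fin d))) :=
  (innerSL ℝ w).integrable_comp IsGaussian.integrable_id

/-- The sign of a real number, with the convention that the sign of `0` is `1`. -/
def sgn (x : ℝ) : ℝ := if 0 ≤ x then 1 else -1

theorem measurable_sgn : Measurable sgn :=
  Measurable.ite measurableSet_Ici measurable_const measurable_const

theorem abs_sgn (x : ℝ) : |sgn x| = 1 := by
  unfold sgn; split_ifs <;> simp

theorem sgn_mul_self (x : ℝ) : sgn x * x = |x| := by
  unfold sgn
  split_ifs with h
  · rw [abs_of_nonneg h, one_mul]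
  · rw [abs_of_neg (not_le.1 h), neg_one_mul]

theorem integrable_sgn_mul_inner (T w : EuclideanSpace ℝ (Fin d)) :
    Integrable (fun g => sgn (inner ℝ T g) * inner ℝ w g)
      (stdGaussian (EuclideanSpace ℝ (Fin d))) := by
  refine (integrable_inner_stdGaussian w).bdd_mul (c := 1)
    (measurable_sgn.comp (by fun_prop)).aestronglyMeasurable (ae_of_all _ fun g => ?_)
  rw [Real.norm_eq_abs, abs_sgn]

/-- The Gaussian vector multiplied by the sign of its component along `T` has mean proportional
to `T`. -/
theorem integral_sgn_mul_inner (T w : EuclideanSpace ℝ (Fin d)) (hT : T ≠ 0) :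
    ∫ g, sgn (inner ℝ T g) * inner ℝ w g ∂(stdGaussian (EuclideanSpace ℝ (Fin d))) =
      √(2 / Real.pi) * (inner ℝ w T / ‖T‖) := by
  set γ := stdGaussian (EuclideanSpace ℝ (Fin d)) with hγ
  set a : ℝ := inner ℝ w T / ‖T‖ ^ 2 with ha
  set w' := w - a • T with hw'
  have hTn : ‖T‖ ≠ 0 := norm_ne_zero_iff.2 hT
  have hperp : inner ℝ T w' = 0 := by
    rw [hw', inner_sub_right, inner_smul_right, real_inner_self_eq_norm_sq, ha,
      real_inner_comm]
    field_simp
    ring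
  -- The reflection that fixes `T` and negates its orthogonal complement preserves the Gaussian law.
  -- It changes the sign of this integrand, so the integral vanishes.
  have hzero : ∫ g, sgn (inner ℝ T g) * inner ℝ w' g ∂γ = 0 := by
    set ρ := (Submodule.span ℝ {T}).reflection with hρ
    have hmap : γ.map ρ = γ := stdGaussian_map ρ
    have hT' : ρ T = T := Submodule.reflection_mem_subspace_eq_self
      (Submodule.mem_span_singleton_self T)
    have hw'' : ρ w' = -w' := by
      refine Submodule.reflection_mem_subspace_orthogonalComplement_eq_neg ?_
      rw [Submodule.mem_orthogonal_singleton_iff_inner_right]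
      exact hperp
    have h1 : ∀ g, inner ℝ T (ρ g) = inner ℝ T g := fun g => by
      conv_lhs => rw [← hT']
      exact ρ.inner_map_map T g
    have h2 : ∀ g, inner ℝ w' (ρ g) = -inner ℝ w' g := fun g => by
      have := ρ.inner_map_map w' g
      rw [hw'', inner_neg_left] at this
      linarith
    have h3 : ∫ g, sgn (inner ℝ T g) * inner ℝ w' g ∂γ =
        ∫ g, sgn (inner ℝ T (ρ g)) * inner ℝ w' (ρ g) ∂γ := by
      conv_lhs => rw [← hmap]
      rw [integral_map ρ.continuous.aemeasurable]
      exact ((measurable_sgn.comp (by fun_prop)).mul (by fun_prop)).aestronglyMeasurable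
    simp_rw [h1, h2, mul_neg, integral_neg] at h3
    linarith
  -- Only the component of `w` along `T` contributes, through the absolute first moment of a
  -- Gaussian.
  have hsplit : ∀ g, sgn (inner ℝ T g) * inner ℝ w g =
      sgn (inner ℝ T g) * inner ℝ w' g + a * |inner ℝ T g| := by
    intro g
    rw [← sgn_mul_self, hw', inner_sub_left, real_inner_smul_left]
    ring
  simp_rw [hsplit]
  rw [integral_add (integrable_sgn_mul_inner T w')
    ((integrable_inner_stdGaussian T).abs.const_mul a), hzero, zero_add, integral_const_mul,
    integral_abs_inner_stdGaussian, ha]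
  field_simp

/-- The expected value of the randomized sign. -/
theorem integral_randomizedSign {ε : ℝ} (h0 : 0 < ε) (h1 : ε ≤ 3 / 2) (S : ℝ) :
    ∫ u : unitInterval, randomizedSign ε S u = ε / 4 * sgn S := by
  have hp := bitProb_mem h0 S
  have hm : MeasurableSet {u : unitInterval | (u : ℝ) ≤ bitProb ε S} :=
    measurableSet_le measurable_subtype_coe measurable_const
  have hfun : ∀ u : unitInterval, randomizedSign ε S u =
      2 * ({u : unitInterval | (u : ℝ) ≤ bitProb ε S}.indicator (fun _ => (1 : ℝ)) u) - 1 := by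
    intro u
    unfold randomizedSign
    by_cases h : (u : ℝ) ≤ bitProb ε S
    · rw [if_pos h, Set.indicator_of_mem (by exact h)]; norm_num
    · rw [if_neg h, Set.indicator_of_notMem (by exact h)]; norm_num
  simp_rw [hfun]
  rw [integral_sub ((integrable_indicator_iff hm).2 (integrable_const _).integrableOn |>.const_mul 2)
    (integrable_const _), integral_const_mul, integral_indicator_const _ hm, Measure.real,
    volume_le_bitProb h0 h1, ENNReal.toReal_ofReal (by linarith [hp.1])]
  simp only [smul_eq_mul, mul_one, integral_const, Measure.real, measure_univ, ENNReal.toReal_one]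
  unfold bitProb sgn
  split_ifs <;> ring

theorem abs_randomizedSign (ε S u : ℝ) : |randomizedSign ε S u| = 1 := by
  unfold randomizedSign; split_ifs <;> simp

/-- The contribution of one party to the estimate of the component along `w`. -/
def response (ε : ℝ) (T w : EuclideanSpace ℝ (Fin d))
    (p : EuclideanSpace ℝ (Fin d) × unitInterval) : ℝ :=
  randomizedSign ε (inner ℝ T p.1) p.2 * inner ℝ w p.1

@[fun_prop]
theorem measurable_response (ε : ℝ) (T w : EuclideanSpace ℝ (Fin d)) :
    Measurable (response ε T w) :=
  ((measurable_randomizedSign ε).comp ((by fun_prop : Measurable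
    fun p : EuclideanSpace ℝ (Fin d) × unitInterval => inner ℝ T p.1).prodMk
      measurable_snd)).mul (by fun_prop)

/-- The law of the coins used for one response. -/
abbrev responseLaw (d : ℕ) : Measure (EuclideanSpace ℝ (Fin d) × unitInterval) :=
  (stdGaussian (EuclideanSpace ℝ (Fin d))).prod volume

theorem abs_response (ε : ℝ) (T w : EuclideanSpace ℝ (Fin d))
    (p : EuclideanSpace ℝ (Fin d) × unitInterval) : |response ε T w p| = |inner ℝ w p.1| := by
  rw [response, abs_mul, abs_randomizedSign, one_mul]

theorem integrable_response (ε : ℝ) (T w : EuclideanSpace ℝ (Fin d)) :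
    Integrable (response ε T w) (responseLaw d) := by
  have h : Integrable (fun p : EuclideanSpace ℝ (Fin d) × unitInterval => inner ℝ w p.1)
      (responseLaw d) := (integrable_inner_stdGaussian w).comp_fst volume
  refine h.mono (by fun_prop) (ae_of_all _ fun p => ?_)
  rw [Real.norm_eq_abs, Real.norm_eq_abs, abs_response]

/-- The factor depends on `T` only through its norm. Giving all parties vectors of the same public
norm therefore lets the server invert it exactly. -/
theorem integral_response {ε : ℝ} (h0 : 0 < ε) (h1 : ε ≤ 3 / 2)
    (T w : EuclideanSpace ℝ (Fin d)) (hT : T ≠ 0) :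
    ∫ p, response ε T w p ∂(responseLaw d) =
      ε / 4 * √(2 / Real.pi) * (inner ℝ w T / ‖T‖) := by
  rw [integral_prod _ (integrable_response ε T w)]
  simp only [response, integral_mul_const, integral_randomizedSign h0 h1, mul_assoc]
  rw [integral_const_mul, integral_sgn_mul_inner T w hT]

theorem exp_mul_le_cosh (x y : ℝ) (h : |x| = |y|) :
    Real.exp x ≤ Real.exp y + Real.exp (-y) := by
  rcases abs_eq_abs.1 h with rfl | rfl
  · linarith [Real.exp_pos (-x)]
  · linarith [Real.exp_pos y]

theorem integrable_exp_response (ε : ℝ) (T w : EuclideanSpace ℝ (Fin d)) (t : ℝ) :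
    Integrable (fun p => Real.exp (t * response ε T w p)) (responseLaw d) := by
  have h : ∀ t : ℝ, Integrable (fun p : EuclideanSpace ℝ (Fin d) × unitInterval =>
      Real.exp (t * inner ℝ w p.1)) (responseLaw d) := fun t =>
    (integral_exp_inner_stdGaussian w t).1.comp_fst volume
  refine ((h t).add (h (-t))).mono (by fun_prop) (ae_of_all _ fun p => ?_)
  rw [Real.norm_of_nonneg (Real.exp_pos _).le]
  refine (exp_mul_le_cosh _ (t * inner ℝ w p.1) ?_).trans ?_
  · rw [abs_mul, abs_mul, abs_response]
  · rw [← neg_mul]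
    exact le_abs_self _

/-- The hyperbolic cosine is even and a response differs from `inner ℝ w g` only by a sign. So the
sum of the two factors is that of the plain Gaussian, and the product is at most the square of half
the sum. -/
theorem integral_exp_response_mul_le (ε : ℝ) (T w : EuclideanSpace ℝ (Fin d)) (t : ℝ) :
    (∫ p, Real.exp (t * response ε T w p) ∂(responseLaw d)) *
      (∫ p, Real.exp (-t * response ε T w p) ∂(responseLaw d)) ≤
      Real.exp (t ^ 2 * ‖w‖ ^ 2) := by
  set A := ∫ p, Real.exp (t * response ε T w p) ∂(responseLaw d) with hA
  set B := ∫ p, Real.exp (-t * response ε T w p) ∂(responseLaw d) with hB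
  have hi : ∀ t : ℝ, Integrable (fun p : EuclideanSpace ℝ (Fin d) × unitInterval =>
      Real.exp (t * inner ℝ w p.1)) (responseLaw d) := fun t =>
    (integral_exp_inner_stdGaussian w t).1.comp_fst volume
  have hint : ∀ t : ℝ, ∫ p : EuclideanSpace ℝ (Fin d) × unitInterval,
      Real.exp (t * inner ℝ w p.1) ∂(responseLaw d) = Real.exp (t ^ 2 * ‖w‖ ^ 2 / 2) := fun t => by
    rw [integral_prod _ (hi t)]
    simp only [integral_const, smul_eq_mul, Measure.real, measure_univ, ENNReal.toReal_one, one_mul]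
    exact (integral_exp_inner_stdGaussian w t).2
  have hsum : A + B = 2 * Real.exp (t ^ 2 * ‖w‖ ^ 2 / 2) := by
    rw [hA, hB, ← integral_add (integrable_exp_response ε T w t)
      (integrable_exp_response ε T w (-t))]
    have : ∀ p : EuclideanSpace ℝ (Fin d) × unitInterval,
        Real.exp (t * response ε T w p) + Real.exp (-t * response ε T w p) =
        Real.exp (t * inner ℝ w p.1) + Real.exp (-t * inner ℝ w p.1) := by
      intro p
      rcases abs_eq_abs.1 (abs_response ε T w p) with h | h
      · rw [h]
      · rw [h, mul_neg, mul_neg, neg_mul, neg_neg, add_comm]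
    simp_rw [this]
    rw [integral_add (hi t) (hi (-t)), hint, hint, neg_sq]
    ring
  have hexp : Real.exp (t ^ 2 * ‖w‖ ^ 2) = Real.exp (t ^ 2 * ‖w‖ ^ 2 / 2) ^ 2 := by
    rw [← Real.exp_nat_mul]
    congr 1
    push_cast
    ring
  rw [hexp]
  have h4 : Real.exp (t ^ 2 * ‖w‖ ^ 2 / 2) = (A + B) / 2 := by rw [hsum]; ring
  rw [h4]
  nlinarith [sq_nonneg (A - B)]

/-- The centered responses are sub-Gaussian. -/
theorem integral_exp_response_sub_le (ε : ℝ) (T w : EuclideanSpace ℝ (Fin d)) (t : ℝ) :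
    ∫ p, Real.exp (t * (response ε T w p - ∫ q, response ε T w q ∂(responseLaw d)))
      ∂(responseLaw d) ≤ Real.exp (t ^ 2 * ‖w‖ ^ 2) := by
  set τ := ∫ q, response ε T w q ∂(responseLaw d) with hτ
  -- By Jensen's inequality exp(-tτ) is at most the mean of exp(-t · response). Thus the centered
  -- exponential moment is at most the product of the moments at `t` and `-t`. Jensen's inequality
  -- is proved below from the tangent line of exp at -tτ.
  refine le_trans ?_ (integral_exp_response_mul_le ε T w t)
  have h1 : ∀ p, Real.exp (t * (response ε T w p - τ)) =
      Real.exp (-t * τ) * Real.exp (t * response ε T w p) := by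
    intro p
    rw [← Real.exp_add]
    congr 1
    ring
  simp_rw [h1]
  rw [integral_const_mul, mul_comm]
  refine mul_le_mul_of_nonneg_left ?_ (integral_nonneg fun _ => (Real.exp_pos _).le)
  have h2 : ∀ p, Real.exp (-t * τ) * (1 + (-t * response ε T w p - -t * τ)) ≤
      Real.exp (-t * response ε T w p) := by
    intro p
    have h := Real.add_one_le_exp (-t * response ε T w p - -t * τ)
    calc Real.exp (-t * τ) * (1 + (-t * response ε T w p - -t * τ))
        ≤ Real.exp (-t * τ) * Real.exp (-t * response ε T w p - -t * τ) :=
          mul_le_mul_of_nonneg_left (by linarith) (Real.exp_pos _).le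
      _ = _ := by rw [← Real.exp_add]; congr 1; ring
  have hi := integrable_response ε T w
  have h3 : ∫ p, Real.exp (-t * τ) * (1 + (-t * response ε T w p - -t * τ)) ∂(responseLaw d) =
      Real.exp (-t * τ) := by
    have h4 : ∫ p, (-t * response ε T w p - -t * τ) ∂(responseLaw d) = 0 := by
      rw [integral_sub (hi.const_mul _) (integrable_const _), integral_const_mul, ← hτ]
      simp
    have h5 := integral_add (integrable_const (μ := responseLaw d) (1 : ℝ))
      ((hi.const_mul (-t)).sub (integrable_const (-t * τ)))
    simp only [Pi.sub_apply] at h5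
    rw [integral_const_mul, h5, h4]
    simp
  rw [← h3]
  exact integral_mono (((integrable_const _).add ((hi.const_mul _).sub
    (integrable_const _))).const_mul _) (integrable_exp_response ε T w (-t)) h2

end Gaussian

/-! ## Geometry of the chain of nets -/

/-- Used with `x = α / 2`: at every active level the half scale exceeds `α / 4`, so it lies in the
range of the supremum. -/
theorem lt_of_lt_numHalvings {x : ℝ} {k v : ℕ} (h : v < numHalvings x k) : x < (1 / 2) ^ v := by
  induction k with
  | zero => exact absurd h (Nat.not_lt_zero v)
  | succ k ih =>
    unfold numHalvings at h
    split_ifs at h with hx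
    · rcases Nat.lt_succ_iff_lt_or_eq.1 h with h | rfl
      · exact ih h
      · exact hx
    · exact ih h

/-- Either the cap on the number of rounds is what stopped the halving, or the scale has become
small enough. -/
theorem numHalvings_eq_or_le (x : ℝ) (k : ℕ) :
    numHalvings x k = k ∨ (1 / 2 : ℝ) ^ numHalvings x k ≤ x := by
  induction k with
  | zero => exact Or.inl rfl
  | succ k ih =>
    unfold numHalvings
    split_ifs with hx
    · exact ih.imp (congrArg (· + 1)) fun h => absurd hx (not_lt.2 h)
    · exact Or.inr (not_lt.1 hx)

/-- The vector with the given coordinates. -/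
def vec (m : ℕ) (c : ℕ → ℝ) : EuclideanSpace ℝ (Fin m) := WithLp.toLp 2 fun j => c j

@[simp] theorem vec_apply (m : ℕ) (c : ℕ → ℝ) (j : Fin m) : vec m c j = c j := rfl

theorem inner_vec (m : ℕ) (c c' : ℕ → ℝ) :
    inner ℝ (vec m c) (vec m c') = ∑ j ∈ Finset.range m, c j * c' j := by
  rw [PiLp.inner_apply, Finset.sum_range]
  simp [mul_comm]

theorem norm_vec_sq (m : ℕ) (c : ℕ → ℝ) : ‖vec m c‖ ^ 2 = ∑ j ∈ Finset.range m, c j ^ 2 := by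
  rw [← real_inner_self_eq_norm_sq, inner_vec]
  exact Finset.sum_congr rfl fun j _ => (sq _).symm

theorem vec_sub (m : ℕ) (c c' : ℕ → ℝ) : vec m (fun j => c j - c' j) = vec m c - vec m c' := rfl

theorem sqDist_eq (m : ℕ) (U : ℕ → ℕ → ℝ) (i j : ℕ) :
    sqDist m U i j = ‖vec m (U i) - vec m (U j)‖ ^ 2 := by
  rw [← vec_sub, norm_vec_sq, sqDist]

/-! ### Covering and separation by greedy nets. -/

section Net

variable {m N : ℕ} {U : ℕ → ℕ → ℝ} {r : ℝ} {i j : ℕ}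

theorem netMap_le (hi : i < N) : netMap m N U r i ≤ i := by
  rcases isNet_netMap m N U r i hi with h | h
  · exact h.1.le
  · exact h.1.le

theorem netMap_netMap (hi : i < N) :
    netMap m N U r (netMap m N U r i) = netMap m N U r i := by
  refine le_antisymm (netMap_le ((netMap_le hi).trans_lt hi)) ?_
  rcases isNet_netMap m N U r i hi with h | h
  · rw [h.1, h.1]
  · exact h.2.1

theorem dist_netMap_le (hr : 0 ≤ r) (hi : i < N) :
    ‖vec m (U i) - vec m (U (netMap m N U r i))‖ ≤ r * √m := by
  rcases isNet_netMap m N U r i hi with h | h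
  · rw [h.1, sub_self, norm_zero]
    positivity
  · have h3 : sqDist m U i (netMap m N U r i) ≤ r ^ 2 * m := h.2.2.1
    rw [sqDist_eq] at h3
    refine abs_le_of_sq_le_sq' (by rwa [mul_pow, Real.sq_sqrt (Nat.cast_nonneg m)])
      (by positivity) |>.2

/-- Of two net points, the one listed later was kept because no earlier net point was close to it.
-/
theorem lt_dist_of_netMap_eq (hi : i < N) (hj : j < N) (hi' : netMap m N U r i = i)
    (hj' : netMap m N U r j = j) (hij : i ≠ j) : r * √m < ‖vec m (U i) - vec m (U j)‖ := by
  wlog h : j < i generalizing i j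
  · rw [norm_sub_rev]
    exact this hj hi hj' hi' hij.symm (by omega)
  rcases isNet_netMap m N U r i hi with k | k
  · have this : ¬ sqDist m U i j ≤ r ^ 2 * m := k.2 j h hj'.ge
    rw [sqDist_eq, not_le, ← Real.sq_sqrt (Nat.cast_nonneg m), ← mul_pow] at this
    exact lt_of_pow_lt_pow_left₀ 2 (norm_nonneg _) this
  · exact absurd hi' k.1.ne

end Net

/-! ### Comparison of the nets with packing numbers, and the chain of increments. -/

section Packing

variable {m N : ℕ} (u : Fin N → EuclideanSpace ℝ (Fin m))

theorem vec_coords (i : Fin N) : vec m (coords u i) = u i :=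
  PiLp.ext fun j => coords_fin u i j

theorem sepNumber_ne_top (t : ℝ) : sepNumber (Set.range u) t ≠ ⊤ :=
  ne_top_of_le_ne_top (Set.finite_range u).encard_lt_top.ne
    (Metric.packingNumber_le_encard_self _)

theorem sepNumber_le (t : ℝ) : (sepNumber (Set.range u) t).toNat ≤ N := by
  have h := ENat.toNat_le_toNat (Metric.packingNumber_le_encard_self
    (ε := Real.toNNReal (t * √(m : ℝ))) (Set.range u)) (Set.finite_range u).encard_lt_top.ne
  refine h.trans ?_
  rw [← Set.ncard_def, ← Set.image_univ]
  refine (Set.ncard_image_le Set.finite_univ).trans ?_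
  simp

theorem card_le_sepNumber {t : ℝ} (ht : 0 ≤ t) (A : Finset ℕ) (hA : ∀ i ∈ A, i < N)
    (hsep : ∀ i ∈ A, ∀ j ∈ A, i ≠ j → t * √m < ‖vec m (coords u i) - vec m (coords u j)‖) :
    A.card ≤ (sepNumber (Set.range u) t).toNat := by
  have hinj : Set.InjOn (fun i => vec m (coords u i)) (A : Set ℕ) := by
    intro i hi j hj hij
    by_contra hne
    have := hsep i hi j hj hne
    simp only at hij
    rw [hij, sub_self, norm_zero] at this
    exact absurd this (not_lt.2 (by positivity))
  have hs : Metric.IsSeparated ((Real.toNNReal (t * √(m : ℝ)) : NNReal) : ENNReal)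
      ((fun i => vec m (coords u i)) '' (A : Set ℕ)) := by
    rintro _ ⟨i, hi, rfl⟩ _ ⟨j, hj, rfl⟩ hne
    have hij : i ≠ j := fun h => hne (by rw [h])
    change ENNReal.ofReal (t * √m) < _
    rw [edist_dist, dist_eq_norm]
    exact (ENNReal.ofReal_lt_ofReal_iff_of_nonneg (by positivity)).2 (hsep i hi j hj hij)
  have hsub : (fun i => vec m (coords u i)) '' (A : Set ℕ) ⊆ Set.range u := by
    rintro _ ⟨i, hi, rfl⟩
    exact ⟨⟨i, hA i hi⟩, (vec_coords u ⟨i, hA i hi⟩).symm⟩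
  have h := ENat.toNat_le_toNat (hs.encard_le_packingNumber hsub) (sepNumber_ne_top u t)
  rwa [hinj.encard_image, Set.encard_coe_eq_coe_finsetCard, ENat.toNat_natCast] at h

/-- The values of `netMap` are its fixed points, which are separated and hence form a packing. -/
theorem card_netMap_le {r : ℝ} (hr : 0 ≤ r) :
    ((Finset.range N).image (netMap m N (coords u) r)).card ≤
      (sepNumber (Set.range u) r).toNat := by
  have key : ∀ i ∈ (Finset.range N).image (netMap m N (coords u) r), i < N ∧
      netMap m N (coords u) r i = i := by
    intro i hi
    obtain ⟨k, hk, rfl⟩ := Finset.mem_image.1 hi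
    have hk' := Finset.mem_range.1 hk
    exact ⟨(netMap_le hk').trans_lt hk', netMap_netMap hk'⟩
  exact card_le_sepNumber u hr _ (fun i hi => (key i hi).1) fun i hi j hj hij =>
    lt_dist_of_netMap_eq (key i hi).1 (key j hj).1 (key i hi).2 (key j hj).2 hij

theorem sepNumber_anti {s t : ℝ} (h : s ≤ t) :
    (sepNumber (Set.range u) t).toNat ≤ (sepNumber (Set.range u) s).toNat := by
  refine ENat.toNat_le_toNat ?_ (sepNumber_ne_top u s)
  refine iSup₂_mono fun C _ => iSup_le fun hC => le_iSup_of_le (fun x hx y hy hxy => ?_) le_rfl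
  refine lt_of_le_of_lt ?_ (hC hx hy hxy)
  exact_mod_cast Real.toNNReal_le_toNNReal (mul_le_mul_of_nonneg_right h (Real.sqrt_nonneg _))

theorem dist_le_of_sepNumber_le_one {t : ℝ} (ht : 0 ≤ t)
    (h : (sepNumber (Set.range u) t).toNat ≤ 1) {i j : ℕ} (hi : i < N) (hj : j < N) :
    ‖vec m (coords u i) - vec m (coords u j)‖ ≤ t * √m := by
  by_contra hlt
  rw [not_le] at hlt
  have hij : i ≠ j := by
    rintro rfl
    rw [sub_self, norm_zero] at hlt
    exact absurd hlt (not_lt.2 (by positivity))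
  have := card_le_sepNumber u ht {i, j} (by simp [hi, hj]) (by
    intro a ha b hb hab
    simp only [Finset.mem_insert, Finset.mem_singleton] at ha hb
    rcases ha with rfl | rfl <;> rcases hb with rfl | rfl
    · exact absurd rfl hab
    · exact hlt
    · rw [norm_sub_rev]; exact hlt
    · exact absurd rfl hab)
  rw [Finset.card_pair hij] at this
  omega

theorem dist_le_sqrt {u : Fin N → EuclideanSpace ℝ (Fin m)}
    (hu : ∀ k j, u k j ∈ Set.Icc (0 : ℝ) 1) (i j : Fin N) : ‖u i - u j‖ ≤ √m := by
  rw [EuclideanSpace.norm_eq]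
  refine Real.sqrt_le_sqrt ?_
  calc ∑ l, ‖(u i - u j) l‖ ^ 2 ≤ ∑ _l : Fin m, (1 : ℝ) := by
        refine Finset.sum_le_sum fun l _ => ?_
        rw [PiLp.sub_apply, Real.norm_eq_abs, sq_abs]
        have h1 := hu i l
        have h2 := hu j l
        rw [sq_le_one_iff_abs_le_one, abs_le]
        constructor <;> linarith [h1.1, h1.2, h2.1, h2.2]
    _ = m := by simp

variable {u}

theorem sepNumber_le_one (hu : ∀ k j, u k j ∈ Set.Icc (0 : ℝ) 1) {t : ℝ} (ht : 1 ≤ t) :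
    (sepNumber (Set.range u) t).toNat ≤ 1 := by
  have h : sepNumber (Set.range u) t ≤ 1 := by
    refine iSup₂_le fun C hC => iSup_le fun hs => ?_
    rw [Set.encard_le_one_iff]
    intro a b ha hb
    by_contra hne
    have h1 := hs ha hb hne
    obtain ⟨i, rfl⟩ := hC ha
    obtain ⟨j, rfl⟩ := hC hb
    change ENNReal.ofReal (t * √m) < _ at h1
    rw [edist_dist, dist_eq_norm] at h1
    refine absurd h1 (not_lt.2 (ENNReal.ofReal_le_ofReal ?_))
    exact (dist_le_sqrt hu i j).trans (le_mul_of_one_le_left (Real.sqrt_nonneg _) ht)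
  exact ENat.toNat_le_of_le_natCast h

/-- A real `sSup` is an upper bound only for sets that are bounded above. Here log N is a bound: for
t ≥ 1 the logarithm vanishes, as the cube has diameter √m, and for t ≤ 1 the power is at most 1. -/
theorem mul_log_le_packingSup (hu : ∀ k j, u k j ∈ Set.Icc (0 : ℝ) 1) (p : ℕ) {s t : ℝ}
    (hs : 0 < s) (ht : s ≤ t) :
    t ^ p * Real.log ((sepNumber (Set.range u) t).toNat : ℝ) ≤
      packingSup (Set.range u) p s := by
  refine le_csSup ⟨Real.log (N : ℝ), ?_⟩ ⟨t, ht, rfl⟩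
  rintro _ ⟨t, ht, rfl⟩
  have ht0 : 0 < t := hs.trans_le ht
  have hN : (0 : ℝ) ≤ Real.log (N : ℝ) := Real.log_natCast_nonneg N
  simp only
  rcases Nat.eq_zero_or_pos (sepNumber (Set.range u) t).toNat with h0 | h0
  · rw [h0]
    simpa using hN
  rcases le_total 1 t with h1 | h1
  · rw [le_antisymm (sepNumber_le_one hu h1) h0]
    simpa using hN
  · calc t ^ p * Real.log ((sepNumber (Set.range u) t).toNat : ℝ)
        ≤ 1 * Real.log ((sepNumber (Set.range u) t).toNat : ℝ) :=
          mul_le_mul_of_nonneg_right (pow_le_one₀ ht0.le h1) (Real.log_natCast_nonneg _)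
      _ ≤ Real.log (N : ℝ) := by
          rw [one_mul]
          exact Real.log_le_log (by exact_mod_cast h0) (by exact_mod_cast sepNumber_le u t)

/-- The diameter of the cube is √m, so index `0` is the only net point at scale 1. The start of the
chain is thus public and needs no estimate. -/
theorem netMap_one (hu : ∀ k j, u k j ∈ Set.Icc (0 : ℝ) 1) {i : ℕ} (hi : i < N) :
    netMap m N (coords u) 1 i = 0 := by
  by_contra hne
  have h0 : 0 < N := by omega
  have hk : netMap m N (coords u) 1 i < N := (netMap_le hi).trans_lt hi
  have h := lt_dist_of_netMap_eq hk h0 (netMap_netMap hi)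
    (Nat.le_zero.1 (netMap_le h0)) hne
  rw [one_mul] at h
  refine absurd h (not_lt.2 ?_)
  have := dist_le_sqrt hu ⟨_, hk⟩ ⟨0, h0⟩
  rwa [← vec_coords u, ← vec_coords u] at this

theorem netMap_eq_zero {r : ℝ} (hr : 0 ≤ r) (h : (sepNumber (Set.range u) r).toNat ≤ 1) {i : ℕ}
    (hi : i < N) : netMap m N (coords u) r i = 0 := by
  have h0 : 0 < N := by omega
  have hc := Finset.card_le_one.1 ((card_netMap_le u hr).trans h)
  rw [hc _ (Finset.mem_image_of_mem _ (Finset.mem_range.2 hi)) _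
    (Finset.mem_image_of_mem _ (Finset.mem_range.2 h0))]
  exact Nat.le_zero.1 (netMap_le h0)

/-- The increment at scale `r` as a vector. -/
def incVec (u : Fin N → EuclideanSpace ℝ (Fin m)) (r : ℝ) (i : ℕ) : EuclideanSpace ℝ (Fin m) :=
  vec m (increment m N (coords u) r i)

theorem incVec_eq (u : Fin N → EuclideanSpace ℝ (Fin m)) (r : ℝ) (i : ℕ) : incVec u r i =
    vec m (coords u (netMap m N (coords u) (r / 2) i)) -
      vec m (coords u (netMap m N (coords u) r i)) := rfl

theorem norm_incVec_le {r : ℝ} (hr : 0 ≤ r) {i : ℕ} (hi : i < N) :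
    ‖incVec u r i‖ ≤ 3 / 2 * r * √m := by
  rw [incVec_eq]
  have h1 := dist_netMap_le (m := m) (U := coords u) hr hi
  have h2 := dist_netMap_le (m := m) (U := coords u) (div_nonneg hr zero_le_two) hi
  rw [norm_sub_rev] at h2
  refine (norm_sub_le_norm_sub_add_norm_sub _ (vec m (coords u i)) _).trans ?_
  linarith

/-- Covers the levels where log P vanishes and the error bound therefore leaves no room. -/
theorem incVec_eq_zero {r : ℝ} (hr : 0 ≤ r) (h : (sepNumber (Set.range u) (r / 2)).toNat ≤ 1)
    {i : ℕ} (hi : i < N) : incVec u r i = 0 := by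
  rw [incVec_eq, netMap_eq_zero (by linarith) h hi,
    netMap_eq_zero hr ((sepNumber_anti u (by linarith)).trans h) hi, sub_self]

/-- An increment is determined by a pair of net points, one from each of the two scales. The finer
scale bounds the sizes of both nets. -/
theorem card_incVec_le {r : ℝ} (hr : 0 ≤ r) :
    ((Finset.range N).image (incVec u r)).card ≤
      (sepNumber (Set.range u) (r / 2)).toNat ^ 2 := by
  classical
  have hsub : (Finset.range N).image (incVec u r) ⊆
      (((Finset.range N).image (netMap m N (coords u) (r / 2))) ×ˢ
        ((Finset.range N).image (netMap m N (coords u) r))).image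
        (fun p => vec m (coords u p.1) - vec m (coords u p.2)) := by
    intro x hx
    obtain ⟨i, hi, rfl⟩ := Finset.mem_image.1 hx
    exact Finset.mem_image.2 ⟨(_, _), Finset.mem_product.2
      ⟨Finset.mem_image_of_mem _ hi, Finset.mem_image_of_mem _ hi⟩, rfl⟩
  refine (Finset.card_le_card hsub).trans (Finset.card_image_le.trans ?_)
  rw [Finset.card_product, sq]
  exact Nat.mul_le_mul (card_netMap_le u (by linarith))
    ((card_netMap_le u hr).trans (sepNumber_anti u (by linarith)))

/-- The increments telescope, and the coarsest approximation is the first point of the list. -/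
theorem add_sum_incVec (hu : ∀ k j, u k j ∈ Set.Icc (0 : ℝ) 1) {i : ℕ} (hi : i < N) (L : ℕ) :
    vec m (coords u 0) + ∑ v ∈ Finset.range L, incVec u ((1 / 2) ^ v) i =
      vec m (coords u (netMap m N (coords u) ((1 / 2) ^ L) i)) := by
  have h := Finset.sum_range_sub
    (fun v => vec m (coords u (netMap m N (coords u) ((1 / 2) ^ v) i))) L
  simp only [pow_zero, netMap_one hu hi] at h
  have h2 : ∀ v : ℕ, incVec u ((1 / 2) ^ v) i =
      vec m (coords u (netMap m N (coords u) ((1 / 2) ^ (v + 1)) i)) -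
        vec m (coords u (netMap m N (coords u) ((1 / 2) ^ v) i)) := fun v => by
    rw [incVec_eq, pow_succ]
    congr 5
    ring
  simp only [h2, h]
  abel

/-- If the cap stopped the halving too early, the second alternative takes over: the whole universe
has diameter at most (x/2)√m, and any net point is a good approximation. -/
theorem norm_sub_netMap_le {x : ℝ} (hx : 0 ≤ x) {n : ℕ} {i : ℕ} (hi : i < N)
    (h : (1 / 2 : ℝ) ^ numHalvings x n ≤ x ∨ (sepNumber (Set.range u) (x / 2)).toNat ≤ 1) :
    ‖vec m (coords u i) - vec m (coords u (netMap m N (coords u) ((1 / 2) ^ numHalvings x n) i))‖ ≤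
      x * √m := by
  rcases h with h | h
  · exact (dist_netMap_le (by positivity) hi).trans
      (mul_le_mul_of_nonneg_right h (Real.sqrt_nonneg _))
  · refine (dist_le_of_sepNumber_le_one u (by linarith) h hi
      ((netMap_le hi).trans_lt hi)).trans ?_
    exact mul_le_mul_of_nonneg_right (by linarith) (Real.sqrt_nonneg _)

end Packing

/-! ## The Frank-Wolfe algorithm -/

theorem inner_le_of_mem_convexHull {E : Type*} [NormedAddCommGroup E] [InnerProductSpace ℝ E]
    {S : Set E} {a x : E} {b : ℝ} (hx : x ∈ convexHull ℝ S) (h : ∀ y ∈ S, inner ℝ a y ≤ b) :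
    inner ℝ a x ≤ b :=
  convexHull_min (t := {x | inner ℝ a x ≤ b}) h
    (convex_halfSpace_le (innerₛₗ ℝ a).isLinear b) hx

/-- One step contracts the gap in ‖· - y‖² by 1 - γ, up to a term of second order. Expand the
square, replace `z` by `μ` in the linear term, and use convexity in the form of the nonnegative term
γ‖μ - c‖². -/
theorem norm_add_smul_sub_sq_le {E : Type*} [NormedAddCommGroup E] [InnerProductSpace ℝ E]
    {c y z μ : E} {γ : ℝ} (hγ : 0 ≤ γ) (h : inner ℝ (c - y) z ≤ inner ℝ (c - y) μ) :
    ‖c + γ • (z - c) - y‖ ^ 2 - ‖μ - y‖ ^ 2 ≤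
      (1 - γ) * (‖c - y‖ ^ 2 - ‖μ - y‖ ^ 2) + γ ^ 2 * ‖z - c‖ ^ 2 := by
  have h1 : c + γ • (z - c) - y = (c - y) + γ • (z - c) := by abel
  have h2 : μ - y = (c - y) + (μ - c) := by abel
  have h3 : inner ℝ (c - y) (z - c) ≤ inner ℝ (c - y) (μ - c) := by
    rw [inner_sub_right, inner_sub_right]
    linarith
  rw [h1, h2, norm_add_sq_real, norm_add_sq_real, norm_smul, inner_smul_right,
    Real.norm_of_nonneg hγ]
  nlinarith [mul_le_mul_of_nonneg_left h3 hγ, mul_nonneg hγ (sq_nonneg ‖μ - c‖)]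

/-- Expanding ‖(c - μ) - (y - μ)‖² shows that a near-minimizer `c` is close to `μ` as soon as the
noise y - μ has small inner product with c - μ. The norm of the noise does not enter. -/
theorem norm_sub_sq_le_of_inner_le {E : Type*} [NormedAddCommGroup E] [InnerProductSpace ℝ E]
    {c y μ : E} {M δ : ℝ} (h1 : inner ℝ (y - μ) (c - μ) ≤ M)
    (h2 : ‖c - y‖ ^ 2 - ‖μ - y‖ ^ 2 ≤ δ) : ‖c - μ‖ ^ 2 ≤ 2 * M + δ := by
  have h3 : c - y = (c - μ) - (y - μ) := by abel
  rw [h3, norm_sub_sq_real, norm_sub_rev μ y, real_inner_comm] at h2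
  linarith

namespace FrankWolfe

variable {m N : ℕ} {d : ℕ → ℕ → ℝ} {y : ℕ → ℝ} {t : ℕ} {c : ℕ → ℝ}

theorem vec_eq_zero (h : FrankWolfe m N d y t c) (hd : ∀ i < N, vec m (d i) = 0) :
    vec m c = 0 := by
  induction h with
  | zero c hc => exact PiLp.ext fun j => hc j j.2
  | succ t i c c' _ hi _ hc' ih =>
    refine PiLp.ext fun j => ?_
    have h1 : c j = 0 := congrArg (fun x : EuclideanSpace ℝ (Fin m) => x j) ih
    have h2 : d i j = 0 := congrArg (fun x : EuclideanSpace ℝ (Fin m) => x j) (hd i hi)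
    rw [vec_apply, hc' j j.2, h1, h2]
    simp

/-- The usual O(1/t) rate with steps 2/(t+2). The bound does not involve the distance from `y` to
the hull, which noise can make large. -/
theorem spec (h : FrankWolfe m N d y t c) {Δ : ℝ} (hd : ∀ i < N, ‖vec m (d i)‖ ≤ Δ)
    (hΔ : 0 ≤ Δ) : ‖vec m c‖ ≤ Δ ∧ (0 < t →
      vec m c ∈ convexHull ℝ {x | ∃ i < N, x = vec m (d i)} ∧
      ∀ μ ∈ convexHull ℝ {x | ∃ i < N, x = vec m (d i)},
        ‖vec m c - vec m y‖ ^ 2 - ‖μ - vec m y‖ ^ 2 ≤ 16 * Δ ^ 2 / ((t : ℝ) + 2)) := by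
  set S := convexHull ℝ {x | ∃ i < N, x = vec m (d i)} with hS
  have hball : ∀ x ∈ S, ‖x‖ ≤ Δ := fun x hx => by
    have := convexHull_min (t := Metric.closedBall (0 : EuclideanSpace ℝ (Fin m)) Δ)
      (by rintro _ ⟨i, hi, rfl⟩; simpa using hd i hi) (convex_closedBall _ _) hx
    simpa using this
  induction h with
  | zero c hc =>
    have : vec m c = 0 := PiLp.ext fun j => hc j j.2
    exact ⟨by rwa [this, norm_zero], fun h => absurd h (lt_irrefl 0)⟩
  | succ t i c c' _ hi hmin hc' ih =>
    obtain ⟨ih1, ih2⟩ := ih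
    set γ : ℝ := 2 / ((t : ℝ) + 2) with hγ
    have hγ0 : 0 ≤ γ := by positivity
    have ht : (0 : ℝ) < (t : ℝ) + 2 := by positivity
    have hγ1 : γ ≤ 1 := by
      rw [hγ, div_le_one ht]
      linarith [Nat.cast_nonneg (α := ℝ) t]
    have hvec : vec m c' = vec m c + γ • (vec m (d i) - vec m c) :=
      PiLp.ext fun j => by
        simp only [vec_apply, PiLp.add_apply, PiLp.smul_apply, PiLp.sub_apply, smul_eq_mul]
        exact hc' j j.2
    have hDmem : vec m (d i) ∈ S := subset_convexHull ℝ _ ⟨i, hi, rfl⟩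
    have hmem : vec m c' ∈ S := by
      -- The first step has length 1 and jumps to a vertex. So the start at `0`, which need not
      -- belong to the hull, is harmless.
      rcases Nat.eq_zero_or_pos t with rfl | h0
      · have : γ = 1 := by rw [hγ]; norm_num
        rw [hvec, this, one_smul, add_sub_cancel]
        exact hDmem
      · have h := (convex_convexHull ℝ _) (ih2 h0).1 hDmem (sub_nonneg.2 hγ1) hγ0 (by ring)
        rw [hvec]
        convert h using 1
        module
    refine ⟨hball _ hmem, fun _ => ⟨hmem, fun μ hμ => ?_⟩⟩
    have hinner : ∀ i' < N, inner ℝ (vec m c - vec m y) (vec m (d i)) ≤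
        inner ℝ (vec m c - vec m y) (vec m (d i')) := fun i' hi' => by
      rw [← vec_sub, inner_vec, inner_vec]
      exact hmin i' hi'
    have hle : inner ℝ (vec m c - vec m y) (vec m (d i)) ≤ inner ℝ (vec m c - vec m y) μ := by
      have := inner_le_of_mem_convexHull (a := -(vec m c - vec m y))
        (b := -inner ℝ (vec m c - vec m y) (vec m (d i))) hμ (by
          rintro _ ⟨i', hi', rfl⟩
          rw [inner_neg_left]
          exact neg_le_neg (hinner i' hi'))
      rw [inner_neg_left] at this
      linarith
    have hstep := norm_add_smul_sub_sq_le hγ0 hle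
    rw [← hvec] at hstep
    have hnorm : ‖vec m (d i) - vec m c‖ ^ 2 ≤ 4 * Δ ^ 2 := by
      have h1 := (norm_sub_le (vec m (d i)) (vec m c)).trans (add_le_add (hd i hi) ih1)
      calc ‖vec m (d i) - vec m c‖ ^ 2 ≤ (Δ + Δ) ^ 2 := pow_le_pow_left₀ (norm_nonneg _) h1 2
        _ = 4 * Δ ^ 2 := by ring
    have h2 : γ ^ 2 * ‖vec m (d i) - vec m c‖ ^ 2 ≤ 16 * Δ ^ 2 / ((t : ℝ) + 2) ^ 2 := by
      refine (mul_le_mul_of_nonneg_left hnorm (sq_nonneg γ)).trans (le_of_eq ?_)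
      rw [hγ]
      field_simp
      ring
    have h1 : (1 - γ) * (‖vec m c - vec m y‖ ^ 2 - ‖μ - vec m y‖ ^ 2) ≤
        t / ((t : ℝ) + 2) * (16 * Δ ^ 2 / ((t : ℝ) + 2)) := by
      have hγt : 1 - γ = t / ((t : ℝ) + 2) := by rw [hγ]; field_simp; ring
      rw [hγt]
      -- For `t = 0` the factor 1 - γ vanishes, so no bound on the initial gap is required.
      rcases Nat.eq_zero_or_pos t with rfl | h0
      · simp
      · exact mul_le_mul_of_nonneg_left ((ih2 h0).2 μ hμ) (by positivity)
    refine hstep.trans ((add_le_add h1 h2).trans ?_)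
    have h4 : t / ((t : ℝ) + 2) * (16 * Δ ^ 2 / ((t : ℝ) + 2)) + 16 * Δ ^ 2 / ((t : ℝ) + 2) ^ 2 =
        16 * Δ ^ 2 * (((t : ℝ) + 1) / ((t : ℝ) + 2) ^ 2) := by
      field_simp
    have h5 : ((t : ℝ) + 1) / ((t : ℝ) + 2) ^ 2 ≤ 1 / ((t : ℝ) + 1 + 2) := by
      rw [div_le_div_iff₀ (by positivity) (by positivity)]
      nlinarith
    rw [h4, Nat.cast_succ]
    calc 16 * Δ ^ 2 * (((t : ℝ) + 1) / ((t : ℝ) + 2) ^ 2)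
        ≤ 16 * Δ ^ 2 * (1 / ((t : ℝ) + 1 + 2)) := mul_le_mul_of_nonneg_left h5 (by positivity)
      _ = _ := by ring

/-- The output lies in the hull, so its inner product with the noise is controlled by that of the
vertices. The noise need only be bounded in finitely many directions. -/
theorem norm_sub_sq_le (h : FrankWolfe m N d y t c) (ht : 0 < t) {Δ : ℝ}
    (hd : ∀ i < N, ‖vec m (d i)‖ ≤ Δ) (hΔ : 0 ≤ Δ) {μ : EuclideanSpace ℝ (Fin m)}
    (hμ : μ ∈ convexHull ℝ {x | ∃ i < N, x = vec m (d i)}) {M : ℝ}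
    (hM : ∀ i < N, inner ℝ (vec m y - μ) (vec m (d i) - μ) ≤ M) :
    ‖vec m c - μ‖ ^ 2 ≤ 2 * M + 16 * Δ ^ 2 / t := by
  obtain ⟨h1, h2⟩ := (h.spec hd hΔ).2 ht
  refine norm_sub_sq_le_of_inner_le ?_ ((h2 μ hμ).trans ?_)
  · have := inner_le_of_mem_convexHull (a := vec m y - μ) (b := M + inner ℝ (vec m y - μ) μ) h1 (by
      rintro _ ⟨i, hi, rfl⟩
      have := hM i hi
      rw [inner_sub_right] at this
      linarith)
    rw [inner_sub_right]
    linarith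
  · have : (0 : ℝ) < t := by exact_mod_cast ht
    exact div_le_div_of_nonneg_left (by positivity) this (by linarith)

end FrankWolfe

/-! ## Blocks of the completed vector -/

section Blocks

variable {m N n L : ℕ}

/-- The cell that holds the coordinate `j` of the level `v`. -/
def slot (v : Fin n) (j : Fin m) : Fin (n * m + 1) :=
  ⟨v * m + j, by
    have h1 := j.2
    have h2 : ((v : ℕ) + 1) * m ≤ n * m := Nat.mul_le_mul_right m v.2
    rw [Nat.succ_mul] at h2
    omega⟩

theorem slot_lt (v : Fin n) (j : Fin m) : (slot v j : ℕ) < n * m := by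
  have h1 := j.2
  have h2 : ((v : ℕ) + 1) * m ≤ n * m := Nat.mul_le_mul_right m v.2
  rw [Nat.succ_mul] at h2
  change (v : ℕ) * m + j < n * m
  omega

theorem slot_injective (v : Fin n) : Function.Injective (slot v : Fin m → Fin (n * m + 1)) := by
  intro i j h
  have := congrArg Fin.val h
  simp only [slot] at this
  exact Fin.ext (by omega)

/-- The vector `x` placed in the block of the level `v`. -/
def embed (v : Fin n) (x : EuclideanSpace ℝ (Fin m)) : EuclideanSpace ℝ (Fin (n * m + 1)) :=
  ∑ j, EuclideanSpace.single (slot v j) (x j)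

theorem inner_embed (v : Fin n) (x : EuclideanSpace ℝ (Fin m))
    (y : EuclideanSpace ℝ (Fin (n * m + 1))) : inner ℝ (embed v x) y = ∑ j, x j * y (slot v j) := by
  rw [embed, sum_inner]
  refine Finset.sum_congr rfl fun j _ => ?_
  rw [EuclideanSpace.inner_single_left]
  simp

theorem norm_embed (v : Fin n) (x : EuclideanSpace ℝ (Fin m)) : ‖embed v x‖ = ‖x‖ := by
  have h : ∀ j, embed v x (slot v j) = x j := by
    intro j
    rw [embed, WithLp.ofLp_sum, Finset.sum_apply, Finset.sum_eq_single j]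
    · simp
    · intro i _ hij
      simp [(slot_injective v).ne hij.symm]
    · simp
  rw [← sq_eq_sq₀ (norm_nonneg _) (norm_nonneg _), ← real_inner_self_eq_norm_sq, inner_embed,
    ← real_inner_self_eq_norm_sq, PiLp.inner_apply]
  simp [h, sq]

/-- Testing against a vector supported in one block isolates one level. The division by the scale is
undone by the scale in `serverScale`. -/
theorem inner_embed_completed (u : Fin N → EuclideanSpace ℝ (Fin m)) (v : Fin n) (hv : (v : ℕ) < L)
    (x : EuclideanSpace ℝ (Fin m)) (own : ℕ) :
    inner ℝ (embed v x) (completed m N n L (coords u) own) =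
      inner ℝ x (incVec u ((1 / 2) ^ (v : ℕ)) own) / (1 / 2) ^ (v : ℕ) := by
  rw [inner_embed, PiLp.inner_apply, Finset.sum_div]
  refine Finset.sum_congr rfl fun j _ => ?_
  have hj := j.2
  have h1 : (slot v j : ℕ) < L * m := by
    have h2 : ((v : ℕ) + 1) * m ≤ L * m := Nat.mul_le_mul_right m hv
    rw [Nat.succ_mul] at h2
    change (v : ℕ) * m + j < L * m
    omega
  have h2 : (slot v j : ℕ) / m = v := by
    change ((v : ℕ) * m + j) / m = v
    rw [Nat.add_div_of_dvd_right (Dvd.intro_left _ rfl), Nat.mul_div_cancel _ (by omega),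
      Nat.div_eq_of_lt hj, add_zero]
  have h3 : (slot v j : ℕ) % m = j := by
    change ((v : ℕ) * m + j) % m = j
    rw [Nat.mul_add_mod_self_right, Nat.mod_eq_of_lt hj]
  simp only [completed, slot_lt, if_true, stacked, if_pos h1, h2, h3]
  simp only [incVec, vec_apply, RCLike.inner_apply, conj_trivial]
  ring

/-- After division by its scale every block has squared norm at most (9/4) m, whatever the level.
This makes the radicand of the completing coordinate nonnegative. -/
theorem sum_stacked_sq_le (u : Fin N → EuclideanSpace ℝ (Fin m)) (n L : ℕ) {own : ℕ}
    (ho : own < N) :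
    ∑ c ∈ Finset.range (n * m), stacked m N L (coords u) own c ^ 2 ≤ 9 / 4 * ((L : ℝ) * m) := by
  have h1 : ∑ c ∈ Finset.range (n * m), stacked m N L (coords u) own c ^ 2 ≤
      ∑ v ∈ Finset.range n, if v < L then 9 / 4 * (m : ℝ) else 0 := by
    induction n with
    | zero => simp
    | succ n ih =>
      rw [Nat.succ_mul, Finset.sum_range_add, Finset.sum_range_succ]
      refine add_le_add ih ?_
      split_ifs with h
      · have h2 : ∀ j ∈ Finset.range m, stacked m N L (coords u) own (n * m + j) ^ 2 =
            increment m N (coords u) ((1 / 2) ^ n) own j ^ 2 / ((1 / 2) ^ n) ^ 2 := by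
          intro j hj
          have hj := Finset.mem_range.1 hj
          have h3 : (n * m + j) / m = n := by
            rw [Nat.add_div_of_dvd_right (Dvd.intro_left _ rfl), Nat.mul_div_cancel _ (by omega),
              Nat.div_eq_of_lt hj, add_zero]
          have h4 : n * m + j < L * m := by
            have h2 : (n + 1) * m ≤ L * m := Nat.mul_le_mul_right m h
            rw [Nat.succ_mul] at h2
            omega
          rw [stacked, if_pos h4, h3, Nat.mul_add_mod_self_right, Nat.mod_eq_of_lt hj, div_pow]
        rw [Finset.sum_congr rfl h2, ← Finset.sum_div, ← norm_vec_sq,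
          div_le_iff₀ (by positivity)]
        have h5 := pow_le_pow_left₀ (norm_nonneg _)
          (norm_incVec_le (u := u) (r := (1 / 2) ^ n) (by positivity) ho) 2
        rw [mul_pow, Real.sq_sqrt (Nat.cast_nonneg m)] at h5
        refine h5.trans (le_of_eq ?_)
        ring
      · refine (Finset.sum_eq_zero fun j _ => ?_).le
        have h4 : ¬ n * m + j < L * m := by
          have h2 : L * m ≤ n * m := Nat.mul_le_mul_right m (not_lt.1 h)
          omega
        rw [stacked, if_neg h4]
        simp
  refine h1.trans ?_
  rw [← Finset.sum_filter, Finset.sum_const, nsmul_eq_mul]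
  have h2 : ((Finset.range n).filter (· < L)).card ≤ L := by
    refine (Finset.card_le_card (t := Finset.range L) fun v hv => ?_).trans
      (Finset.card_range L).le
    exact Finset.mem_range.2 (Finset.mem_filter.1 hv).2
  have h3 : (((Finset.range n).filter (· < L)).card : ℝ) ≤ L := by exact_mod_cast h2
  calc _ ≤ (L : ℝ) * (9 / 4 * (m : ℝ)) := mul_le_mul_of_nonneg_right h3 (by positivity)
    _ = _ := by ring

theorem norm_completed (u : Fin N → EuclideanSpace ℝ (Fin m)) (n L : ℕ) {own : ℕ}
    (ho : own < N) : ‖completed m N n L (coords u) own‖ = 3 / 2 * √((L : ℝ) * m) := by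
  have h := sum_stacked_sq_le u n L ho
  rw [← sq_eq_sq₀ (norm_nonneg _) (by positivity), EuclideanSpace.norm_sq_eq,
    Fin.sum_univ_castSucc, mul_pow, Real.sq_sqrt (by positivity)]
  simp only [completed, Fin.val_castSucc, Fin.is_lt, if_true, Fin.val_last, lt_irrefl, if_false,
    Real.norm_eq_abs, sq_abs]
  rw [Real.sq_sqrt (by linarith), Fin.sum_univ_eq_sum_range
    (fun c => stacked m N L (coords u) own c ^ 2)]
  ring

end Blocks

/-! ## The noise of one level -/

/-- The coins of a party that determine its response. -/
def responseCoins (d : ℕ) (ω : Tape) : EuclideanSpace ℝ (Fin d) × unitInterval :=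
  (gaussians d ω, (ω d).2)

@[fun_prop]
theorem measurable_responseCoins (d : ℕ) : Measurable (responseCoins d) :=
  (measurable_gaussians d).prodMk (measurable_snd.comp (measurable_pi_apply d))

/-- The sum of independent centered responses is sub-Gaussian. -/
theorem lintegral_exp_sum_response_le {n d : ℕ} (ε : ℝ) (T : Fin n → EuclideanSpace ℝ (Fin d))
    (w : EuclideanSpace ℝ (Fin d)) (t : ℝ) :
    ∫⁻ ω, ENNReal.ofReal (Real.exp (∑ i, t * (response ε (T i) w (responseCoins d (ω i)) -
      ∫ p, response ε (T i) w p ∂(responseLaw d)))) ∂(Measure.pi fun _ : Fin n => tapeLaw) ≤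
      ENNReal.ofReal (Real.exp (n * (t ^ 2 * ‖w‖ ^ 2))) := by
  set f : Fin n → EuclideanSpace ℝ (Fin d) × unitInterval → ℝ := fun i p =>
    Real.exp (t * (response ε (T i) w p - ∫ p, response ε (T i) w p ∂(responseLaw d))) with hf
  have hfi : ∀ i, Integrable (f i) (responseLaw d) := fun i => by
    have h : f i = fun p => Real.exp (t * response ε (T i) w p) *
        Real.exp (-(t * ∫ p, response ε (T i) w p ∂(responseLaw d))) := by
      funext p
      simp only [hf]
      rw [← Real.exp_add]
      congr 1
      ring
    rw [h]
    exact (integrable_exp_response ε (T i) w t).mul_const _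
  have hgi : ∀ i, Integrable (fun ω => f i (responseCoins d ω)) tapeLaw := fun i => by
    have h := hfi i
    rw [responseLaw, ← map_tapeLaw] at h
    exact h.comp_measurable (measurable_responseCoins d)
  have hint : ∀ i, ∫ ω, f i (responseCoins d ω) ∂tapeLaw ≤ Real.exp (t ^ 2 * ‖w‖ ^ 2) := fun i => by
    have h := integral_map (μ := tapeLaw) (measurable_responseCoins d).aemeasurable
      (f := f i) (by simp only [hf]; fun_prop)
    rw [show tapeLaw.map (responseCoins d) = responseLaw d from map_tapeLaw d] at h
    rw [← h]
    exact integral_exp_response_sub_le ε (T i) w t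
  simp only [Real.exp_sum]
  have hI : Integrable (fun ω : Fin n → Tape => ∏ i, f i (responseCoins d (ω i)))
      (Measure.pi fun _ : Fin n => tapeLaw) := Integrable.fintype_prod_dep hgi
  rw [← ofReal_integral_eq_lintegral_ofReal hI
    (ae_of_all _ fun ω => Finset.prod_nonneg fun i _ => (Real.exp_pos _).le)]
  refine ENNReal.ofReal_le_ofReal ?_
  rw [integral_fintype_prod_eq_prod (f := fun i ω => f i (responseCoins d ω)), Real.exp_nat_mul]
  refine (Finset.prod_le_prod (fun i _ => integral_nonneg fun ω => (Real.exp_pos _).le)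
    fun i _ => hint i).trans ?_
  simp

/-! ### Unbiasedness and sub-Gaussian noise of the estimate of one level. -/

section Level

variable {m N n : ℕ} (u : Fin N → EuclideanSpace ℝ (Fin m)) (L : ℕ) (ε : ℝ) (a : Fin n → Fin N)
  (v : Fin n)

/-- The estimate of the mean of the increments of a level, before the projection. -/
def levelEstimate (ω : Fin n → Tape) : EuclideanSpace ℝ (Fin m) :=
  vec m fun j => serverScale m n L ε ((1 / 2) ^ (v : ℕ)) * ∑ i : Fin n, if v * m + j < n * m then
    randomizedSign ε (projection m N n L (coords u) (a i) (ω i)) (ω i (n * m + 1)).2 *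
      (ω i (v * m + j)).1 else 0

/-- The mean of the increments of a level. -/
def levelMean : EuclideanSpace ℝ (Fin m) :=
  (n : ℝ)⁻¹ • ∑ i, incVec u ((1 / 2) ^ (v : ℕ)) (a i)

theorem inner_levelEstimate (ω : Fin n → Tape) (w : EuclideanSpace ℝ (Fin m)) :
    inner ℝ (levelEstimate u L ε a v ω) w = ∑ i, serverScale m n L ε ((1 / 2) ^ (v : ℕ)) *
      response ε (completed m N n L (coords u) (a i)) (embed v w)
        (responseCoins (n * m + 1) (ω i)) := by
  rw [PiLp.inner_apply, ← Finset.mul_sum]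
  simp only [response, responseCoins, inner_embed, levelEstimate, vec_apply,
    projection_eq_inner, RCLike.inner_apply, conj_trivial, Finset.mul_sum]
  rw [Finset.sum_comm]
  refine Finset.sum_congr rfl fun i _ => Finset.sum_congr rfl fun j _ => ?_
  rw [if_pos (show (v : ℕ) * m + j < n * m from slot_lt v j)]
  change _ = _ * (_ * (_ * (ω i (v * m + j)).1))
  ring

/-- Unbiasedness: each factor of `serverScale` cancels one of the randomized bit, of the Gaussian
mean absolute value, of the norm of the completed vector, of the scale and of the averaging. -/
theorem sum_integral_response (hn : 0 < n) (hm : 0 < m) (hv : (v : ℕ) < L) {ε : ℝ} (h0 : 0 < ε)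
    (h1 : ε ≤ 3 / 2) (w : EuclideanSpace ℝ (Fin m)) :
    ∑ i, serverScale m n L ε ((1 / 2) ^ (v : ℕ)) *
      ∫ p, response ε (completed m N n L (coords u) (a i)) (embed v w) p
        ∂(responseLaw (n * m + 1)) = inner ℝ (levelMean u a v) w := by
  have hL : 0 < L := by omega
  have hR : 0 < 3 / 2 * √((L : ℝ) * m) := by positivity
  have hn' : (n : ℝ) ≠ 0 := by positivity
  rw [levelMean, inner_smul_left, sum_inner, Finset.mul_sum]
  refine Finset.sum_congr rfl fun i _ => ?_
  have hT := norm_completed u n L (a i).2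
  rw [integral_response h0 h1 _ _ (norm_pos_iff.1 (by rw [hT]; exact hR)), hT,
    inner_embed_completed u v hv, serverScale, real_inner_comm]
  have hpi : √(Real.pi / 2) * √(2 / Real.pi) = 1 := by
    rw [← Real.sqrt_mul (by positivity)]
    rw [div_mul_div_comm, mul_comm, div_self (by positivity), Real.sqrt_one]
  set X := inner ℝ (incVec u ((1 / 2) ^ (v : ℕ)) (a i)) w
  set R := 3 / 2 * √((L : ℝ) * m)
  set r : ℝ := (1 / 2) ^ (v : ℕ) with hr
  have hr0 : r ≠ 0 := by positivity
  have hR0 : R ≠ 0 := hR.ne'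
  calc 4 / ε * √(Real.pi / 2) * R * r / n * (ε / 4 * √(2 / Real.pi) * (X / r / R))
      = (√(Real.pi / 2) * √(2 / Real.pi)) * ((n : ℝ)⁻¹ * X) := by field_simp
    _ = _ := by rw [hpi, one_mul]; simp

theorem lintegral_exp_inner_levelEstimate_le (hn : 0 < n) (hm : 0 < m) (hv : (v : ℕ) < L) {ε : ℝ}
    (h0 : 0 < ε) (h1 : ε ≤ 3 / 2) (w : EuclideanSpace ℝ (Fin m)) :
    ∫⁻ ω, ENNReal.ofReal (Real.exp (inner ℝ (levelEstimate u L ε a v ω - levelMean u a v) w))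
      ∂(Measure.pi fun _ : Fin n => tapeLaw) ≤
      ENNReal.ofReal (Real.exp (n * (serverScale m n L ε ((1 / 2) ^ (v : ℕ)) ^ 2 * ‖w‖ ^ 2))) := by
  have h := lintegral_exp_sum_response_le ε
    (fun i => completed m N n L (coords u) (a i)) (embed v w)
    (serverScale m n L ε ((1 / 2) ^ (v : ℕ)))
  rw [norm_embed] at h
  refine le_trans (le_of_eq (lintegral_congr fun ω => ?_)) h
  rw [inner_sub_left, inner_levelEstimate, ← sum_integral_response u L a v hn hm hv h0 h1 w,
    ← Finset.sum_sub_distrib]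
  simp only [mul_sub]

theorem mul_serverScale_sq (hn : 0 < n) {ε : ℝ} (h0 : 0 < ε) (r : ℝ) :
    n * serverScale m n L ε r ^ 2 = 18 * Real.pi * L * m * r ^ 2 / (ε ^ 2 * n) := by
  have hn' : (n : ℝ) ≠ 0 := by positivity
  rw [serverScale]
  simp only [div_pow, mul_pow]
  rw [Real.sq_sqrt (by positivity), Real.sq_sqrt (by positivity)]
  field_simp
  ring

theorem measurable_inner_levelEstimate (w : EuclideanSpace ℝ (Fin m)) :
    Measurable fun ω => inner ℝ (levelEstimate u L ε a v ω) w := by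
  simp only [inner_levelEstimate]
  refine Finset.measurable_sum _ fun i _ => Measurable.const_mul ?_ _
  exact (measurable_response _ _ _).comp ((measurable_responseCoins _).comp (measurable_pi_apply i))

theorem levelMean_mem (hn : 0 < n) : levelMean u a v ∈ convexHull ℝ {x | ∃ i < N,
    x = vec m (increment m N (coords u) ((1 / 2) ^ (v : ℕ)) i)} := by
  rw [levelMean, Finset.smul_sum]
  refine (convex_convexHull ℝ _).sum_mem (fun _ _ => by positivity) ?_
    fun i _ => subset_convexHull ℝ _ ⟨a i, (a i).2, rfl⟩
  have hn' : (n : ℝ) ≠ 0 := by positivity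
  simp [hn']

theorem norm_levelMean_le (hn : 0 < n) :
    ‖levelMean u a v‖ ≤ 3 / 2 * (1 / 2) ^ (v : ℕ) * √m := by
  have h := convexHull_min (t := Metric.closedBall (0 : EuclideanSpace ℝ (Fin m))
    (3 / 2 * (1 / 2) ^ (v : ℕ) * √m)) (by
      rintro _ ⟨i, hi, rfl⟩
      rw [mem_closedBall_zero_iff]
      exact norm_incVec_le (u := u) (by positivity) hi)
    (convex_closedBall _ _) (levelMean_mem u a v hn)
  simpa using h

end Level

/-! ## The maximum of the noise -/

/-- The maximal inequality for finitely many sub-Gaussian variables, from x ≤ a + exp(x - a). It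
produces a measurable majorant, valid for all directions at once, in place of the maximum. -/
theorem exists_max_inner_le {Ω E : Type*} [MeasurableSpace Ω] {P : Measure Ω}
    [IsProbabilityMeasure P] [NormedAddCommGroup E] [InnerProductSpace ℝ E] {Z : Ω → E}
    (hZ : ∀ w, Measurable fun ω => inner ℝ (Z ω) w) {s B l : ℝ} (hs : 0 < s) (hB : 0 < B)
    (hl : 1 ≤ 2 * l)
    (hexp : ∀ w, ∫⁻ ω, ENNReal.ofReal (Real.exp (inner ℝ (Z ω) w)) ∂P ≤
      ENNReal.ofReal (Real.exp (s * ‖w‖ ^ 2)))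
    {S : Finset E} (hS : ∀ w ∈ S, ‖w‖ ≤ B) (hcard : (S.card : ℝ) ≤ Real.exp (2 * l)) :
    ∃ G : Ω → ℝ, Measurable G ∧ (∀ ω, ∀ w ∈ S, inner ℝ (Z ω) w ≤ G ω) ∧ (∀ ω, 0 ≤ G ω) ∧
      ∫⁻ ω, ENNReal.ofReal (G ω) ∂P ≤ ENNReal.ofReal (5 * (√s * B * √l)) := by
  have hl0 : 0 < l := by linarith
  -- This choice makes s t² B² = l. Then a = 3l, and a is the logarithm of the bound on the sum of
  -- exponential moments.
  set t : ℝ := √l / (√s * B) with ht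
  have hst : 0 < √s := Real.sqrt_pos.2 hs
  have hlt : 0 < √l := Real.sqrt_pos.2 hl0
  have ht0 : 0 < t := by positivity
  set a : ℝ := 2 * l + s * t ^ 2 * B ^ 2 with ha
  have ha3 : a = 3 * l := by
    rw [ha, ht, div_pow, mul_pow, Real.sq_sqrt hs.le, Real.sq_sqrt hl0.le]
    field_simp
    norm_num
  refine ⟨fun ω => t⁻¹ * (a + Real.exp (-a) * ∑ w ∈ S, Real.exp (inner ℝ (Z ω) (t • w))),
    ?_, fun ω w hw => ?_, fun ω => ?_, ?_⟩
  · have h : ∀ w, Measurable fun ω => Real.exp (inner ℝ (Z ω) w) := fun w =>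
      Real.measurable_exp.comp (hZ w)
    exact ((Finset.measurable_sum _ fun w _ => h (t • w)).const_mul _ |>.const_add a).const_mul _
  · change _ ≤ t⁻¹ * _
    rw [← div_eq_inv_mul, le_div_iff₀ ht0, mul_comm (inner ℝ (Z ω) w), ← real_inner_smul_right]
    have h1 : Real.exp (-a) * Real.exp (inner ℝ (Z ω) (t • w)) ≤
        Real.exp (-a) * ∑ w ∈ S, Real.exp (inner ℝ (Z ω) (t • w)) :=
      mul_le_mul_of_nonneg_left (Finset.single_le_sum (f := fun w => Real.exp (inner ℝ (Z ω) (t • w)))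
        (fun _ _ => (Real.exp_pos _).le) hw) (Real.exp_pos _).le
    rw [← Real.exp_add] at h1
    have h2 := Real.add_one_le_exp (-a + inner ℝ (Z ω) (t • w))
    linarith
  · have : 0 ≤ ∑ w ∈ S, Real.exp (inner ℝ (Z ω) (t • w)) :=
      Finset.sum_nonneg fun _ _ => (Real.exp_pos _).le
    have ha0 : 0 ≤ a := by linarith
    have := Real.exp_pos (-a)
    positivity
  · have h1 : ∀ ω, ENNReal.ofReal (t⁻¹ * (a + Real.exp (-a) *
        ∑ w ∈ S, Real.exp (inner ℝ (Z ω) (t • w)))) = ENNReal.ofReal (t⁻¹ * a) +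
        ENNReal.ofReal (t⁻¹ * Real.exp (-a)) *
          ∑ w ∈ S, ENNReal.ofReal (Real.exp (inner ℝ (Z ω) (t • w))) := by
      intro ω
      have h0 : 0 ≤ ∑ w ∈ S, Real.exp (inner ℝ (Z ω) (t • w)) :=
        Finset.sum_nonneg fun _ _ => (Real.exp_pos _).le
      have ha0 : 0 ≤ a := by linarith
      have := Real.exp_pos (-a)
      rw [← ENNReal.ofReal_sum_of_nonneg fun _ _ => (Real.exp_pos _).le,
        ← ENNReal.ofReal_mul (by positivity), ← ENNReal.ofReal_add (by positivity) (by positivity)]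
      congr 1
      ring
    have hm : ∀ w, Measurable fun ω => ENNReal.ofReal (Real.exp (inner ℝ (Z ω) w)) := fun w =>
      ENNReal.measurable_ofReal.comp (Real.measurable_exp.comp (hZ w))
    simp only [h1]
    rw [lintegral_add_left measurable_const, lintegral_const, measure_univ, mul_one,
      lintegral_const_mul _ (Finset.measurable_sum _ fun w _ => hm _),
      lintegral_finsetSum _ fun w _ => hm _]
    have h2 : ∑ w ∈ S, ∫⁻ ω, ENNReal.ofReal (Real.exp (inner ℝ (Z ω) (t • w))) ∂P ≤
        ENNReal.ofReal (Real.exp a) := by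
      calc _ ≤ ∑ _w ∈ S, ENNReal.ofReal (Real.exp (s * t ^ 2 * B ^ 2)) := by
            refine Finset.sum_le_sum fun w hw => (hexp _).trans (ENNReal.ofReal_le_ofReal
              (Real.exp_le_exp.2 ?_))
            rw [norm_smul, mul_pow, Real.norm_eq_abs, sq_abs, mul_assoc]
            have := pow_le_pow_left₀ (norm_nonneg _) (hS w hw) 2
            exact mul_le_mul_of_nonneg_left (mul_le_mul_of_nonneg_left this (sq_nonneg _)) hs.le
        _ = ENNReal.ofReal (S.card * Real.exp (s * t ^ 2 * B ^ 2)) := by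
            rw [Finset.sum_const, nsmul_eq_mul, ENNReal.ofReal_mul (Nat.cast_nonneg _),
              ENNReal.ofReal_natCast]
        _ ≤ _ := by
            refine ENNReal.ofReal_le_ofReal ?_
            rw [ha, Real.exp_add]
            exact mul_le_mul_of_nonneg_right hcard (Real.exp_pos _).le
    have ha0 : 0 ≤ a := by linarith
    calc _ ≤ ENNReal.ofReal (t⁻¹ * a) + ENNReal.ofReal (t⁻¹ * Real.exp (-a)) *
          ENNReal.ofReal (Real.exp a) := by gcongr
      _ = ENNReal.ofReal (t⁻¹ * a + t⁻¹ * Real.exp (-a) * Real.exp a) := by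
          have := Real.exp_pos (-a)
          rw [← ENNReal.ofReal_mul (by positivity), ← ENNReal.ofReal_add (by positivity)
            (by positivity)]
      -- The left side is (3l + 1)/t, and 1 ≤ 2l turns it into 5l/t = 5 √s B √l.
      _ ≤ _ := by
          refine ENNReal.ofReal_le_ofReal ?_
          rw [mul_assoc t⁻¹, ← Real.exp_add, neg_add_cancel, Real.exp_zero, ha3, ← mul_add,
            ← div_eq_inv_mul, div_le_iff₀ ht0, ht]
          have : 5 * (√s * B * √l) * (√l / (√s * B)) = 5 * (√l * √l) := by field_simp
          rw [this, Real.mul_self_sqrt hl0.le]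
          linarith

/-- The majorant `G` depends on the parties' coins alone and is valid for every possible Frank-Wolfe
output. Thus neither measurability of that output nor the resolution of ties matters. -/
theorem exists_level_error_le {m N n : ℕ} (u : Fin N → EuclideanSpace ℝ (Fin m)) {L : ℕ}
    (a : Fin n → Fin N) (v : Fin n) (hm : 0 < m) (hv : (v : ℕ) < L) {ε : ℝ}
    (h0 : 0 < ε) (h1 : ε ≤ 3 / 2) :
    ∃ G : (Fin n → Tape) → ENNReal, Measurable G ∧
      (∀ ω y c, FrankWolfe m N (increment m N (coords u) ((1 / 2) ^ (v : ℕ))) y n c →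
        vec m y = levelEstimate u L ε a v ω →
        ENNReal.ofReal (‖vec m c - levelMean u a v‖ ^ 2) ≤ G ω) ∧
      ∫⁻ ω, G ω ∂(Measure.pi fun _ : Fin n => tapeLaw) ≤
        ENNReal.ofReal (300 * m * (((1 / 2) ^ (v : ℕ)) ^ 2 *
          √(Real.log ((sepNumber (Set.range u) ((1 / 2) ^ (v : ℕ) / 2)).toNat : ℝ))) * √L /
            (ε * √n)) := by
  classical
  have hn : 0 < n := by have := v.2; omega
  set r : ℝ := (1 / 2) ^ (v : ℕ) with hr
  have hr0 : 0 < r := by positivity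
  set k := (sepNumber (Set.range u) (r / 2)).toNat with hk
  rcases Nat.lt_or_ge 1 k with hk1 | hk1
  swap
  -- Here the asserted bound is zero: all increments vanish and the algorithm never leaves the
  -- origin.
  · have hz : ∀ i < N, incVec u r i = 0 := fun i hi => incVec_eq_zero hr0.le hk1 hi
    refine ⟨0, measurable_zero, fun ω y c hc _ => ?_, by simp⟩
    have h2 : levelMean u a v = 0 := by
      rw [levelMean, Finset.sum_eq_zero fun i _ => hz _ (a i).2, smul_zero]
    rw [hc.vec_eq_zero hz, h2, sub_self, norm_zero]
    simp
  set l : ℝ := Real.log (k : ℝ) with hl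
  have hl2 : 0.69 ≤ l := by
    have h2 : Real.log 2 ≤ l := Real.log_le_log two_pos (by exact_mod_cast hk1)
    linarith [Real.log_two_gt_d9]
  have hm' : (0 : ℝ) < m := by exact_mod_cast hm
  have hn' : (0 : ℝ) < n := by exact_mod_cast hn
  have hL' : (1 : ℝ) ≤ L := by exact_mod_cast (show 1 ≤ L by omega)
  have hmpos : 0 < √(m : ℝ) := Real.sqrt_pos.2 hm'
  set B : ℝ := 3 * r * √m with hB
  set s : ℝ := n * serverScale m n L ε r ^ 2 with hs
  have hs' : s = 18 * Real.pi * L * m * r ^ 2 / (ε ^ 2 * n) := mul_serverScale_sq L hn h0 r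
  have hs0 : 0 < s := by rw [hs']; have := Real.pi_pos; positivity
  set Z : (Fin n → Tape) → EuclideanSpace ℝ (Fin m) := fun ω =>
    levelEstimate u L ε a v ω - levelMean u a v with hZ
  obtain ⟨G, hGm, hG, hG0, hGi⟩ := exists_max_inner_le (P := Measure.pi fun _ : Fin n => tapeLaw)
    (Z := Z) (fun w => by
      simp only [hZ, inner_sub_left]
      exact (measurable_inner_levelEstimate u L ε a v w).sub_const _) hs0
    (show 0 < B by positivity) (show 1 ≤ 2 * l by linarith) (fun w => by
      have := lintegral_exp_inner_levelEstimate_le u L a v hn hm hv h0 h1 w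
      rwa [← mul_assoc] at this)
    (S := (Finset.range N).image fun i => incVec u r i - levelMean u a v) (by
      intro w hw
      obtain ⟨i, hi, rfl⟩ := Finset.mem_image.1 hw
      have h2 := norm_incVec_le (u := u) hr0.le (Finset.mem_range.1 hi)
      have h3 := norm_levelMean_le u a v hn
      refine (norm_sub_le _ _).trans ((add_le_add h2 h3).trans (le_of_eq ?_))
      rw [hB]
      ring) (by
      have h2 : (((Finset.range N).image fun i => incVec u r i - levelMean u a v).card : ℝ) ≤
          (k : ℝ) ^ 2 := by
        have h3 : ((Finset.range N).image fun i => incVec u r i - levelMean u a v) =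
            ((Finset.range N).image (incVec u r)).image fun x => x - levelMean u a v := by
          rw [Finset.image_image]
          rfl
        rw [h3]
        exact_mod_cast Finset.card_image_le.trans (card_incVec_le hr0.le)
      refine h2.trans (le_of_eq ?_)
      have hk0 : (0 : ℝ) < k := by exact_mod_cast (by omega : 0 < k)
      rw [two_mul, Real.exp_add, Real.exp_log hk0, sq])
  have hD : 0 ≤ 3 / 2 * r * √m := by positivity
  refine ⟨fun ω => ENNReal.ofReal (2 * G ω + 16 * (3 / 2 * r * √m) ^ 2 / n),
    ENNReal.measurable_ofReal.comp ((hGm.const_mul 2).add_const _), fun ω y c hc hy => ?_, ?_⟩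
  · refine ENNReal.ofReal_le_ofReal (hc.norm_sub_sq_le hn
      (fun i hi => norm_incVec_le (u := u) hr0.le hi) hD (levelMean_mem u a v hn) fun i hi => ?_)
    rw [hy]
    exact hG ω _ (Finset.mem_image.2 ⟨i, Finset.mem_range.2 hi, rfl⟩)
  · have hsplit : ∀ ω, ENNReal.ofReal (2 * G ω + 16 * (3 / 2 * r * √m) ^ 2 / n) =
        2 * ENNReal.ofReal (G ω) + ENNReal.ofReal (16 * (3 / 2 * r * √m) ^ 2 / n) := fun ω => by
      rw [ENNReal.ofReal_add (by linarith [hG0 ω]) (by positivity),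
        ENNReal.ofReal_mul (by norm_num), ENNReal.ofReal_ofNat]
    simp only [hsplit]
    rw [lintegral_add_right _ measurable_const, lintegral_const, measure_univ, mul_one,
      lintegral_const_mul 2 (f := fun ω => ENNReal.ofReal (G ω)) (by fun_prop)]
    refine (add_le_add_left (mul_le_mul_right hGi 2) _).trans ?_
    rw [← ENNReal.ofReal_ofNat, ← ENNReal.ofReal_mul (by norm_num),
      ← ENNReal.ofReal_add (by positivity) (by positivity)]
    refine ENNReal.ofReal_le_ofReal ?_
    -- The constant comes from √(18π) < 7.6. With B = 3r√m, the noise term has the factor 2 · 5 ·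
    -- 7.6 · 3 = 228.
    have hsq : √s ≤ 7.6 * √L * √m * r / (ε * √n) := by
      rw [Real.sqrt_le_left (by positivity), hs']
      simp only [div_pow, mul_pow]
      rw [Real.sq_sqrt hm'.le, Real.sq_sqrt hn'.le, Real.sq_sqrt (by linarith)]
      refine div_le_div_of_nonneg_right ?_ (by positivity)
      have hpi := Real.pi_lt_d2
      have : 0 ≤ (L : ℝ) * m * r ^ 2 := by positivity
      nlinarith
    have hLl : 3 / 4 ≤ √L * √l := by
      rw [← Real.sqrt_mul (by linarith)]
      refine Real.le_sqrt_of_sq_le ?_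
      nlinarith
    have hsn : 1 ≤ √(n : ℝ) := by
      rw [Real.one_le_sqrt]
      exact_mod_cast hn
    have hmm : √(m : ℝ) * √m = m := Real.mul_self_sqrt hm'.le
    have hnn : √(n : ℝ) * √n = n := Real.mul_self_sqrt hn'.le
    have e1 : 2 * (5 * (√s * B * √l)) ≤ 228 * m * (r ^ 2 * √l) * √L / (ε * √n) := by
      calc 2 * (5 * (√s * B * √l))
          ≤ 2 * (5 * (7.6 * √L * √m * r / (ε * √n) * B * √l)) := by gcongr
        _ = 228 * (√m * √m) * (r ^ 2 * √l) * √L / (ε * √n) := by rw [hB]; ring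
        _ = _ := by rw [hmm]
    -- The optimization error 36 m r²/n is absorbed in the noise bound because ε ≤ 3/2 ≤ 2√L √l √n.
    -- The two constants add up to 300.
    have e2 : 16 * (3 / 2 * r * √m) ^ 2 / n ≤ 72 * m * (r ^ 2 * √l) * √L / (ε * √n) := by
      have h2 : 16 * (3 / 2 * r * √m) ^ 2 / n = 36 * m * r ^ 2 / (√n * √n) := by
        rw [hnn, mul_pow, Real.sq_sqrt hm'.le]
        ring
      rw [h2, div_le_div_iff₀ (by positivity) (by positivity)]
      have h3 : ε ≤ 2 * (√L * √l) * √n := by nlinarith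
      calc 36 * m * r ^ 2 * (ε * √n) ≤ 36 * m * r ^ 2 * (2 * (√L * √l) * √n * √n) := by gcongr
        _ = _ := by ring
    refine (add_le_add e1 e2).trans (le_of_eq ?_)
    ring

/-! ## The error of the protocol -/

theorem errAt_le_of_lintegral_le {m N : ℕ} {Q : Protocol} {u : Fin N → EuclideanSpace ℝ (Fin m)}
    {n : ℕ} {α ε : ℝ} (hα : 0 ≤ α) {X : Fin n → EuclideanSpace ℝ (Fin m)}
    (h : ∫⁻ ω, ENNReal.ofReal (‖Q.output u n α ε X ω - (n : ℝ)⁻¹ • ∑ i, X i‖ ^ 2 / m)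
      ∂(Protocol.coinLaw n) ≤ ENNReal.ofReal (α ^ 2)) :
    Q.errAt u n α ε X ≤ ENNReal.ofReal α := by
  rw [Protocol.errAt, Protocol.outputLaw, lintegral_map (by fun_prop)
    (Q.measurable_output u n α ε X)]
  refine (ENNReal.rpow_le_rpow h (by norm_num)).trans (le_of_eq ?_)
  rw [ENNReal.ofReal_rpow_of_nonneg (sq_nonneg α) (by norm_num), ← Real.sqrt_eq_rpow,
    Real.sqrt_sq hα]

theorem sq_sum_le_sum_mul_sum_div {ι : Type*} (s : Finset ι) {q b : ι → ℝ}
    (hq : ∀ i ∈ s, 0 < q i) :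
    (∑ i ∈ s, b i) ^ 2 ≤ (∑ i ∈ s, q i) * ∑ i ∈ s, b i ^ 2 / q i :=
  Finset.sum_sq_le_sum_mul_sum_of_sq_le_mul s (fun i hi => (hq i hi).le)
    (fun i hi => div_nonneg (sq_nonneg _) (hq i hi).le) fun i hi => by
      have := (hq i hi).ne'
      exact le_of_eq (by field_simp)

section Error

variable {m N n : ℕ} {u : Fin N → EuclideanSpace ℝ (Fin m)} {α ε : ℝ}

/-- The error splits into the deterministic error of the finest net and the estimation errors of the
levels. -/
theorem norm_add_sum_sub_mean_le (h01 : ∀ k j, u k j ∈ Set.Icc (0 : ℝ) 1) (hn : 0 < n)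
    {x : ℝ} (hx : 0 ≤ x) (a : Fin n → Fin N)
    (hres : (1 / 2 : ℝ) ^ numHalvings x n ≤ x ∨ (sepNumber (Set.range u) (x / 2)).toNat ≤ 1)
    (c : ℕ → EuclideanSpace ℝ (Fin m)) :
    ‖vec m (coords u 0) + ∑ v ∈ Finset.range (numHalvings x n), c v -
        (n : ℝ)⁻¹ • ∑ i, u (a i)‖ ≤
      x * √m + ∑ v ∈ Finset.range (numHalvings x n),
        ‖c v - (n : ℝ)⁻¹ • ∑ i, incVec u ((1 / 2) ^ v) (a i)‖ := by
  set L := numHalvings x n with hL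
  have hn' : (n : ℝ) ≠ 0 := by positivity
  have h1 : vec m (coords u 0) + ∑ v ∈ Finset.range L, (n : ℝ)⁻¹ •
      ∑ i, incVec u ((1 / 2) ^ v) (a i) - (n : ℝ)⁻¹ • ∑ i, u (a i) = (n : ℝ)⁻¹ •
      ∑ i, (vec m (coords u (netMap m N (coords u) ((1 / 2) ^ L) (a i))) - u (a i)) := by
    rw [Finset.sum_sub_distrib, smul_sub, ← Finset.smul_sum, Finset.sum_comm]
    congr 1
    have h2 : ∀ i, vec m (coords u (netMap m N (coords u) ((1 / 2) ^ L) (a i))) =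
        vec m (coords u 0) + ∑ v ∈ Finset.range L, incVec u ((1 / 2) ^ v) (a i) := fun i =>
      (add_sum_incVec h01 (a i).2 L).symm
    simp only [h2]
    rw [Finset.sum_add_distrib, smul_add]
    congr 1
    simp only [Finset.sum_const, Finset.card_univ, Fintype.card_fin]
    rw [← Nat.cast_smul_eq_nsmul ℝ, smul_smul, inv_mul_cancel₀ hn', one_smul]
  have h3 : vec m (coords u 0) + ∑ v ∈ Finset.range L, c v - (n : ℝ)⁻¹ • ∑ i, u (a i) =
      (n : ℝ)⁻¹ • ∑ i, (vec m (coords u (netMap m N (coords u) ((1 / 2) ^ L) (a i))) - u (a i)) +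
      ∑ v ∈ Finset.range L, (c v - (n : ℝ)⁻¹ • ∑ i, incVec u ((1 / 2) ^ v) (a i)) := by
    rw [← h1, Finset.sum_sub_distrib]
    abel
  rw [h3]
  refine (norm_add_le _ _).trans (add_le_add ?_ (norm_sum_le _ _))
  rw [norm_smul, norm_inv, Real.norm_natCast, ← div_eq_inv_mul, div_le_iff₀ (by positivity)]
  refine (norm_sum_le _ _).trans ?_
  calc _ ≤ ∑ _i : Fin n, x * √m := by
        refine Finset.sum_le_sum fun i _ => ?_
        rw [norm_sub_rev, ← vec_coords u (a i)]
        exact norm_sub_netMap_le hx (a i).2 hres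
    _ = _ := by simp [mul_comm]

/-- Half of α² is spent on the finest net and half on the levels. Their dependence is irrelevant,
since weighted Cauchy-Schwarz needs only the separate second moments. The constant is 1200 = 2 · 2 ·
300. -/
theorem chainingProtocol_errAt_le (hu : Function.Injective u)
    (h01 : ∀ k j, u k j ∈ Set.Icc (0 : ℝ) 1) (hn : 0 < n) (hm : 0 < m) (hα0 : 0 < α)
    (hα : α < 1 / 2) (h0 : 0 < ε) (h1 : ε ≤ 3 / 2)
    (hres : (1 / 2 : ℝ) ^ numHalvings (α / 2) n ≤ α / 2 ∨
      (sepNumber (Set.range u) (α / 2 / 2)).toNat ≤ 1) {q : ℕ → ℝ} (hq : ∀ v, 0 < q v)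
    (hbound : (∑ v ∈ Finset.range (numHalvings (α / 2) n), q v) *
      (∑ v ∈ Finset.range (numHalvings (α / 2) n), (((1 / 2) ^ v) ^ 2 *
        √(Real.log ((sepNumber (Set.range u) ((1 / 2) ^ v / 2)).toNat : ℝ))) / q v) *
      √(numHalvings (α / 2) n) * 1200 ≤ α ^ 2 * (ε * √n)) (a : Fin n → Fin N) :
    chainingProtocol.errAt u n α ε (fun i => u (a i)) ≤ ENNReal.ofReal α := by
  refine errAt_le_of_lintegral_le hα0.le ?_
  set L := numHalvings (α / 2) n with hL
  have hLn : L ≤ n := numHalvings_le _ _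
  have hN : 0 < N := (Nat.zero_le _).trans_lt (a ⟨0, hn⟩).2
  have hm' : (0 : ℝ) < m := by exact_mod_cast hm
  have hn' : (0 : ℝ) < n := by exact_mod_cast hn
  set W : ℕ → ℝ := fun v => ((1 / 2) ^ v) ^ 2 *
    √(Real.log ((sepNumber (Set.range u) ((1 / 2) ^ v / 2)).toNat : ℝ)) with hW
  set μ : ℕ → EuclideanSpace ℝ (Fin m) := fun v =>
    (n : ℝ)⁻¹ • ∑ i, incVec u ((1 / 2) ^ v) (a i) with hμ
  have hG : ∀ v, ∃ G : (Fin n → Tape) → ENNReal, Measurable G ∧ ∀ hv : v < L,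
      (∀ ω y c, FrankWolfe m N (increment m N (coords u) ((1 / 2) ^ v)) y n c →
        vec m y = levelEstimate u L ε a ⟨v, hv.trans_le hLn⟩ ω →
        ENNReal.ofReal (‖vec m c - μ v‖ ^ 2) ≤ G ω) ∧
      ∫⁻ ω, G ω ∂(Measure.pi fun _ : Fin n => tapeLaw) ≤
        ENNReal.ofReal (300 * m * W v * √L / (ε * √n)) := by
    intro v
    by_cases hv : v < L
    · obtain ⟨G, hG1, hG2, hG3⟩ := exists_level_error_le u a ⟨v, hv.trans_le hLn⟩ hm hv h0 h1
      exact ⟨G, hG1, fun _ => ⟨hG2, hG3⟩⟩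
    · exact ⟨0, measurable_zero, fun h => absurd h hv⟩
  choose G hGm hG using hG
  set Q := ∑ v ∈ Finset.range L, q v with hQ
  have hQ0 : 0 ≤ Q := Finset.sum_nonneg fun v _ => (hq v).le
  clear_value Q
  have hW0 : ∀ v, 0 ≤ W v := fun v => by positivity
  have hpt : ∀ ω : (Fin n → Tape) × Tape,
      ENNReal.ofReal (‖chainingProtocol.output u n α ε (fun i => u (a i)) ω -
        (n : ℝ)⁻¹ • ∑ i, u (a i)‖ ^ 2 / m) ≤ ENNReal.ofReal (α ^ 2 / 2) +
        ∑ v ∈ Finset.range L, ENNReal.ofReal (2 * Q / (m * q v)) * G v ω.1 := by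
    intro ω
    obtain ⟨c, hc, hout⟩ := chainingProtocol_output u n α ε hN (fun i => u (a i)) ω
    have hout' : chainingProtocol.output u n α ε (fun i => u (a i)) ω =
        vec m (coords u 0) + ∑ v ∈ Finset.range L, vec m (c v) := by
      refine PiLp.ext fun j => ?_
      rw [hout j, if_neg (not_le.2 hα), PiLp.add_apply, WithLp.ofLp_sum, Finset.sum_apply]
      simp [hL]
    have hb : ∀ v ∈ Finset.range L, ENNReal.ofReal (‖vec m (c v) - μ v‖ ^ 2) ≤ G v ω.1 := by
      intro v hv
      have hv := Finset.mem_range.1 hv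
      refine ((hG v hv).1) ω.1 _ _ (hc v hv) ?_
      simp only [chainingProtocol_message u n α ε hu]
      rfl
    have hnorm := norm_add_sum_sub_mean_le h01 hn (half_pos hα0).le a hres fun v => vec m (c v)
    rw [← hL, ← hout'] at hnorm
    set z := chainingProtocol.output u n α ε (fun i => u (a i)) ω - (n : ℝ)⁻¹ • ∑ i, u (a i)
    set b : ℕ → ℝ := fun v => ‖vec m (c v) - μ v‖ with hbdef
    have hsum0 : 0 ≤ ∑ v ∈ Finset.range L, b v := Finset.sum_nonneg fun v _ => norm_nonneg _
    have hreal : ‖z‖ ^ 2 / m ≤ α ^ 2 / 2 +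
        ∑ v ∈ Finset.range L, 2 * Q / (m * q v) * b v ^ 2 := by
      have h2 : ‖z‖ ^ 2 ≤ (α / 2 * √m + ∑ v ∈ Finset.range L, b v) ^ 2 :=
        pow_le_pow_left₀ (norm_nonneg _) hnorm 2
      have h3 := sq_sum_le_sum_mul_sum_div (Finset.range L) (q := q) (b := b) fun v _ => hq v
      rw [← hQ] at h3
      have h4 : (α / 2 * √m) ^ 2 = α ^ 2 / 4 * m := by
        rw [mul_pow, Real.sq_sqrt hm'.le]
        ring
      have h5 : ∑ v ∈ Finset.range L, 2 * Q / (m * q v) * b v ^ 2 =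
          2 / m * (Q * ∑ v ∈ Finset.range L, b v ^ 2 / q v) := by
        rw [Finset.mul_sum, Finset.mul_sum]
        refine Finset.sum_congr rfl fun v _ => ?_
        have := (hq v).ne'
        field_simp
      rw [h5, div_le_iff₀ hm']
      calc ‖z‖ ^ 2 ≤ 2 * (α / 2 * √m) ^ 2 + 2 * (∑ v ∈ Finset.range L, b v) ^ 2 := by
            nlinarith [sq_nonneg (α / 2 * √m - ∑ v ∈ Finset.range L, b v)]
        _ ≤ 2 * (α ^ 2 / 4 * m) + 2 * (Q * ∑ v ∈ Finset.range L, b v ^ 2 / q v) := by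
            rw [h4]
            linarith
        _ = _ := by field_simp; ring
    refine (ENNReal.ofReal_le_ofReal hreal).trans ?_
    rw [ENNReal.ofReal_add (by positivity) (Finset.sum_nonneg fun v _ => by
      have := hq v
      positivity), ENNReal.ofReal_sum_of_nonneg fun v _ => by
      have := hq v
      positivity]
    refine add_le_add le_rfl (Finset.sum_le_sum fun v hv => ?_)
    rw [ENNReal.ofReal_mul (by have := hq v; positivity)]
    gcongr
    exact hb v hv
  refine (lintegral_mono hpt).trans ?_
  have hmeas : ∀ v, Measurable fun ω : (Fin n → Tape) × Tape =>
      ENNReal.ofReal (2 * Q / (m * q v)) * G v ω.1 := fun v =>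
    ((hGm v).comp measurable_fst).const_mul _
  rw [lintegral_add_left measurable_const, lintegral_const, measure_univ, mul_one,
    lintegral_finsetSum _ fun v _ => hmeas v]
  have hterm : ∀ v ∈ Finset.range L, ∫⁻ ω : (Fin n → Tape) × Tape,
      ENNReal.ofReal (2 * Q / (m * q v)) * G v ω.1 ∂(Protocol.coinLaw n) ≤
      ENNReal.ofReal (2 * Q / (m * q v) * (300 * m * W v * √L / (ε * √n))) := by
    intro v hv
    rw [lintegral_const_mul _ (show Measurable fun ω : (Fin n → Tape) × Tape => G v ω.1 from
        (hGm v).comp measurable_fst), Protocol.coinLaw,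
      -- The bounds do not involve the coins of the server, which are integrated out.
      measurePreserving_fst.lintegral_comp (hGm v), ENNReal.ofReal_mul (by
        have := hq v
        positivity)]
    gcongr
    exact (hG v (Finset.mem_range.1 hv)).2
  refine (add_le_add le_rfl (Finset.sum_le_sum hterm)).trans ?_
  rw [← ENNReal.ofReal_sum_of_nonneg fun v _ => by
      have := hq v
      have := hW0 v
      positivity, ← ENNReal.ofReal_add (by positivity) (Finset.sum_nonneg fun v _ => by
      have := hq v
      have := hW0 v
      positivity)]
  refine ENNReal.ofReal_le_ofReal ?_
  have hen : 0 < ε * √n := by positivity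
  have h5 : ∑ v ∈ Finset.range L, 2 * Q / (m * q v) * (300 * m * W v * √L / (ε * √n)) =
      (Q * (∑ v ∈ Finset.range L, W v / q v) * √L * 1200) / (ε * √n) / 2 := by
    rw [Finset.mul_sum, Finset.sum_mul, Finset.sum_mul, Finset.sum_div, Finset.sum_div]
    refine Finset.sum_congr rfl fun v _ => ?_
    have := (hq v).ne'
    field_simp
    ring
  have h6 := (div_le_iff₀ hen).2 hbound
  rw [h5]
  linarith

/-- The centre of the cube differs from any mean by at most 1/2 in each coordinate, so no samples
are needed. -/
theorem chainingProtocol_errAt_le_of_half_le (h01 : ∀ k j, u k j ∈ Set.Icc (0 : ℝ) 1)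
    (hn : 0 < n) (hα : 1 / 2 ≤ α) (a : Fin n → Fin N) :
    chainingProtocol.errAt u n α ε (fun i => u (a i)) ≤ ENNReal.ofReal α := by
  refine errAt_le_of_lintegral_le (by linarith) ?_
  have hN : 0 < N := (Nat.zero_le _).trans_lt (a ⟨0, hn⟩).2
  have hn' : (0 : ℝ) < n := by exact_mod_cast hn
  refine (lintegral_mono fun ω => ENNReal.ofReal_le_ofReal
    (?_ : _ ≤ α ^ 2)).trans (by rw [lintegral_const, measure_univ, mul_one])
  obtain ⟨c, -, hout⟩ := chainingProtocol_output u n α ε hN (fun i => u (a i)) ω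
  refine div_le_of_le_mul₀ (Nat.cast_nonneg m) (sq_nonneg α) ?_
  rw [EuclideanSpace.norm_sq_eq]
  calc _ ≤ ∑ _j : Fin m, α ^ 2 := by
        refine Finset.sum_le_sum fun j _ => ?_
        have h1 : 0 ≤ ∑ i, u (a i) j := Finset.sum_nonneg fun i _ => (h01 (a i) j).1
        have h2 : ∑ i, u (a i) j ≤ n := by
          refine (Finset.sum_le_sum fun i _ => (h01 (a i) j).2).trans ?_
          simp
        have h3 : (chainingProtocol.output u n α ε (fun i => u (a i)) ω -
            (n : ℝ)⁻¹ • ∑ i, u (a i)) j = 1 / 2 - (n : ℝ)⁻¹ * ∑ i, u (a i) j := by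
          rw [PiLp.sub_apply, hout j, if_pos hα, PiLp.smul_apply, WithLp.ofLp_sum,
            Finset.sum_apply, smul_eq_mul]
        rw [h3, Real.norm_eq_abs]
        have h4 : (n : ℝ)⁻¹ * ∑ i, u (a i) j ≤ 1 := by
          rw [← div_eq_inv_mul, div_le_one hn']
          exact h2
        have h5 : 0 ≤ (n : ℝ)⁻¹ * ∑ i, u (a i) j := by positivity
        refine pow_le_pow_left₀ (abs_nonneg _) ?_ 2
        rw [abs_le]
        constructor <;> linarith
    _ = _ := by simp [mul_comm]

theorem chainingProtocol_errAt_le_of_dimension_eq_zero {u : Fin N → EuclideanSpace ℝ (Fin 0)}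
    (hα : 0 ≤ α) (X : Fin n → EuclideanSpace ℝ (Fin 0)) :
    chainingProtocol.errAt u n α ε X ≤ ENNReal.ofReal α := by
  refine errAt_le_of_lintegral_le hα ?_
  simp

/-! ## Sample complexity -/

/-- The last halving started from a scale above α/2, so L < log₂(1/α) + 2. Since log(1/α) ≥ log 2,
the additive 2 is absorbed in the factor 5. -/
theorem numHalvings_le_log (hα0 : 0 < α) (hα : α < 1 / 2) (n : ℕ) :
    (numHalvings (α / 2) n : ℝ) ≤ 5 * Real.log (1 / α) := by
  have hl : Real.log 2 ≤ Real.log (1 / α) := by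
    refine Real.log_le_log two_pos ?_
    rw [le_div_iff₀ hα0]
    linarith
  have h2 := Real.log_two_gt_d9
  rcases hk : numHalvings (α / 2) n with _ | k
  · rw [Nat.cast_zero]
    linarith
  have h3 : α / 2 < (1 / 2) ^ k := lt_of_lt_numHalvings (k := n) (by omega)
  have h4 := Real.log_lt_log (by positivity) h3
  rw [Real.log_div hα0.ne' two_ne_zero, Real.log_pow, one_div, Real.log_inv] at h4
  rw [one_div, Real.log_inv] at hl ⊢
  push_cast
  nlinarith [Nat.cast_nonneg (α := ℝ) k]

theorem sum_pow_le (x : ℝ) (h0 : 0 ≤ x) (h1 : x < 1) (L : ℕ) :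
    ∑ v ∈ Finset.range L, x ^ v ≤ (1 - x)⁻¹ := by
  rw [← tsum_geometric_of_lt_one h0 h1]
  exact (summable_geometric_of_lt_one h0 h1).sum_le_tsum _ fun v _ => pow_nonneg h0 v

/-- Take t to be half the scale, which exceeds α/4 at every active level. The factor 2^p pays for
this halving. -/
theorem pow_mul_sqrt_log_le (h01 : ∀ k j, u k j ∈ Set.Icc (0 : ℝ) 1) (hα0 : 0 < α) (p : ℕ) {v : ℕ}
    (hv : v < numHalvings (α / 2) n) :
    ((1 / 2) ^ v) ^ p *
      √(Real.log ((sepNumber (Set.range u) ((1 / 2) ^ v / 2)).toNat : ℝ)) ≤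
      2 ^ p * √(packingSup (Set.range u) (2 * p) (α / 4)) := by
  have h1 := lt_of_lt_numHalvings hv
  have h2 := Real.sqrt_le_sqrt (mul_log_le_packingSup h01 (2 * p) (by positivity : 0 < α / 4)
    (by linarith : α / 4 ≤ (1 / 2) ^ v / 2))
  rw [Real.sqrt_mul (by positivity), pow_mul', Real.sqrt_sq (by positivity), div_pow,
    div_mul_eq_mul_div, div_le_iff₀ (by positivity)] at h2
  linarith

theorem packingSup_nonneg (h01 : ∀ k j, u k j ∈ Set.Icc (0 : ℝ) 1) (p : ℕ) {s : ℝ} (hs : 0 < s) :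
    0 ≤ packingSup (Set.range u) p s :=
  le_trans (mul_nonneg (by positivity) (Real.log_natCast_nonneg _))
    (mul_log_le_packingSup h01 p hs le_rfl)

/-- If the number of halvings is bounded by the number of parties only, then the points are close
to each other. -/
theorem pow_numHalvings_le_or (h01 : ∀ k j, u k j ∈ Set.Icc (0 : ℝ) 1) (hα0 : 0 < α)
    (hα : α < 1 / 2) (p : ℕ) {K : ℝ} (hK : 0 ≤ K)
    (h : K * packingSup (Set.range u) p (α / 4) ≤ n)
    (hlarge : 5 * Real.log (1 / α) < K * ((α / 4) ^ p * 0.69)) :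
    (1 / 2 : ℝ) ^ numHalvings (α / 2) n ≤ α / 2 ∨
      (sepNumber (Set.range u) (α / 2 / 2)).toNat ≤ 1 := by
  -- If the cap is attained, then L = n. A packing number of at least 2 at α/4 would bound the
  -- supremum below by (α/4)^p log 2, forcing n > 5 log(1/α) ≥ L, a contradiction.
  refine (numHalvings_eq_or_le (α / 2) n).elim (fun h1 => Or.inr ?_) Or.inl
  by_contra hlt
  rw [not_le, show α / 2 / 2 = α / 4 by ring] at hlt
  have h2 : 0.69 ≤ Real.log ((sepNumber (Set.range u) (α / 4)).toNat : ℝ) := by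
    have h2 := Real.log_le_log two_pos (by exact_mod_cast hlt :
      (2 : ℝ) ≤ ((sepNumber (Set.range u) (α / 4)).toNat : ℝ))
    linarith [Real.log_two_gt_d9]
  have h3 := mul_log_le_packingSup h01 p (by positivity : 0 < α / 4) le_rfl
  have h4 : (α / 4) ^ p * 0.69 ≤ packingSup (Set.range u) p (α / 4) :=
    (mul_le_mul_of_nonneg_left h2 (by positivity)).trans h3
  have h5 := numHalvings_le_log hα0 hα n
  rw [h1] at h5
  have h6 := mul_le_mul_of_nonneg_left h4 hK
  linarith

theorem chainingProtocol_err_le (h01 : ∀ k j, u k j ∈ Set.Icc (0 : ℝ) 1) (hn : 0 < n)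
    (hα0 : 0 < α)
    (h : 0 < m → α < 1 / 2 → ∀ a : Fin n → Fin N,
      chainingProtocol.errAt u n α ε (fun i => u (a i)) ≤ ENNReal.ofReal α) :
    chainingProtocol.err u n α ε ≤ ENNReal.ofReal α := by
  refine iSup_le fun a => ?_
  rcases Nat.eq_zero_or_pos m with rfl | hm
  · exact chainingProtocol_errAt_le_of_dimension_eq_zero hα0.le _
  · rcases le_or_gt (1 / 2) α with hα | hα
    · exact chainingProtocol_errAt_le_of_half_le h01 hn hα a
    · exact h hm hα a

theorem mul_sqrt_le_of_sq_le {x y z w : ℝ} (hz : 0 ≤ z) (hy : 0 ≤ y) (hw : 0 ≤ w)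
    (h : x ^ 2 * y ≤ z ^ 2 * w) : x * √y ≤ z * √w := by
  refine abs_le_of_sq_le_sq' ?_ (by positivity) |>.2
  rwa [mul_pow, mul_pow, Real.sq_sqrt hy, Real.sq_sqrt hw]

theorem log_two_lt_log_one_div (hα0 : 0 < α) (hα : α < 1 / 2) : 0.69 < Real.log (1 / α) := by
  have hl : Real.log 2 ≤ Real.log (1 / α) := by
    refine Real.log_le_log two_pos ?_
    rw [le_div_iff₀ hα0]
    linarith
  linarith [Real.log_two_gt_d9]

/-- The sample complexity in terms of `t ^ 2 * log P(t)`. -/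
theorem chainingProtocol_err_le_of_sq (hu : Function.Injective u)
    (h01 : ∀ k j, u k j ∈ Set.Icc (0 : ℝ) 1) (hn : 0 < n) (hα0 : 0 < α) (h0 : 0 < ε)
    (h1 : ε ≤ 3 / 2)
    (h : 10 ^ 12 * (Real.log (1 / α) ^ 2 / (α ^ 4 * ε ^ 2)) *
      packingSup (Set.range u) 2 (α / 4) ≤ n) :
    chainingProtocol.err u n α ε ≤ ENNReal.ofReal α := by
  refine chainingProtocol_err_le h01 hn hα0 fun hm hα a => ?_
  have hl := log_two_lt_log_one_div hα0 hα
  set l := Real.log (1 / α) with hldef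
  have hl0 : 0 < l := by linarith
  refine chainingProtocol_errAt_le hu h01 hn hm hα0 hα h0 h1
    -- Any ratio strictly between 1/2 and 1 would do: both the weights and the quotients, of order
    -- (2/3)^v, are then summable uniformly in L.
    (pow_numHalvings_le_or h01 hα0 hα 2 (by positivity) h ?_) (q := fun v => (3 / 4) ^ v)
    (fun v => by positivity) ?_ a
  · have he : α ^ 2 * ε ^ 2 ≤ 1 := by
      have h2 : α * ε ≤ 1 := by nlinarith
      rw [← mul_pow]
      exact pow_le_one₀ (by positivity) h2
    rw [show (10 : ℝ) ^ 12 * (l ^ 2 / (α ^ 4 * ε ^ 2)) * ((α / 4) ^ 2 * 0.69) =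
      10 ^ 12 * l ^ 2 * 0.69 / 16 / (α ^ 2 * ε ^ 2) by field_simp; ring, lt_div_iff₀ (by positivity)]
    nlinarith
  · set L := numHalvings (α / 2) n with hL
    set B := packingSup (Set.range u) 2 (α / 4) with hB
    have hB0 : 0 ≤ B := packingSup_nonneg h01 2 (by positivity)
    have hLl : (L : ℝ) ≤ 5 * l := numHalvings_le_log hα0 hα n
    have hS1 : ∑ v ∈ Finset.range L, ((3 : ℝ) / 4) ^ v ≤ 4 :=
      (sum_pow_le _ (by norm_num) (by norm_num) L).trans (by norm_num)
    have hS2 : ∑ v ∈ Finset.range L, (((1 / 2) ^ v) ^ 2 *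
        √(Real.log ((sepNumber (Set.range u) ((1 / 2) ^ v / 2)).toNat : ℝ))) / (3 / 4) ^ v ≤
        6 * √B := by
      calc _ ≤ ∑ v ∈ Finset.range L, 2 * √B * (2 / 3) ^ v := by
            refine Finset.sum_le_sum fun v hv => ?_
            have h2 := pow_mul_sqrt_log_le h01 hα0 1 (Finset.mem_range.1 hv)
            rw [pow_one, pow_one] at h2
            rw [div_le_iff₀ (by positivity), mul_assoc (2 * √B), ← mul_pow,
              show (2 / 3 : ℝ) * (3 / 4) = 1 / 2 by norm_num, sq, mul_assoc, mul_comm]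
            exact mul_le_mul_of_nonneg_right h2 (by positivity)
        _ ≤ 2 * √B * 3 := by
            rw [← Finset.mul_sum]
            refine mul_le_mul_of_nonneg_left ?_ (by positivity)
            exact (sum_pow_le _ (by norm_num) (by norm_num) L).trans (by norm_num)
        _ = 6 * √B := by ring
    calc _ ≤ 4 * (6 * √B) * √L * 1200 := by gcongr
      _ = 28800 * √(B * L) := by rw [Real.sqrt_mul hB0]; ring
      _ ≤ (α ^ 2 * ε) * √n := by
          refine mul_sqrt_le_of_sq_le (by positivity) (by positivity) (Nat.cast_nonneg n) ?_
          have h3 : 10 ^ 12 * l ^ 2 * B ≤ (α ^ 2 * ε) ^ 2 * n := by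
            calc _ = 10 ^ 12 * (l ^ 2 / (α ^ 4 * ε ^ 2)) * B * (α ^ 2 * ε) ^ 2 := by field_simp
              _ ≤ n * (α ^ 2 * ε) ^ 2 := by gcongr
              _ = _ := mul_comm _ _
          -- One factor log(1/α) bounds L. The other is only bounded below, by 0.69.
          have h4 : 28800 ^ 2 * (L : ℝ) ≤ 10 ^ 12 * l ^ 2 := by nlinarith
          calc 28800 ^ 2 * (B * L) = 28800 ^ 2 * (L : ℝ) * B := by ring
            _ ≤ 10 ^ 12 * l ^ 2 * B := mul_le_mul_of_nonneg_right h4 hB0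
            _ ≤ _ := h3
      _ = _ := mul_assoc _ _ _

/-- The sample complexity in terms of `t ^ 4 * log P(t)`. -/
theorem chainingProtocol_err_le_of_pow_four (hu : Function.Injective u)
    (h01 : ∀ k j, u k j ∈ Set.Icc (0 : ℝ) 1) (hn : 0 < n) (hα0 : 0 < α) (h0 : 0 < ε)
    (h1 : ε ≤ 3 / 2)
    (h : 10 ^ 12 * (Real.log (1 / α) ^ 6 / (α ^ 4 * ε ^ 2)) *
      packingSup (Set.range u) 4 (α / 4) ≤ n) :
    chainingProtocol.err u n α ε ≤ ENNReal.ofReal α := by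
  refine chainingProtocol_err_le h01 hn hα0 fun hm hα a => ?_
  have hl := log_two_lt_log_one_div hα0 hα
  set l := Real.log (1 / α) with hldef
  have hl0 : 0 < l := by linarith
  refine chainingProtocol_errAt_le hu h01 hn hm hα0 hα h0 h1
    -- The bound on W_v no longer decays with the level, so equal weights are used, at the price of
    -- two factors L.
    (pow_numHalvings_le_or h01 hα0 hα 4 (by positivity) h ?_) (q := fun v => 1)
    (fun v => one_pos) ?_ a
  · have he : ε ^ 2 ≤ 9 / 4 := by nlinarith
    have h5 : 0.1 < l ^ 5 := lt_of_lt_of_le (by norm_num) (pow_le_pow_left₀ (by norm_num) hl.le 5)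
    rw [show (10 : ℝ) ^ 12 * (l ^ 6 / (α ^ 4 * ε ^ 2)) * ((α / 4) ^ 4 * 0.69) =
      10 ^ 12 * (l ^ 5 * l) * 0.69 / 256 / ε ^ 2 by field_simp; ring, lt_div_iff₀ (by positivity)]
    nlinarith
  · set L := numHalvings (α / 2) n with hL
    set A := packingSup (Set.range u) 4 (α / 4) with hA
    have hA0 : 0 ≤ A := packingSup_nonneg h01 4 (by positivity)
    have hLl : (L : ℝ) ≤ 5 * l := numHalvings_le_log hα0 hα n
    have hS2 : ∑ v ∈ Finset.range L, (((1 / 2) ^ v) ^ 2 *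
        √(Real.log ((sepNumber (Set.range u) ((1 / 2) ^ v / 2)).toNat : ℝ))) / 1 ≤
        L * (4 * √A) := by
      calc _ ≤ ∑ _v ∈ Finset.range L, 4 * √A := by
            refine Finset.sum_le_sum fun v hv => ?_
            rw [div_one]
            refine (pow_mul_sqrt_log_le h01 hα0 2 (Finset.mem_range.1 hv)).trans (le_of_eq ?_)
            norm_num [hA]
        _ = _ := by simp
    calc _ ≤ L * (L * (4 * √A)) * √L * 1200 := by
          rw [Finset.sum_const, Finset.card_range, nsmul_eq_mul, mul_one]
          gcongr
      _ = 4800 * L ^ 2 * √(A * L) := by rw [Real.sqrt_mul hA0]; ring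
      _ ≤ (α ^ 2 * ε) * √n := by
          refine mul_sqrt_le_of_sq_le (by positivity) (by positivity) (Nat.cast_nonneg n) ?_
          have h3 : 10 ^ 12 * l ^ 6 * A ≤ (α ^ 2 * ε) ^ 2 * n := by
            calc _ = 10 ^ 12 * (l ^ 6 / (α ^ 4 * ε ^ 2)) * A * (α ^ 2 * ε) ^ 2 := by field_simp
              _ ≤ n * (α ^ 2 * ε) ^ 2 := by gcongr
              _ = _ := mul_comm _ _
          -- Squaring L² √L gives L⁵. The sixth power of the logarithm leaves one to spare.
          have h4 : 4800 ^ 2 * (L : ℝ) ^ 5 ≤ 10 ^ 12 * l ^ 6 := by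
            have h5 : (L : ℝ) ^ 5 ≤ (5 * l) ^ 5 := pow_le_pow_left₀ (Nat.cast_nonneg L) hLl 5
            have h6 : 0.69 * l ^ 5 ≤ l * l ^ 5 := mul_le_mul_of_nonneg_right hl.le (by positivity)
            have h7 : 0 < l ^ 5 := by positivity
            rw [mul_pow] at h5
            rw [show l ^ 6 = l * l ^ 5 by ring]
            linarith
          calc (4800 * (L : ℝ) ^ 2) ^ 2 * (A * L) = 4800 ^ 2 * (L : ℝ) ^ 5 * A := by ring
            _ ≤ 10 ^ 12 * l ^ 6 * A := mul_le_mul_of_nonneg_right h4 hA0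
            _ ≤ _ := h3
      _ = _ := mul_assoc _ _ _

end Error

end LocalModel

end

/-! ### Both bounds, for one and the same protocol. -/

theorem theorem5 :
    ∃ (C K : ℝ) (_ : 0 < C) (_ : 0 < K)
      (P_CPM P_CM : LocalModel.Protocol) (p : Polynomial ℕ),
      ∀ (m N n : ℕ) (u : Fin N → EuclideanSpace ℝ (Fin m)),
        Function.Injective u → (∀ k j, u k j ∈ Set.Icc (0 : ℝ) 1) → 0 < n →
        ∀ α ε : ℝ, 0 < α → 0 < ε → ε ≤ 3 / 2 →
          -- the local coarse projection mechanism
          (P_CPM.IsLDP u n α ε ∧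
            (∀ (a : Fin n → Fin N) (ω : (Fin n → LocalModel.Tape) × LocalModel.Tape),
              P_CPM.totalTime u n α ε (fun i => u (a i)) ω ≤ p.eval (N + n + m)) ∧
            (K * (Real.log (1 / α) ^ 2 / (α ^ 4 * ε ^ 2)) *
                LocalModel.packingSup (Set.range u) 2 (α / C) ≤ n →
              P_CPM.err u n α ε ≤ ENNReal.ofReal α)) ∧
          -- the local chaining mechanism
          (P_CM.IsLDP u n α ε ∧
            (∀ (a : Fin n → Fin N) (ω : (Fin n → LocalModel.Tape) × LocalModel.Tape),
              P_CM.totalTime u n α ε (fun i => u (a i)) ω ≤ p.eval (N + n + m)) ∧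
            (K * (Real.log (1 / α) ^ 6 / (α ^ 4 * ε ^ 2)) *
                LocalModel.packingSup (Set.range u) 4 (α / C) ≤ n →
              P_CM.err u n α ε ≤ ENNReal.ofReal α)) := by
  -- C = 4 because the chain stops near α/2 and the finer net of each level lives at half the scale
  -- of the level. The program does not depend on which bound is wanted; only the weights in the
  -- analysis do.
  refine ⟨4, 10 ^ 12, by norm_num, by norm_num, LocalModel.chainingProtocol,
    LocalModel.chainingProtocol, LocalModel.chainingTime, ?_⟩
  intro m N n u hu h01 hn α ε hα h0 h1
  have hldp := LocalModel.chainingProtocol_isLDP hu n α h0 h1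
  exact ⟨⟨hldp, fun a ω => LocalModel.chainingProtocol_totalTime u n α ε _ ω,
      LocalModel.chainingProtocol_err_le_of_sq hu h01 hn hα h0 h1⟩,
    hldp, fun a ω => LocalModel.chainingProtocol_totalTime u n α ε _ ω,
      LocalModel.chainingProtocol_err_le_of_pow_four hu h01 hn hα h0 h1⟩
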